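/- **Koppelman's formula.** Let $n\ge 1$, let $\Omega\subset\mathbb C^n$ be open, and let $D\Subset\Omega$ be an open set with $C^1$ boundary, $\partial D$ being oriented as the boundary of $D$. Let $\phi$ be a $(p,q)$-form which is smooth on $\overline D$. Write $(\zeta,z)$ for the coordinates on $\Omega\times\Omega$ and $[\Delta]$ for the current of integration over the diagonal $\Delta=\{\zeta=z\}$. Let $K$ be a current of bidegree $(n,n-1)$ and $P$ a smooth form of bidegree $(n,n)$ on $\Omega\times\Omega$ such that $$\bar\partial K=[\Delta]-P$$ in the sense of currents. Assume that $K$ is given by a continuous form on a neighbourhood of $(\partial D\cap\operatorname{supp}\phi)\times D$ in $\Omega\times\Omega$, so that the boundary integral below makes sense; this holds for instance if $K$ is smooth outside $\Delta$, and always if $\phi$ has compact support in $D$. Then, as currents of bidegree $(p,q)$ on $D$, $$\phi(z)=\int_{\partial D}K\wedge\phi+\int_D K\wedge\bar\partial\phi+\bar\partial_z\int_D K\wedge\phi+\int_D P\wedge\phi ,$$ where all integrals are taken over $\zeta$. Here the meaning of the terms is as follows. The equality is tested against smooth forms $\psi$ of bidegree $(n-p,n-q)$ with compact support in $D$; in particular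 only the component of bidegree $(p,q)$ in $z$ of the boundary integral enters. The boundary integral and the integral of $P\wedge\phi$ are forms in $z$, computed with the differentials of $\zeta$ placed first, so that $\int_z\bigl(\int_\zeta\alpha\bigr)\wedge\psi(z)=\int_{(\zeta,z)}\alpha\wedge\psi(z)$. For $\alpha=\phi$ and $\alpha=\bar\partial\phi$, $\int_D K\wedge\alpha$ is the current $\psi\mapsto\lim_{j\to\infty}K\bigl(\chi_j(\zeta)\,\alpha(\zeta)\wedge\psi(z)\bigr)$ on $D$, where $\chi_j$ are smooth functions with compact support in $D$ and values in $[0,1]$ such that on each compact subset of $D$ one has $\chi_j=1$ for all large $j$; it is part of the claim that these limits exist, do not depend on the choice of $(\chi_j)$, and define currents. A current $T$ of degree $r$ is differentiated by $(\bar\partial T)(\psi)=(-1)^{r+1}T(\bar\partial\psi)$, and a form $\alpha$ is identified with the current $\psi\mapsto\int\alpha\wedge\psi$. -/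

import Mathlib

open Set Filter Topology MeasureTheory TopologicalSpace
open scoped ContDiff Distributions

noncomputable section

namespace Koppelman

/-! ### Differential forms on `ℂ^m` with complex coefficients

A form on `ℂ^m` is written in the coframe `dz₁, dz̄₁, dz₂, dz̄₂, …, dz_m, dz̄_m`, in this order:
its value at a point is the family of its coefficients with respect to the monomials
`e_S = e_{s₁} ∧ ⋯ ∧ e_{s_k}`, `S = {s₁ < ⋯ < s_k}`. Forms need not be homogeneous. -/

/-- The space `ℂ^m`. -/
abbrev Cn (m : ℕ) : Type := Fin m → ℂ

/-- Labels of the coframe: `(j, false)` stands for `dz_j`, `(j, true)` for `dz̄_j`. -/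
abbrev Idx (m : ℕ) : Type := Fin m ×ₗ Bool

/-- The exterior algebra of the complexified cotangent space of `ℂ^m`, in coordinates. -/
abbrev ExtAlg (m : ℕ) : Type := Finset (Idx m) → ℂ

variable {m n : ℕ}

/-- The sign in `e_A ∧ e_B = ± e_{A ∪ B}`, for `A` and `B` disjoint: the parity of the number of
pairs that have to be interchanged. -/
def wedgeSign (A B : Finset (Idx m)) : ℂ :=
  (-1) ^ ((A ×ˢ B).filter fun c => c.2 < c.1).card

/-- The exterior product. -/
def wedge (a b : ExtAlg m) : ExtAlg m :=
  fun S => ∑ A ∈ S.powerset, wedgeSign A (S \ A) * a A * b (S \ A)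

/-- The covector `dz̄_j`. -/
def dzbar (j : Fin m) : ExtAlg m := Pi.single {toLex (j, true)} 1

/-- The number of factors `dz_j` in `e_S`. -/
def holDeg (S : Finset (Idx m)) : ℕ := (S.filter fun c => (ofLex c).2 = false).card

/-- The number of factors `dz̄_j` in `e_S`. -/
def antiDeg (S : Finset (Idx m)) : ℕ := (S.filter fun c => (ofLex c).2 = true).card

/-- `a` is of bidegree `(p, q)`. -/
def IsBidegree (p q : ℕ) (a : ExtAlg m) : Prop :=
  ∀ S, a S ≠ 0 → holDeg S = p ∧ antiDeg S = q

/-- `a` is of bidegree `(m - p, m - q)`. -/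
def IsComplBidegree (p q : ℕ) (a : ExtAlg m) : Prop :=
  ∀ S, a S ≠ 0 → holDeg S + p = m ∧ antiDeg S + q = m

/-- Left exterior multiplication by `a`, as a continuous linear map. -/
def wedgeCLM (a : ExtAlg m) : ExtAlg m →L[ℂ] ExtAlg m :=
  LinearMap.toContinuousLinearMap
    { toFun := wedge a
      map_add' := fun b c => by
        funext S; simp [wedge, mul_add, Finset.sum_add_distrib]
      map_smul' := fun r b => by
        funext S
        simp only [wedge, Pi.smul_apply, smul_eq_mul, RingHom.id_apply, Finset.mul_sum]
        exact Finset.sum_congr rfl fun A _ => by ring }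

/-- The map which is multiplication by `(-1)^k` on forms of degree `k`. -/
def gradeInvol : ExtAlg m →L[ℂ] ExtAlg m :=
  ContinuousLinearMap.pi fun S => ((-1 : ℂ) ^ S.card) • ContinuousLinearMap.proj S

/-- The value `a(v₁, …, v_k)` of (the component of degree `k` of) `a` on `k` tangent vectors, with
`e_S(v₁, …, v_k) = det (e_{s_a}(v_b))`, `dz_j(v) = v_j` and `dz̄_j(v) = conj v_j`. -/
def evalForm {k : ℕ} (a : ExtAlg m) (v : Fin k → Cn m) : ℂ :=
  ∑ S : {S : Finset (Idx m) // S.card = k}, a S.1 *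
    Matrix.det (Matrix.of fun i b : Fin k =>
      let c := ofLex (S.1.orderEmbOfFin S.2 i)
      if c.2 then (starRingEnd ℂ) (v b c.1) else v b c.1)

/-- The integral over `A ⊆ ℂ^m` of (the component of top degree of) a form. Here
`dz₁ ∧ dz̄₁ ∧ ⋯ ∧ dz_m ∧ dz̄_m = (-2i)^m dV`, with `dV` the Lebesgue measure. -/
def integralForm (A : Set (Cn m)) (θ : Cn m → ExtAlg m) : ℂ :=
  (-2 * Complex.I) ^ m * ∫ x in A, θ x Finset.univ

/-- `∂̄θ = ∑_j dz̄_j ∧ ∂θ/∂z̄_j`, where `∂/∂z̄_j = (∂/∂x_j + i ∂/∂y_j) / 2`. -/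
def dbar (θ : Cn m → ExtAlg m) (x : Cn m) : ExtAlg m :=
  ∑ j : Fin m, wedge (dzbar j)
    ((1 / 2 : ℂ) • (fderiv ℝ θ x (Pi.single j 1 : Cn m) +
      Complex.I • fderiv ℝ θ x (Pi.single j Complex.I : Cn m)))

/-! ### Currents -/

/-- The derivative of a test form along `v`. -/
def derivTest {Ω : Opens (Cn m)} (v : Cn m) : 𝓓(Ω, ExtAlg m) →L[ℂ] 𝓓(Ω, ExtAlg m) :=
  TestFunction.lineDerivCLM ℂ v

/-- `∂̄` on test forms; see `dbarTest_apply`. -/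
def dbarTest {Ω : Opens (Cn m)} : 𝓓(Ω, ExtAlg m) →L[ℂ] 𝓓(Ω, ExtAlg m) :=
  ∑ j : Fin m,
    (TestFunction.postcompCLM ((1 / 2 : ℂ) • wedgeCLM (dzbar j)) ∘L derivTest (Pi.single j 1) +
      TestFunction.postcompCLM ((Complex.I / 2 : ℂ) • wedgeCLM (dzbar j)) ∘L
        derivTest (Pi.single j Complex.I))

theorem dbarTest_apply {Ω : Opens (Cn m)} (ψ : 𝓓(Ω, ExtAlg m)) (x : Cn m) :
    dbarTest ψ x = dbar ψ x := by
  have hd : ∀ v : Cn m, (derivTest v ψ) x = fderiv ℝ ψ x v := by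
    intro v
    rw [derivTest, TestFunction.lineDerivCLM_apply_of_le (by simp)]
    exact ((ψ.contDiff.differentiable (by simp)) x).lineDeriv_eq_fderiv
  have hs : ∀ (s : Finset (Fin m)) (f : Fin m → 𝓓(Ω, ExtAlg m)),
      (∑ j ∈ s, f j) x = ∑ j ∈ s, f j x := by
    intro s f
    induction s using Finset.cons_induction with
    | empty => simp
    | cons j s hj ih => rw [Finset.sum_cons, Finset.sum_cons, ← ih]; rfl
  rw [dbarTest, sum_apply, hs, dbar]
  refine Finset.sum_congr rfl fun j _ => ?_
  have hw : ∀ a, wedge (dzbar j) a = wedgeCLM (dzbar j) a := fun _ => rfl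
  change ((1 / 2 : ℂ) • wedgeCLM (dzbar j)) (derivTest (Pi.single j 1 : Cn m) ψ x) +
    ((Complex.I / 2 : ℂ) • wedgeCLM (dzbar j)) (derivTest (Pi.single j Complex.I : Cn m) ψ x) = _
  rw [hd, hd, hw, map_smul, map_add, map_smul, smul_add, smul_smul]
  rw [show (Complex.I / 2 : ℂ) = 1 / 2 * Complex.I by ring]
  rfl

/-- A current on `Ω` is a continuous linear functional on the smooth forms with compact support
in `Ω`. A form `θ` defines the current `Ψ ↦ ∫ θ ∧ Ψ`. -/
abbrev Current (Ω : Opens (Cn m)) : Type := 𝓓(Ω, ExtAlg m) →L[ℂ] ℂ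

/-- `∂̄T`: on test forms of degree `k`, `(∂̄T)(Ψ) = (-1)^k T(∂̄Ψ)`. If `T` has degree `r` this is
the usual `(-1)^(r+1) T(∂̄Ψ)`, as only `k = 2m - r - 1` matters. -/
def Current.dbar {Ω : Opens (Cn m)} (T : Current Ω) : Current Ω :=
  T ∘L dbarTest ∘L TestFunction.postcompCLM gradeInvol

/-- `T` has bidegree `(p, q)`: it only sees the component of bidegree `(m - p, m - q)` of a test
form. -/
def Current.HasBidegree {Ω : Opens (Cn m)} (T : Current Ω) (p q : ℕ) : Prop :=
  ∀ Ψ : 𝓓(Ω, ExtAlg m), (∀ x S, holDeg S + p = m → antiDeg S + q = m → Ψ x S = 0) → T Ψ = 0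

/-! ### Forms on the product `ℂ^n_ζ × ℂ^n_z = ℂ^(n+n)` -/

/-- The set of all `(ζ, z)` with `ζ ∈ Ω₁` and `z ∈ Ω₂`; the coordinates `ζ` come first. -/
def prodOpens (Ω₁ Ω₂ : Opens (Cn n)) : Opens (Cn (n + n)) where
  carrier := {w | (fun i => w (Fin.castAdd n i)) ∈ Ω₁ ∧ (fun i => w (Fin.natAdd n i)) ∈ Ω₂}
  is_open' :=
    (Ω₁.isOpen.preimage (by fun_prop)).inter (Ω₂.isOpen.preimage (by fun_prop))

/-- `dζ_j` and `dζ̄_j` among the covectors of the product. -/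
def idxZeta : Idx n ↪ Idx (n + n) where
  toFun c := toLex (Fin.castAdd n (ofLex c).1, (ofLex c).2)
  inj' c d h := by
    have h' := congrArg (fun t => ofLex t) h
    simp only [ofLex_toLex, Prod.mk.injEq] at h'
    exact Prod.ext ((Fin.castAdd_injective n n) h'.1) h'.2

/-- `dz_j` and `dz̄_j` among the covectors of the product. -/
def idxZ : Idx n ↪ Idx (n + n) where
  toFun c := toLex (Fin.natAdd n (ofLex c).1, (ofLex c).2)
  inj' c d h := by
    have h' := congrArg (fun t => ofLex t) h
    simp only [ofLex_toLex, Prod.mk.injEq] at h'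
    exact Prod.ext ((Fin.natAdd_injective n n) h'.1) h'.2

/-- The monomial `e_A(ζ) ∧ e_B(z)` on the product. -/
def idxPair (A B : Finset (Idx n)) : Finset (Idx (n + n)) := A.map idxZeta ∪ B.map idxZ

/-- A form in `ζ`, seen on the product. -/
def liftZeta (a : ExtAlg n) : ExtAlg (n + n) := fun S => ∑ A, if A.map idxZeta = S then a A else 0

/-- A form in `z`, seen on the product. -/
def liftZ (a : ExtAlg n) : ExtAlg (n + n) := fun S => ∑ A, if A.map idxZ = S then a A else 0

/-- For `α = ∑_B α_B ∧ e_B(z)`, where `α_B` contains no `dz_j`, `dz̄_j`, this is `α_B`. -/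
def slice (α : ExtAlg (n + n)) (B : Finset (Idx n)) : ExtAlg n := fun A => α (idxPair A B)

/-- The pullback of a form under `z ↦ (z, z)`. -/
def pullDiag (α : ExtAlg (n + n)) : ExtAlg n := ∑ B, wedge (slice α B) (Pi.single B 1)

/-- The current of integration `[Δ]` over the diagonal of `Ω × Ω`, evaluated at a test form. -/
def diagCurrent (Ω : Opens (Cn n)) (Ψ : 𝓓(prodOpens Ω Ω, ExtAlg (n + n))) : ℂ :=
  integralForm (Ω : Set (Cn n)) fun z => pullDiag (Ψ (Fin.append z z))

/-- The integral `∫_{ζ ∈ D} α(ζ, z)`, a form in `z`; it satisfies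
`∫_z (∫_ζ α) ∧ ψ(z) = ∫_{(ζ, z)} α ∧ ψ(z)`. -/
def fiberIntegralForm (D : Set (Cn n)) (α : Cn (n + n) → ExtAlg (n + n)) (z : Cn n) : ExtAlg n :=
  fun B => integralForm D fun ζ => slice (α (Fin.append ζ z)) B

/-! ### The boundary of a domain -/

/-- `ρ` is a `C¹` defining function of `D` near the point `x`. -/
def IsLocalDefiningFunction (D : Set (Cn n)) (x : Cn n) (ρ : Cn n → ℝ) : Prop :=
  ContDiffAt ℝ 1 ρ x ∧ ρ x = 0 ∧ fderiv ℝ ρ x ≠ 0 ∧ ∀ᶠ y in 𝓝 x, (y ∈ D ↔ ρ y < 0)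

/-- `D` has `C¹` boundary. -/
def HasC1Boundary (D : Set (Cn n)) : Prop :=
  ∀ x ∈ frontier D, ∃ ρ, IsLocalDefiningFunction D x ρ

/-- `dV(v₁, …, v_k)` for `k = 2n`, the real determinant of the vectors with respect to the
standard orientation of `ℂ^n`. -/
def orientedVolume {k : ℕ} (v : Fin k → Cn n) : ℝ :=
  (evalForm (Pi.single Finset.univ 1) v / (-2 * Complex.I) ^ n).re

/-- The partial derivatives of a parametrization. -/
def tangentFrame {k : ℕ} (γ : (Fin k → ℝ) → Cn n) (t : Fin k → ℝ) (b : Fin k) : Cn n :=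
  fderiv ℝ γ t (Pi.single b 1)

/-- The data for integration over `∂D`: finitely many positively oriented injective local `C¹`
parametrizations of `∂D`, and a continuous partition of unity subordinate to them. The orientation
is that of the boundary of `D`: an outward pointing vector followed by a positively oriented frame
of `∂D` is a positively oriented frame of `ℂ^n`. -/
structure BoundaryAtlas (D : Set (Cn n)) where
  N : ℕ
  dom : Fin N → Set (Fin (2 * n - 1) → ℝ)
  param : Fin N → (Fin (2 * n - 1) → ℝ) → Cn n
  weight : Fin N → Cn n → ℝ
  isOpen_dom : ∀ i, IsOpen (dom i)
  contDiffOn_param : ∀ i, ContDiffOn ℝ 1 (param i) (dom i)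
  injOn_param : ∀ i, InjOn (param i) (dom i)
  mapsTo_param : ∀ i, MapsTo (param i) (dom i) (frontier D)
  oriented : ∀ i, ∀ t ∈ dom i, ∀ (ρ : Cn n → ℝ) (v : Cn n),
    IsLocalDefiningFunction D (param i t) ρ → 0 < fderiv ℝ ρ (param i t) v →
      0 < orientedVolume (Fin.cons v (tangentFrame (param i) t) : Fin (2 * n - 1 + 1) → Cn n)
  continuous_weight : ∀ i, ContinuousOn (weight i) (frontier D)
  subordinate : ∀ i, ∃ L : Set (Fin (2 * n - 1) → ℝ), IsCompact L ∧ L ⊆ dom i ∧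
    ∀ x ∈ frontier D, weight i x ≠ 0 → x ∈ param i '' L
  sum_weight : ∀ x ∈ frontier D, ∑ i, weight i x = 1

/-- The integral over `∂D` of (the component of degree `2n - 1` of) a form. -/
def BoundaryAtlas.integral {D : Set (Cn n)} (𝔞 : BoundaryAtlas D) (θ : Cn n → ExtAlg n) : ℂ :=
  ∑ i, ∫ t in 𝔞.dom i, (𝔞.weight i (𝔞.param i t) : ℂ) *
    evalForm (θ (𝔞.param i t)) (tangentFrame (𝔞.param i) t)

/-- The integral `∫_{ζ ∈ ∂D} α(ζ, z)`, a form in `z`; the differentials of `ζ` are put first, as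
in `fiberIntegralForm`, so that `∫_z (∫_{ζ ∈ ∂D} α) ∧ ψ(z)` is the integral of `α ∧ ψ(z)` over
`∂D × ℂ^n`. -/
def BoundaryAtlas.fiberIntegral {D : Set (Cn n)} (𝔞 : BoundaryAtlas D)
    (α : Cn (n + n) → ExtAlg (n + n)) (z : Cn n) : ExtAlg n :=
  fun B => 𝔞.integral fun ζ => slice (α (Fin.append ζ z)) B

/-! ### The current `∫_{ζ ∈ D} K ∧ α` -/

theorem contDiffOn_dbar {Ω : Set (Cn m)} (hΩ : IsOpen Ω) {θ : Cn m → ExtAlg m}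
    (hθ : ContDiffOn ℝ ∞ θ Ω) : ContDiffOn ℝ ∞ (dbar θ) Ω := by
  have h : ContDiffOn ℝ ∞ (fderiv ℝ θ) Ω := hθ.fderiv_of_isOpen hΩ (by simp)
  have h' : ∀ v : Cn m, ContDiffOn ℝ ∞ (fun x => fderiv ℝ θ x v) Ω := fun v =>
    h.clm_apply contDiffOn_const
  refine ContDiffOn.sum fun j _ => ?_
  exact ((wedgeCLM (dzbar j)).restrictScalars ℝ).contDiff.comp_contDiffOn
    (((h' _).add ((h' _).const_smul Complex.I)).const_smul (1 / 2 : ℂ))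

/-- `χ • α`, for a smooth form `α` on `D` and a cut-off function `χ` on `D`. -/
def cutoff {D : Opens (Cn n)} (χ : 𝓓(D, ℝ)) (α : Cn n → ExtAlg n)
    (hα : ContDiffOn ℝ ∞ α (D : Set (Cn n))) : 𝓓(D, ExtAlg n) where
  toFun x := χ x • α x
  contDiff' := by
    refine contDiff_iff_contDiffAt.2 fun x => ?_
    by_cases hx : x ∈ tsupport χ
    · exact (χ.contDiff.contDiffAt).smul
        (hα.contDiffAt (D.isOpen.mem_nhds (χ.tsupport_subset hx)))
    · have h0 : (fun y => χ y • α y) =ᶠ[𝓝 x] fun _ => 0 := by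
        filter_upwards [notMem_tsupport_iff_eventuallyEq.1 hx] with y hy
        simp [hy]
      exact contDiffAt_const.congr_of_eventuallyEq h0
  hasCompactSupport' := χ.hasCompactSupport.smul_right
  tsupport_subset' := (tsupport_smul_subset_left _ _).trans χ.tsupport_subset

theorem wedge_zero_left (b : ExtAlg m) : wedge 0 b = 0 := by
  funext S; simp [wedge]

theorem wedge_zero_right (a : ExtAlg m) : wedge a 0 = 0 := by
  funext S; simp [wedge]

theorem liftZeta_zero : liftZeta (0 : ExtAlg n) = 0 := by
  funext S; simp [liftZeta]

theorem liftZ_zero : liftZ (0 : ExtAlg n) = 0 := by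
  funext S; simp [liftZ]

theorem isCompact_append {L₁ L₂ : Set (Cn n)} (h₁ : IsCompact L₁) (h₂ : IsCompact L₂) :
    IsCompact ((fun x : Cn n × Cn n => (Fin.append x.1 x.2 : Cn (n + n))) '' (L₁ ×ˢ L₂)) := by
  refine (h₁.prod h₂).image (continuous_pi fun i => ?_)
  refine Fin.addCases (fun j => ?_) (fun j => ?_) i
  · simp only [Fin.append_left]; fun_prop
  · simp only [Fin.append_right]; fun_prop

theorem support_extProd_subset (a b : Cn n → ExtAlg n) :
    Function.support (fun w : Cn (n + n) => wedge (liftZeta (a fun i => w (Fin.castAdd n i)))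
      (liftZ (b fun i => w (Fin.natAdd n i)))) ⊆
    (fun x : Cn n × Cn n => (Fin.append x.1 x.2 : Cn (n + n))) '' (tsupport a ×ˢ tsupport b) := by
  intro w hw
  refine ⟨(fun i => w (Fin.castAdd n i), fun i => w (Fin.natAdd n i)), ⟨?_, ?_⟩,
    Fin.append_castAdd_natAdd⟩
  · refine subset_tsupport a fun h => hw ?_
    change wedge (liftZeta (a _)) _ = 0
    rw [h, liftZeta_zero, wedge_zero_left]
  · refine subset_tsupport b fun h => hw ?_
    change wedge _ (liftZ (b _)) = 0
    rw [h, liftZ_zero, wedge_zero_right]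

/-- The test form `a(ζ) ∧ b(z)` on the product. -/
def extProd {D₁ D₂ : Opens (Cn n)} (a : 𝓓(D₁, ExtAlg n)) (b : 𝓓(D₂, ExtAlg n)) :
    𝓓(prodOpens D₁ D₂, ExtAlg (n + n)) where
  toFun w := wedge (liftZeta (a fun i => w (Fin.castAdd n i)))
    (liftZ (b fun i => w (Fin.natAdd n i)))
  contDiff' := by
    have ha : ContDiff ℝ ∞ fun w : Cn (n + n) => a fun i => w (Fin.castAdd n i) :=
      a.contDiff.comp (by fun_prop)
    have hb : ContDiff ℝ ∞ fun w : Cn (n + n) => b fun i => w (Fin.natAdd n i) :=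
      b.contDiff.comp (by fun_prop)
    have ha' := contDiff_pi.1 ha
    have hb' := contDiff_pi.1 hb
    refine contDiff_pi.2 fun S => ContDiff.sum fun A _ => ?_
    refine (contDiff_const.mul ?_).mul ?_
    · refine ContDiff.sum fun B _ => ?_
      split_ifs
      · exact ha' B
      · exact contDiff_const
    · refine ContDiff.sum fun B _ => ?_
      split_ifs
      · exact hb' B
      · exact contDiff_const
  hasCompactSupport' := HasCompactSupport.of_support_subset_isCompact
    (isCompact_append a.hasCompactSupport b.hasCompactSupport) (support_extProd_subset a b)
  tsupport_subset' := by
    refine (closure_minimal (support_extProd_subset a b)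
      (isCompact_append a.hasCompactSupport b.hasCompactSupport).isClosed).trans ?_
    rintro _ ⟨x, ⟨h₁, h₂⟩, rfl⟩
    refine ⟨?_, ?_⟩
    · simp only [Fin.append_left]
      exact a.tsupport_subset h₁
    · simp only [Fin.append_right]
      exact b.tsupport_subset h₂

/-- A sequence of cut-off functions on `D` with values in `[0, 1]` which are eventually equal to
`1` on each compact subset of `D`. -/
structure IsExhausting {D : Opens (Cn n)} (χ : ℕ → 𝓓(D, ℝ)) : Prop where
  mem_Icc : ∀ j x, χ j x ∈ Icc (0 : ℝ) 1
  eventually_one : ∀ L : Set (Cn n), IsCompact L → L ⊆ D → ∀ᶠ j in atTop, ∀ x ∈ L, χ j x = 1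

/-- The current `T` on `D` is `∫_{ζ ∈ D} K ∧ α`: for each test form `ψ` on `D`, `T(ψ)` is the
integral of `K ∧ α(ζ) ∧ ψ(z)` over `D × D`. As `K` is a current and `α` need not have compact
support in `D`, this integral is the limit of `K(χ_j(ζ) α(ζ) ∧ ψ(z))` for cut-off functions `χ_j`
that tend to the indicator function of `D`; the limit has to be the same for all choices. -/
def IsFiberIntegral {Ω D : Opens (Cn n)} (K : Current (prodOpens Ω Ω)) (α : Cn n → ExtAlg n)
    (hα : ContDiffOn ℝ ∞ α (D : Set (Cn n))) (T : Current D) : Prop :=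
  ∀ χ : ℕ → 𝓓(D, ℝ), IsExhausting χ → ∀ ψ : 𝓓(D, ExtAlg n),
    Tendsto (fun j => K (TestFunction.monoCLM ℂ (extProd (cutoff (χ j) α hα) ψ))) atTop
      (𝓝 (T ψ))

end Koppelman

end

open Koppelman

/-!
Koppelman's formula is the equation `∂̄K = [Δ] - P`, tested against `χ_j(ζ) φ(ζ) ∧ ψ(z)` for cut-off
functions `χ_j` on `D` that increase to the indicator function of `D`.

By the product rule (`dbar_monoCLM_extProd`, `dbarTest_cutoff_sub`), `∂̄K` of this form is the sum of
`K(∂̄χ_j ∧ φ ∧ ψ)`, `K(χ_j ∂̄φ ∧ ψ)` and `± K(χ_j φ ∧ ∂̄ψ)`. The diagonal contributes `∫ φ ∧ ψ` as soon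
as `χ_j = 1` on the support of `ψ` (`diagCurrent_monoCLM_extProd`), and the term with `P` converges
by dominated convergence (`tendsto_integralForm_extProd`). The second and the third term converge to
the values of the currents `∫_D K ∧ ∂̄φ` and `∂̄_z ∫_D K ∧ φ`, once these are known to exist, and the
first term has to converge to the boundary integral.

The existence of the currents (`exists_isFiberIntegral`) rests on `exists_localKernel`: if `z` stays
in a compact part of `D`, then `K` is given by a bounded continuous form for all `ζ` in the support
of `φ` outside a compact part of `D`. Hence `K(χ_j φ ∧ ψ)` is a fixed number `K(χ_{j₀} φ ∧ ψ)`,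
continuous in `ψ`, plus an integral to which dominated convergence applies.

For the first term, the limits in the definition of the currents do not depend on the sequence
`χ_j`, so this sequence may be chosen. With the same local kernel and Fubini's theorem the term
becomes `-∫ ∂̄χ_j ∧ Θ`, for a continuous form `Θ` in `ζ` that is of bidegree `(n, n - 1)` on `∂D`
(`kernelFunctional_dbarFun`), and it has to be shown that `∂̄χ_j` tends to minus the boundary current
in the sense of measures (`exists_isExhausting_tendsto_integral`). For this the indicator function of
`D` is smoothed: locally, by convolution with bump functions whose supports are shifted in a
direction transverse to `∂D`, so that the result has compact support in `D`, and globally with a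
partition of unity. The derivatives of a smoothed indicator function are boundary integrals by the
divergence theorem (`integral_fderiv_eq_flux`), and these converge as the bump functions form an
approximate identity.

The divergence theorem for the given parametrizations of `∂D` is proved locally, for derivatives in
a transverse direction `u`. The maps `(s, t) ↦ γ(t) + s u`, `s < 0`, sweep out `D` near a boundary
point, with Jacobian equal to the flux density of `u`; the change of variables and the fundamental
theorem of calculus along the lines in direction `u` give the result (`stokes_of_isTransverse`). As
the transverse directions form an open cone, they span all directions.
-/

noncomputable section

namespace Koppelman

variable {m n : ℕ}

/-! ### Exterior algebra -/

theorem wedgeSign_union_left {A B : Finset (Idx m)} (h : Disjoint A B) (C : Finset (Idx m)) :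
    wedgeSign (A ∪ B) C = wedgeSign A C * wedgeSign B C := by
  rw [wedgeSign, Finset.union_product, Finset.filter_union, Finset.card_union_of_disjoint, pow_add]
  · rfl
  · refine Finset.disjoint_filter_filter ?_
    rw [Finset.disjoint_left]
    intro x hx hx'
    exact Finset.disjoint_left.1 h (Finset.mem_product.1 hx).1 (Finset.mem_product.1 hx').1

theorem wedgeSign_union_right {A B : Finset (Idx m)} (h : Disjoint A B) (C : Finset (Idx m)) :
    wedgeSign C (A ∪ B) = wedgeSign C A * wedgeSign C B := by
  rw [wedgeSign, Finset.product_union, Finset.filter_union, Finset.card_union_of_disjoint, pow_add]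
  · rfl
  · refine Finset.disjoint_filter_filter ?_
    rw [Finset.disjoint_left]
    intro x hx hx'
    exact Finset.disjoint_left.1 h (Finset.mem_product.1 hx).2 (Finset.mem_product.1 hx').2

theorem wedgeSign_mul_self (A B : Finset (Idx m)) : wedgeSign A B * wedgeSign A B = 1 := by
  rw [wedgeSign, ← mul_pow]; norm_num

theorem wedgeSign_empty_left (B : Finset (Idx m)) : wedgeSign ∅ B = 1 := by simp [wedgeSign]

theorem wedgeSign_empty_right (A : Finset (Idx m)) : wedgeSign A ∅ = 1 := by simp [wedgeSign]

theorem wedge_add_left (a b c : ExtAlg m) : wedge (a + b) c = wedge a c + wedge b c := by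
  funext S; simp [wedge, mul_add, add_mul, Finset.sum_add_distrib]

theorem wedge_add_right (a b c : ExtAlg m) : wedge a (b + c) = wedge a b + wedge a c :=
  map_add (wedgeCLM a) b c

theorem wedge_smul_left (r : ℂ) (a b : ExtAlg m) : wedge (r • a) b = r • wedge a b := by
  funext S
  simp only [wedge, Pi.smul_apply, smul_eq_mul, Finset.mul_sum]
  exact Finset.sum_congr rfl fun A _ => by ring

theorem wedge_smul_right (r : ℂ) (a b : ExtAlg m) : wedge a (r • b) = r • wedge a b :=
  map_smul (wedgeCLM a) r b

theorem wedge_sum_right {ι : Type*} (s : Finset ι) (a : ExtAlg m) (f : ι → ExtAlg m) :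
    wedge a (∑ i ∈ s, f i) = ∑ i ∈ s, wedge a (f i) :=
  map_sum (wedgeCLM a) f s

/-- The exterior product as a continuous bilinear map. -/
def wedgeBilin (m : ℕ) : ExtAlg m →L[ℂ] ExtAlg m →L[ℂ] ExtAlg m :=
  LinearMap.toContinuousLinearMap
    { toFun := wedgeCLM
      map_add' := fun a b => ContinuousLinearMap.ext fun c => wedge_add_left a b c
      map_smul' := fun r a => ContinuousLinearMap.ext fun c => wedge_smul_left r a c }

theorem wedgeBilin_apply (a b : ExtAlg m) : wedgeBilin m a b = wedge a b := rfl

theorem wedge_assoc (a b c : ExtAlg m) : wedge (wedge a b) c = wedge a (wedge b c) := by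
  funext S
  simp only [wedge, Finset.mul_sum, Finset.sum_mul]
  rw [Finset.sum_sigma', Finset.sum_sigma']
  -- both sides are sums over decompositions `S = A ∪ B ∪ C`: `(A ∪ B, A)` corresponds to `(A, B)`
  refine Finset.sum_bij' (fun x _ => ⟨x.2, x.1 \ x.2⟩) (fun x _ => ⟨x.1 ∪ x.2, x.1⟩) ?_ ?_ ?_ ?_ ?_
  · rintro ⟨T, A⟩ h
    simp only [Finset.mem_sigma, Finset.mem_powerset] at h ⊢
    exact ⟨h.2.trans h.1, Finset.sdiff_subset_sdiff h.1 le_rfl⟩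
  · rintro ⟨A, B⟩ h
    simp only [Finset.mem_sigma, Finset.mem_powerset] at h ⊢
    exact ⟨Finset.union_subset h.1 (h.2.trans Finset.sdiff_subset), Finset.subset_union_left⟩
  · rintro ⟨T, A⟩ h
    simp only [Finset.mem_sigma, Finset.mem_powerset] at h
    simp [Finset.union_sdiff_of_subset h.2]
  · rintro ⟨A, B⟩ h
    simp only [Finset.mem_sigma, Finset.mem_powerset] at h
    have : (A ∪ B) \ A = B := by
      rw [Finset.union_sdiff_cancel_left]
      exact Finset.disjoint_left.2 fun x hx hx' => (Finset.mem_sdiff.1 (h.2 hx')).2 hx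
    simp [this]
  · rintro ⟨T, A⟩ h
    simp only [Finset.mem_sigma, Finset.mem_powerset] at h
    obtain ⟨hT, hA⟩ := h
    have h1 : (S \ A) \ (T \ A) = S \ T := by
      ext x; simp only [Finset.mem_sdiff]
      constructor
      · rintro ⟨⟨h1, h2⟩, h3⟩; exact ⟨h1, fun h => h3 ⟨h, h2⟩⟩
      · rintro ⟨h1, h2⟩; exact ⟨⟨h1, fun h => h2 (hA h)⟩, fun h => h2 h.1⟩
    -- both signs count the inversions among the three pairs of blocks
    have h2 : wedgeSign T (S \ T) = wedgeSign A (S \ T) * wedgeSign (T \ A) (S \ T) := by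
      conv_lhs => rw [← Finset.union_sdiff_of_subset hA]
      rw [wedgeSign_union_left Finset.disjoint_sdiff]
      rw [Finset.union_sdiff_of_subset hA]
    have h3 : wedgeSign A (S \ A) = wedgeSign A (T \ A) * wedgeSign A (S \ T) := by
      rw [← wedgeSign_union_right]
      · congr 1
        ext x; simp only [Finset.mem_sdiff, Finset.mem_union]
        constructor
        · rintro ⟨h1, h2⟩; by_cases h : x ∈ T <;> simp [*]
        · rintro (⟨h1, h2⟩ | ⟨h1, h2⟩)
          · exact ⟨hT h1, h2⟩
          · exact ⟨h1, fun h => h2 (hA h)⟩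
      · exact Finset.disjoint_left.2 fun x hx hx' =>
          (Finset.mem_sdiff.1 hx').2 (Finset.mem_sdiff.1 hx).1
    simp only [h1, h2, h3]
    ring

theorem gradeInvol_apply (a : ExtAlg m) (S : Finset (Idx m)) :
    gradeInvol a S = (-1) ^ S.card * a S := rfl

theorem gradeInvol_gradeInvol (a : ExtAlg m) : gradeInvol (gradeInvol a) = a := by
  funext S
  rw [gradeInvol_apply, gradeInvol_apply, ← mul_assoc, ← mul_pow]; norm_num

theorem gradeInvol_wedge (a b : ExtAlg m) :
    gradeInvol (wedge a b) = wedge (gradeInvol a) (gradeInvol b) := by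
  funext S
  simp only [gradeInvol_apply, wedge, Finset.mul_sum]
  refine Finset.sum_congr rfl fun A hA => ?_
  rw [← Finset.card_sdiff_add_card_eq_card (Finset.mem_powerset.1 hA), pow_add]
  ring

theorem wedge_single_left (c : Idx m) (a : ExtAlg m) (S : Finset (Idx m)) :
    wedge (Pi.single {c} 1) a S =
      if c ∈ S then wedgeSign {c} (S \ {c}) * a (S \ {c}) else 0 := by
  rw [wedge]
  split_ifs with h
  · rw [Finset.sum_eq_single {c}]
    · simp
    · intro B _ hB; simp [Pi.single_eq_of_ne hB]
    · intro hB; exact absurd (Finset.mem_powerset.2 (Finset.singleton_subset_iff.2 h)) hB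
  · refine Finset.sum_eq_zero fun B hB => ?_
    have : B ≠ {c} := by
      rintro rfl
      exact h (Finset.singleton_subset_iff.1 (Finset.mem_powerset.1 hB))
    simp [Pi.single_eq_of_ne this]

theorem wedge_single_right (c : Idx m) (a : ExtAlg m) (S : Finset (Idx m)) :
    wedge a (Pi.single {c} 1) S =
      if c ∈ S then wedgeSign (S \ {c}) {c} * a (S \ {c}) else 0 := by
  rw [wedge]
  split_ifs with h
  · have hs : S \ (S \ {c}) = {c} := by
      rw [Finset.sdiff_sdiff_eq_self (Finset.singleton_subset_iff.2 h)]
    rw [Finset.sum_eq_single (S \ {c})]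
    · simp [hs]
    · intro B hB hne
      have : S \ B ≠ {c} := by
        intro h'
        apply hne
        rw [← h', Finset.sdiff_sdiff_eq_self (Finset.mem_powerset.1 hB)]
      simp [Pi.single_eq_of_ne this]
    · intro hB; exact absurd (Finset.mem_powerset.2 Finset.sdiff_subset) hB
  · refine Finset.sum_eq_zero fun B hB => ?_
    have : S \ B ≠ {c} := by
      intro h'
      have : c ∈ S \ B := by rw [h']; simp
      exact h (Finset.mem_sdiff.1 this).1
    simp [Pi.single_eq_of_ne this]

theorem wedgeSign_singleton_comm (c : Idx m) (A : Finset (Idx m)) (h : c ∉ A) :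
    wedgeSign {c} A * wedgeSign A {c} = (-1) ^ A.card := by
  rw [wedgeSign, wedgeSign, ← pow_add]
  congr 1
  have h1 : (({c} ×ˢ A).filter fun x : Idx m × Idx m => x.2 < x.1).card =
      (A.filter fun x => x < c).card := by
    refine Finset.card_bij (fun x _ => x.2) ?_ ?_ ?_
    · rintro ⟨x, y⟩ h
      simp only [Finset.mem_filter, Finset.mem_product, Finset.mem_singleton] at h ⊢
      exact ⟨h.1.2, h.1.1 ▸ h.2⟩
    · rintro ⟨x, y⟩ h ⟨x', y'⟩ h' he
      simp only [Finset.mem_filter, Finset.mem_product, Finset.mem_singleton] at h h' he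
      exact Prod.ext (h.1.1.trans h'.1.1.symm) he
    · intro b hb
      exact ⟨(c, b), by simpa using hb, rfl⟩
  have h2 : ((A ×ˢ {c}).filter fun x : Idx m × Idx m => x.2 < x.1).card =
      (A.filter fun x => ¬ x < c).card := by
    refine Finset.card_bij (fun x _ => x.1) ?_ ?_ ?_
    · rintro ⟨x, y⟩ h
      simp only [Finset.mem_filter, Finset.mem_product, Finset.mem_singleton] at h ⊢
      exact ⟨h.1.1, (h.1.2 ▸ h.2).not_gt⟩
    · rintro ⟨x, y⟩ h ⟨x', y'⟩ h' he
      simp only [Finset.mem_filter, Finset.mem_product, Finset.mem_singleton] at h h' he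
      exact Prod.ext he (h.1.2.trans h'.1.2.symm)
    · intro b hb
      rw [Finset.mem_filter] at hb
      refine ⟨(b, c), ?_, rfl⟩
      simp only [Finset.mem_filter, Finset.mem_product, Finset.mem_singleton]
      exact ⟨⟨hb.1, trivial⟩, lt_of_le_of_ne (not_lt.1 hb.2) (by rintro rfl; exact h hb.1)⟩
  rw [h1, h2, Finset.card_filter_add_card_filter_not]

/-- A covector anticommutes with forms of odd degree and commutes with forms of even degree. -/
theorem wedge_single_comm (c : Idx m) (a : ExtAlg m) :
    wedge (Pi.single {c} 1) a = wedge (gradeInvol a) (Pi.single {c} 1) := by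
  funext S
  rw [wedge_single_left, wedge_single_right]
  split_ifs with h
  · rw [gradeInvol_apply, ← wedgeSign_singleton_comm c (S \ {c}) (by simp)]
    linear_combination (-wedgeSign {c} (S \ {c}) * a (S \ {c})) * wedgeSign_mul_self (S \ {c}) {c}
  · rfl

/-! ### The exterior algebra of the product -/

theorem idxZeta_ne_idxZ (c d : Idx n) : idxZeta c ≠ idxZ d := by
  intro h
  have h' := congrArg (fun t => (ofLex t).1.val) h
  have h1 := (ofLex c).1.isLt
  change ((ofLex c).1 : ℕ) = n + (ofLex d).1 at h'
  omega

theorem idxZeta_lt_idxZ (c d : Idx n) : idxZeta c < idxZ d := by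
  have h1 := (ofLex c).1.isLt
  refine Prod.Lex.toLex_lt_toLex.2 (Or.inl ?_)
  change ((ofLex c).1 : ℕ) < n + (ofLex d).1
  omega

theorem idxZeta_lt_idxZeta {c d : Idx n} : idxZeta c < idxZeta d ↔ c < d := by
  rw [Prod.Lex.lt_iff, Prod.Lex.lt_iff]
  change Fin.castAdd n (ofLex c).1 < Fin.castAdd n (ofLex d).1 ∨
    Fin.castAdd n (ofLex c).1 = Fin.castAdd n (ofLex d).1 ∧ _ ↔ _
  rw [(Fin.castAdd_injective n n).eq_iff]
  rfl

theorem idxZ_lt_idxZ {c d : Idx n} : idxZ c < idxZ d ↔ c < d := by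
  rw [Prod.Lex.lt_iff, Prod.Lex.lt_iff]
  change Fin.natAdd n (ofLex c).1 < Fin.natAdd n (ofLex d).1 ∨
    Fin.natAdd n (ofLex c).1 = Fin.natAdd n (ofLex d).1 ∧ _ ↔ _
  rw [Fin.natAdd_lt_natAdd_iff, (Fin.natAdd_injective n n).eq_iff]
  rfl

theorem disjoint_map_zeta_z (A B : Finset (Idx n)) : Disjoint (A.map idxZeta) (B.map idxZ) := by
  rw [Finset.disjoint_left]
  intro x hx hx'
  obtain ⟨c, -, rfl⟩ := Finset.mem_map.1 hx
  obtain ⟨d, -, h⟩ := Finset.mem_map.1 hx'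
  exact idxZeta_ne_idxZ c d h.symm

theorem idxZeta_mem_idxPair {A B : Finset (Idx n)} {c : Idx n} :
    idxZeta c ∈ idxPair A B ↔ c ∈ A := by
  rw [idxPair, Finset.mem_union, Finset.mem_map', Finset.mem_map]
  constructor
  · rintro (h | ⟨d, -, h⟩)
    · exact h
    · exact absurd h.symm (idxZeta_ne_idxZ c d)
  · exact Or.inl

theorem idxZ_mem_idxPair {A B : Finset (Idx n)} {c : Idx n} :
    idxZ c ∈ idxPair A B ↔ c ∈ B := by
  rw [idxPair, Finset.mem_union, Finset.mem_map', Finset.mem_map]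
  constructor
  · rintro (⟨d, -, h⟩ | h)
    · exact absurd h (idxZeta_ne_idxZ d c)
    · exact h
  · exact Or.inr

theorem idx_cases (x : Idx (n + n)) : (∃ c, x = idxZeta c) ∨ ∃ c, x = idxZ c := by
  have hx : x = toLex ((ofLex x).1, (ofLex x).2) := rfl
  rw [hx]
  generalize (ofLex x).2 = b
  refine Fin.addCases (fun j => ?_) (fun j => ?_) (ofLex x).1
  · exact Or.inl ⟨toLex (j, b), rfl⟩
  · exact Or.inr ⟨toLex (j, b), rfl⟩

theorem idxPair_inj {A B A' B' : Finset (Idx n)} :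
    idxPair A B = idxPair A' B' ↔ A = A' ∧ B = B' := by
  constructor
  · intro h
    constructor
    · ext c; rw [← idxZeta_mem_idxPair (B := B), h, idxZeta_mem_idxPair]
    · ext c; rw [← idxZ_mem_idxPair (A := A), h, idxZ_mem_idxPair]
  · rintro ⟨rfl, rfl⟩; rfl

theorem exists_idxPair (S : Finset (Idx (n + n))) : ∃ A B, S = idxPair A B := by
  refine ⟨Finset.univ.filter fun c => idxZeta c ∈ S, Finset.univ.filter fun c => idxZ c ∈ S, ?_⟩
  ext x
  rcases idx_cases x with ⟨c, rfl⟩ | ⟨c, rfl⟩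
  · rw [idxZeta_mem_idxPair]; simp
  · rw [idxZ_mem_idxPair]; simp

theorem idxPair_univ : idxPair (Finset.univ : Finset (Idx n)) Finset.univ = Finset.univ := by
  ext x
  rcases idx_cases x with ⟨c, rfl⟩ | ⟨c, rfl⟩
  · rw [idxZeta_mem_idxPair]; simp
  · rw [idxZ_mem_idxPair]; simp

theorem idxPair_subset {A B A' B' : Finset (Idx n)} :
    idxPair A B ⊆ idxPair A' B' ↔ A ⊆ A' ∧ B ⊆ B' := by
  constructor
  · intro h
    constructor
    · intro c hc; exact idxZeta_mem_idxPair.1 (h (idxZeta_mem_idxPair.2 hc))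
    · intro c hc; exact idxZ_mem_idxPair.1 (h (idxZ_mem_idxPair.2 hc))
  · rintro ⟨h1, h2⟩ x hx
    rcases idx_cases x with ⟨c, rfl⟩ | ⟨c, rfl⟩
    · exact idxZeta_mem_idxPair.2 (h1 (idxZeta_mem_idxPair.1 hx))
    · exact idxZ_mem_idxPair.2 (h2 (idxZ_mem_idxPair.1 hx))

theorem idxPair_sdiff (A B A' B' : Finset (Idx n)) :
    idxPair A B \ idxPair A' B' = idxPair (A \ A') (B \ B') := by
  ext x
  rcases idx_cases x with ⟨c, rfl⟩ | ⟨c, rfl⟩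
  · simp only [Finset.mem_sdiff, idxZeta_mem_idxPair]
  · simp only [Finset.mem_sdiff, idxZ_mem_idxPair]

theorem card_idxPair (A B : Finset (Idx n)) : (idxPair A B).card = A.card + B.card := by
  rw [idxPair, Finset.card_union_of_disjoint (disjoint_map_zeta_z A B), Finset.card_map,
    Finset.card_map]

theorem sum_powerset_idxPair {M : Type*} [AddCommMonoid M] (A B : Finset (Idx n))
    (f : Finset (Idx (n + n)) → M) :
    ∑ S ∈ (idxPair A B).powerset, f S = ∑ A' ∈ A.powerset, ∑ B' ∈ B.powerset, f (idxPair A' B') := by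
  rw [← Finset.sum_product']
  symm
  refine Finset.sum_bij (fun x _ => idxPair x.1 x.2) ?_ ?_ ?_ ?_
  · rintro ⟨A', B'⟩ h
    simp only [Finset.mem_product, Finset.mem_powerset] at h ⊢
    exact idxPair_subset.2 h
  · rintro ⟨A', B'⟩ _ ⟨A'', B''⟩ _ h
    exact Prod.ext (idxPair_inj.1 h).1 (idxPair_inj.1 h).2
  · intro S hS
    obtain ⟨A', B', rfl⟩ := exists_idxPair S
    refine ⟨(A', B'), ?_, rfl⟩
    simp only [Finset.mem_product, Finset.mem_powerset] at hS ⊢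
    exact idxPair_subset.1 hS
  · intros; rfl

theorem wedgeSign_map {f : Idx n ↪ Idx (n + n)} (hf : ∀ c d, f c < f d ↔ c < d)
    (A B : Finset (Idx n)) : wedgeSign (A.map f) (B.map f) = wedgeSign A B := by
  rw [wedgeSign, wedgeSign]
  congr 1
  symm
  refine Finset.card_bij (fun x _ => (f x.1, f x.2)) ?_ ?_ ?_
  · rintro ⟨x, y⟩ h
    simp only [Finset.mem_filter, Finset.mem_product, Finset.mem_map'] at h ⊢
    exact ⟨h.1, (hf _ _).2 h.2⟩
  · rintro ⟨x, y⟩ _ ⟨x', y'⟩ _ h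
    simpa using h
  · rintro ⟨x, y⟩ h
    simp only [Finset.mem_filter, Finset.mem_product, Finset.mem_map] at h
    obtain ⟨⟨⟨a, ha, rfl⟩, ⟨b, hb, rfl⟩⟩, h⟩ := h
    exact ⟨(a, b), by simpa [ha, hb] using (hf _ _).1 h, rfl⟩

theorem wedgeSign_zeta_z (A B : Finset (Idx n)) : wedgeSign (A.map idxZeta) (B.map idxZ) = 1 := by
  rw [wedgeSign, Finset.card_eq_zero.2, pow_zero]
  refine Finset.filter_eq_empty_iff.2 ?_
  rintro ⟨x, y⟩ h
  simp only [Finset.mem_product, Finset.mem_map] at h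
  obtain ⟨⟨a, ha, rfl⟩, ⟨b, hb, rfl⟩⟩ := h
  exact (idxZeta_lt_idxZ a b).not_gt

theorem wedgeSign_z_zeta (A B : Finset (Idx n)) :
    wedgeSign (B.map idxZ) (A.map idxZeta) = (-1) ^ (B.card * A.card) := by
  rw [wedgeSign, Finset.filter_true_of_mem, Finset.card_product, Finset.card_map, Finset.card_map]
  rintro ⟨x, y⟩ h
  simp only [Finset.mem_product, Finset.mem_map] at h
  obtain ⟨⟨a, ha, rfl⟩, ⟨b, hb, rfl⟩⟩ := h
  exact idxZeta_lt_idxZ b a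

theorem wedgeSign_idxPair (A B A' B' : Finset (Idx n)) :
    wedgeSign (idxPair A B) (idxPair A' B') =
      wedgeSign A A' * wedgeSign B B' * (-1) ^ (B.card * A'.card) := by
  rw [idxPair, idxPair, wedgeSign_union_left (disjoint_map_zeta_z _ _),
    wedgeSign_union_right (disjoint_map_zeta_z _ _), wedgeSign_union_right (disjoint_map_zeta_z _ _),
    wedgeSign_zeta_z, wedgeSign_z_zeta, wedgeSign_map fun c d => idxZeta_lt_idxZeta,
    wedgeSign_map fun c d => idxZ_lt_idxZ]
  ring

theorem wedge_idxPair (a b : ExtAlg (n + n)) (A B : Finset (Idx n)) :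
    wedge a b (idxPair A B) = ∑ A' ∈ A.powerset, ∑ B' ∈ B.powerset,
      wedgeSign A' (A \ A') * wedgeSign B' (B \ B') * (-1) ^ (B'.card * (A \ A').card) *
        a (idxPair A' B') * b (idxPair (A \ A') (B \ B')) := by
  rw [wedge, sum_powerset_idxPair]
  simp only [idxPair_sdiff, wedgeSign_idxPair]

theorem liftZeta_idxPair (a : ExtAlg n) (A B : Finset (Idx n)) :
    liftZeta a (idxPair A B) = if B = ∅ then a A else 0 := by
  have h : ∀ A' : Finset (Idx n), A'.map idxZeta = idxPair A B ↔ A' = A ∧ ∅ = B := by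
    intro A'
    rw [← idxPair_inj, show idxPair A' ∅ = A'.map idxZeta by simp [idxPair]]
  simp only [liftZeta, h]
  split_ifs with hB
  · subst hB; simp
  · exact Finset.sum_eq_zero fun A' _ => if_neg fun h => hB h.2.symm

theorem liftZ_idxPair (b : ExtAlg n) (A B : Finset (Idx n)) :
    liftZ b (idxPair A B) = if A = ∅ then b B else 0 := by
  have h : ∀ B' : Finset (Idx n), B'.map idxZ = idxPair A B ↔ ∅ = A ∧ B' = B := by
    intro B'
    rw [← idxPair_inj, show idxPair ∅ B' = B'.map idxZ by simp [idxPair]]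
  simp only [liftZ, h]
  split_ifs with hB
  · subst hB; simp
  · exact Finset.sum_eq_zero fun A' _ => if_neg fun h => hB h.1.symm

theorem ext_idxPair {a b : ExtAlg (n + n)} (h : ∀ A B, a (idxPair A B) = b (idxPair A B)) :
    a = b := by
  funext S
  obtain ⟨A, B, rfl⟩ := exists_idxPair S
  exact h A B

/-- Exterior multiplication by a form in `ζ` acts on the coefficients of the monomials in `z`. -/
theorem slice_wedge_liftZeta (a : ExtAlg n) (X : ExtAlg (n + n)) (B : Finset (Idx n)) :
    slice (wedge (liftZeta a) X) B = wedge a (slice X B) := by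
  funext A
  rw [slice, wedge_idxPair, wedge]
  refine Finset.sum_congr rfl fun A' _ => ?_
  rw [Finset.sum_eq_single ∅]
  · simp [liftZeta_idxPair, wedgeSign_empty_left, slice]
  · intro B' _ hB'; simp [liftZeta_idxPair, hB']
  · simp

theorem wedge_liftZ_idxPair (X : ExtAlg (n + n)) (b : ExtAlg n) (A B : Finset (Idx n)) :
    wedge X (liftZ b) (idxPair A B) = wedge (fun B' => slice X B' A) b B := by
  rw [wedge_idxPair, wedge, Finset.sum_eq_single A]
  · simp [liftZ_idxPair, wedgeSign_empty_right, slice]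
  · intro A' hA' hne
    have : A \ A' ≠ ∅ := by
      intro h
      exact hne (Finset.Subset.antisymm (Finset.mem_powerset.1 hA') (Finset.sdiff_eq_empty_iff_subset.1 h))
    simp [liftZ_idxPair, this]
  · simp

theorem wedge_liftZ_univ (X : ExtAlg (n + n)) (b : ExtAlg n) :
    wedge X (liftZ b) Finset.univ = wedge (fun B => slice X B Finset.univ) b Finset.univ := by
  rw [← idxPair_univ, wedge_liftZ_idxPair]

theorem slice_liftZeta_wedge_liftZ (a b : ExtAlg n) (B : Finset (Idx n)) :
    slice (wedge (liftZeta a) (liftZ b)) B = b B • a := by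
  funext A
  rw [slice, wedge_liftZ_idxPair, wedge, Finset.sum_eq_single ∅]
  · simp [slice, liftZeta_idxPair, wedgeSign_empty_left, mul_comm]
  · intro B' _ hB'; simp [slice, liftZeta_idxPair, hB']
  · simp

theorem pullDiag_wedge (a b : ExtAlg n) : pullDiag (wedge (liftZeta a) (liftZ b)) = wedge a b := by
  simp only [pullDiag, slice_liftZeta_wedge_liftZ, wedge_smul_left]
  conv_rhs => rw [← Finset.univ_sum_single b, wedge_sum_right]
  refine Finset.sum_congr rfl fun B _ => ?_
  rw [← wedge_smul_right, ← Pi.single_smul, smul_eq_mul, mul_one]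

theorem liftZeta_add (a b : ExtAlg n) : liftZeta (a + b) = liftZeta a + liftZeta b := by
  refine ext_idxPair fun A B => ?_
  simp only [Pi.add_apply, liftZeta_idxPair]; split_ifs <;> simp

theorem liftZeta_smul (r : ℂ) (a : ExtAlg n) : liftZeta (r • a) = r • liftZeta a := by
  refine ext_idxPair fun A B => ?_
  simp only [Pi.smul_apply, liftZeta_idxPair]; split_ifs <;> simp

theorem liftZ_add (a b : ExtAlg n) : liftZ (a + b) = liftZ a + liftZ b := by
  refine ext_idxPair fun A B => ?_
  simp only [Pi.add_apply, liftZ_idxPair]; split_ifs <;> simp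

theorem liftZ_smul (r : ℂ) (a : ExtAlg n) : liftZ (r • a) = r • liftZ a := by
  refine ext_idxPair fun A B => ?_
  simp only [Pi.smul_apply, liftZ_idxPair]; split_ifs <;> simp

/-- `liftZeta` as a continuous linear map. -/
def liftZetaCLM (n : ℕ) : ExtAlg n →L[ℂ] ExtAlg (n + n) :=
  LinearMap.toContinuousLinearMap
    { toFun := liftZeta
      map_add' := liftZeta_add
      map_smul' := liftZeta_smul }

/-- `liftZ` as a continuous linear map. -/
def liftZCLM (n : ℕ) : ExtAlg n →L[ℂ] ExtAlg (n + n) :=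
  LinearMap.toContinuousLinearMap
    { toFun := liftZ
      map_add' := liftZ_add
      map_smul' := liftZ_smul }

theorem liftZetaCLM_apply (a : ExtAlg n) : liftZetaCLM n a = liftZeta a := rfl

theorem liftZeta_wedge (a b : ExtAlg n) :
    liftZeta (wedge a b) = wedge (liftZeta a) (liftZeta b) := by
  refine ext_idxPair fun A B => ?_
  have h := congrFun (slice_wedge_liftZeta a (liftZeta b) B) A
  have hs : slice (liftZeta b) B = if B = ∅ then b else 0 := by
    funext A; rw [slice, liftZeta_idxPair]; split_ifs <;> rfl
  rw [slice, hs] at h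
  rw [h, liftZeta_idxPair]
  split_ifs
  · rfl
  · rw [wedge_zero_right]; rfl

theorem liftZ_wedge (a b : ExtAlg n) : liftZ (wedge a b) = wedge (liftZ a) (liftZ b) := by
  refine ext_idxPair fun A B => ?_
  have hs : (fun B' => slice (liftZ a) B' A) = if A = ∅ then a else 0 := by
    funext B'; rw [slice, liftZ_idxPair]; split_ifs <;> rfl
  rw [wedge_liftZ_idxPair, hs, liftZ_idxPair]
  split_ifs
  · rfl
  · rw [wedge_zero_left]; rfl

theorem gradeInvol_liftZeta (a : ExtAlg n) : gradeInvol (liftZeta a) = liftZeta (gradeInvol a) := by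
  refine ext_idxPair fun A B => ?_
  rw [gradeInvol_apply, liftZeta_idxPair, liftZeta_idxPair]
  split_ifs with h
  · subst h; rw [gradeInvol_apply, card_idxPair]; simp
  · simp

theorem gradeInvol_liftZ (a : ExtAlg n) : gradeInvol (liftZ a) = liftZ (gradeInvol a) := by
  refine ext_idxPair fun A B => ?_
  rw [gradeInvol_apply, liftZ_idxPair, liftZ_idxPair]
  split_ifs with h
  · subst h; rw [gradeInvol_apply, card_idxPair]; simp
  · simp

theorem liftZeta_single (c : Idx n) :
    liftZeta (Pi.single {c} 1) = Pi.single {idxZeta c} 1 := by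
  refine ext_idxPair fun A B => ?_
  have : ({idxZeta c} : Finset (Idx (n + n))) = idxPair {c} ∅ := by simp [idxPair]
  rw [liftZeta_idxPair, this, Pi.single_apply, Pi.single_apply]
  simp only [idxPair_inj]
  split_ifs <;> simp_all

theorem liftZ_single (c : Idx n) : liftZ (Pi.single {c} 1) = Pi.single {idxZ c} 1 := by
  refine ext_idxPair fun A B => ?_
  have : ({idxZ c} : Finset (Idx (n + n))) = idxPair ∅ {c} := by simp [idxPair]
  rw [liftZ_idxPair, this, Pi.single_apply, Pi.single_apply]
  simp only [idxPair_inj]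
  split_ifs <;> simp_all

theorem dzbar_castAdd (j : Fin n) : dzbar (Fin.castAdd n j) = liftZeta (dzbar j) :=
  (liftZeta_single (toLex (j, true))).symm

theorem dzbar_natAdd (j : Fin n) : dzbar (Fin.natAdd n j) = liftZ (dzbar j) :=
  (liftZ_single (toLex (j, true))).symm

theorem holDeg_idxPair (A B : Finset (Idx n)) : holDeg (idxPair A B) = holDeg A + holDeg B := by
  rw [holDeg, idxPair, Finset.filter_union, Finset.card_union_of_disjoint
    (Finset.disjoint_filter_filter (disjoint_map_zeta_z A B)), Finset.filter_map, Finset.filter_map,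
    Finset.card_map, Finset.card_map]
  rfl

theorem antiDeg_idxPair (A B : Finset (Idx n)) :
    antiDeg (idxPair A B) = antiDeg A + antiDeg B := by
  rw [antiDeg, idxPair, Finset.filter_union, Finset.card_union_of_disjoint
    (Finset.disjoint_filter_filter (disjoint_map_zeta_z A B)), Finset.filter_map, Finset.filter_map,
    Finset.card_map, Finset.card_map]
  rfl

theorem holDeg_add_antiDeg (A : Finset (Idx n)) : holDeg A + antiDeg A = A.card := by
  rw [holDeg, antiDeg, ← Finset.card_filter_add_card_filter_not (s := A)
    (fun c => (ofLex c).2 = false)]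
  simp

theorem holDeg_univ : holDeg (Finset.univ : Finset (Idx n)) = n := by
  have : (Finset.univ.filter fun c : Idx n => (ofLex c).2 = false) =
      Finset.univ.image fun j : Fin n => (toLex (j, false) : Idx n) := by
    ext c
    simp only [Finset.mem_filter, Finset.mem_univ, true_and, Finset.mem_image]
    constructor
    · intro h; exact ⟨(ofLex c).1, by rw [← h]; rfl⟩
    · rintro ⟨j, rfl⟩; rfl
  rw [holDeg, this, Finset.card_image_of_injective _ fun i j h => by simpa using h]
  simp

theorem antiDeg_univ : antiDeg (Finset.univ : Finset (Idx n)) = n := by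
  have : (Finset.univ.filter fun c : Idx n => (ofLex c).2 = true) =
      Finset.univ.image fun j : Fin n => (toLex (j, true) : Idx n) := by
    ext c
    simp only [Finset.mem_filter, Finset.mem_univ, true_and, Finset.mem_image]
    constructor
    · intro h; exact ⟨(ofLex c).1, by rw [← h]; rfl⟩
    · rintro ⟨j, rfl⟩; rfl
  rw [antiDeg, this, Finset.card_image_of_injective _ fun i j h => by simpa using h]
  simp

theorem holDeg_sdiff {A S : Finset (Idx n)} (h : A ⊆ S) : holDeg A + holDeg (S \ A) = holDeg S := by
  rw [holDeg, holDeg, holDeg, ← Finset.card_union_of_disjoint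
    (Finset.disjoint_filter_filter Finset.disjoint_sdiff), ← Finset.filter_union,
    Finset.union_sdiff_of_subset h]

theorem antiDeg_sdiff {A S : Finset (Idx n)} (h : A ⊆ S) :
    antiDeg A + antiDeg (S \ A) = antiDeg S := by
  rw [antiDeg, antiDeg, antiDeg, ← Finset.card_union_of_disjoint
    (Finset.disjoint_filter_filter Finset.disjoint_sdiff), ← Finset.filter_union,
    Finset.union_sdiff_of_subset h]

/-! ### Evaluation of forms and the oriented volume -/

/-- The covector `e_c` as a real-linear functional. -/
def coframe (c : Idx m) : Cn m →L[ℝ] ℂ :=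
  if (ofLex c).2 then Complex.conjCLE.toContinuousLinearMap ∘L
    ContinuousLinearMap.proj (R := ℝ) (φ := fun _ : Fin m => ℂ) (ofLex c).1
  else ContinuousLinearMap.proj (R := ℝ) (φ := fun _ : Fin m => ℂ) (ofLex c).1

theorem coframe_apply (c : Idx m) (v : Cn m) :
    coframe c v = if (ofLex c).2 then (starRingEnd ℂ) (v (ofLex c).1) else v (ofLex c).1 := by
  rw [coframe]; split_ifs <;> rfl

theorem evalForm_eq_sum {k : ℕ} (a : ExtAlg m) (v : Fin k → Cn m) :
    evalForm a v = ∑ S : {S : Finset (Idx m) // S.card = k}, a S.1 *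
      Matrix.det (Matrix.of fun i b : Fin k => coframe (S.1.orderEmbOfFin S.2 i) (v b)) := by
  simp only [evalForm, coframe_apply]

/-- The determinant as a real-alternating map of complex vectors. -/
def detAlt (k : ℕ) : (Fin k → ℂ) [⋀^Fin k]→ₗ[ℝ] ℂ where
  toMultilinearMap := (Matrix.detRowAlternating (R := ℂ) (n := Fin k)).toMultilinearMap.restrictScalars ℝ
  map_eq_zero_of_eq' := (Matrix.detRowAlternating (R := ℂ) (n := Fin k)).map_eq_zero_of_eq'

/-- The alternating map defined by a form. -/
def evalAlt (k : ℕ) (a : ExtAlg m) : Cn m [⋀^Fin k]→ₗ[ℝ] ℂ :=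
  ∑ S : {S : Finset (Idx m) // S.card = k}, a S.1 • (detAlt k).compLinearMap
    (LinearMap.pi fun i => (coframe (S.1.orderEmbOfFin S.2 i)).toLinearMap)

theorem evalAlt_apply {k : ℕ} (a : ExtAlg m) (v : Fin k → Cn m) :
    evalAlt k a v = evalForm a v := by
  have hs : ∀ (s : Finset {S : Finset (Idx m) // S.card = k})
      (f : {S : Finset (Idx m) // S.card = k} → Cn m [⋀^Fin k]→ₗ[ℝ] ℂ),
      (∑ S ∈ s, f S) v = ∑ S ∈ s, f S v := by
    classical
    intro s f
    induction s using Finset.induction_on with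
    | empty => simp
    | insert S s hS ih => rw [Finset.sum_insert hS, Finset.sum_insert hS, ← ih]; rfl
  rw [evalForm_eq_sum, evalAlt, hs]
  refine Finset.sum_congr rfl fun S _ => ?_
  change a S.1 * Matrix.det _ = _
  rw [← Matrix.det_transpose]
  rfl

/-- The oriented volume as an alternating map. -/
def volAlt (k : ℕ) : Cn n [⋀^Fin k]→ₗ[ℝ] ℝ :=
  (Complex.reLm ∘ₗ ((LinearMap.mulLeft ℂ (((-2 * Complex.I) ^ n : ℂ)⁻¹)).restrictScalars ℝ)).compAlternatingMap
    (evalAlt k (Pi.single Finset.univ 1))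

theorem volAlt_apply {k : ℕ} (v : Fin k → Cn n) : volAlt k v = orientedVolume v := by
  rw [orientedVolume, ← evalAlt_apply, div_eq_inv_mul]
  rfl

theorem continuous_evalForm {k : ℕ} (a : ExtAlg m) :
    Continuous fun v : Fin k → Cn m => evalForm a v := by
  simp only [evalForm_eq_sum]
  refine continuous_finsetSum _ fun S _ => continuous_const.mul ?_
  refine Continuous.matrix_det (continuous_pi fun i => continuous_pi fun b => ?_)
  exact (coframe _).continuous.comp (continuous_apply b)

theorem continuous_orientedVolume {k : ℕ} :
    Continuous fun v : Fin k → Cn n => orientedVolume v :=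
  Complex.continuous_re.comp ((continuous_evalForm _).div_const _)

theorem card_idx (n : ℕ) : Fintype.card (Idx n) = 2 * n := by
  change Fintype.card (Fin n × Bool) = 2 * n
  simp [mul_comm]

/-- The enumeration of the coframe. -/
def idxEnum {k : ℕ} (h : k = 2 * n) : Fin k ≃o Idx n :=
  Fintype.orderIsoFinOfCardEq _ ((card_idx n).trans h.symm)

theorem evalForm_single_univ {k : ℕ} (h : k = 2 * n) (v : Fin k → Cn n) :
    evalForm (Pi.single Finset.univ 1) v =
      Matrix.det (Matrix.of fun i b : Fin k => coframe (idxEnum h i) (v b)) := by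
  have hc : (Finset.univ : Finset (Idx n)).card = k := by rw [Finset.card_univ, card_idx, h]
  rw [evalForm_eq_sum, Fintype.sum_eq_single ⟨Finset.univ, hc⟩]
  · rw [Pi.single_eq_same, one_mul]
    have : (idxEnum h : Fin k → Idx n) = Finset.univ.orderEmbOfFin hc :=
      Finset.orderEmbOfFin_unique hc (fun _ => Finset.mem_univ _) (idxEnum h).strictMono
    simp only [this]
  · intro S hS
    have : S.1 ≠ Finset.univ := fun h => hS (Subtype.ext h)
    rw [Pi.single_eq_of_ne this, zero_mul]

/-- Real coordinates on `ℂ^n`, in the order `x₁, y₁, x₂, y₂, …`. -/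
def realCoord {k : ℕ} (h : k = 2 * n) : (Fin k → ℝ) ≃L[ℝ] Cn n :=
  LinearEquiv.toContinuousLinearEquiv
    { toFun := fun x j => ⟨x ((idxEnum h).symm (toLex (j, false))),
        x ((idxEnum h).symm (toLex (j, true)))⟩
      invFun := fun z b => if (ofLex (idxEnum h b)).2 then (z (ofLex (idxEnum h b)).1).im
        else (z (ofLex (idxEnum h b)).1).re
      map_add' := fun x y => by funext j; exact Complex.ext rfl rfl
      map_smul' := fun r x => by
        funext j
        exact Complex.ext (by simp) (by simp)
      left_inv := fun x => by
        funext b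
        have hb : ∀ i t, ofLex (idxEnum h b) = (i, t) → (idxEnum h).symm (toLex (i, t)) = b := by
          intro i t hit
          rw [← hit]; simp
        rcases hc : ofLex (idxEnum h b) with ⟨i, _ | _⟩
        · simpa [hc] using congrArg x (hb i _ hc)
        · simpa [hc] using congrArg x (hb i _ hc)
      right_inv := fun z => by
        funext j
        exact Complex.ext (by simp) (by simp) }

theorem realCoord_apply {k : ℕ} (h : k = 2 * n) (x : Fin k → ℝ) (j : Fin n) :
    realCoord h x j = ⟨x ((idxEnum h).symm (toLex (j, false))),
        x ((idxEnum h).symm (toLex (j, true)))⟩ := rfl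

theorem prod_idx {M : Type*} [CommMonoid M] (f : Idx n → M) :
    ∏ c, f c = ∏ j : Fin n, f (toLex (j, false)) * f (toLex (j, true)) := by
  have : ∏ c, f c = ∏ c : Fin n × Bool, f (toLex c) :=
    (Fintype.prod_equiv toLex _ _ fun _ => rfl).symm
  rw [this, Fintype.prod_prod_type]
  refine Finset.prod_congr rfl fun j _ => ?_
  rw [Fintype.prod_bool, mul_comm]

theorem measurePreserving_realCoord {k : ℕ} (h : k = 2 * n) :
    MeasurePreserving (realCoord (n := n) h) := by
  refine MeasurePreserving.symm (e := (realCoord (n := n) h).symm.toHomeomorph.toMeasurableEquiv)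
    ⟨(realCoord (n := n) h).symm.continuous.measurable, ?_⟩
  refine (Measure.pi_eq fun s hs => ?_).symm
  refine (Measure.map_apply (realCoord (n := n) h).symm.continuous.measurable
    (MeasurableSet.univ_pi hs)).trans ?_
  have h1 : (realCoord (n := n) h).symm.toHomeomorph.toMeasurableEquiv ⁻¹' (Set.pi univ s) =
      Set.pi univ fun j => Complex.measurableEquivRealProd ⁻¹'
        (s ((idxEnum h).symm (toLex (j, false))) ×ˢ s ((idxEnum h).symm (toLex (j, true)))) := by
    ext z
    obtain ⟨x, rfl⟩ := (realCoord (n := n) h).surjective z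
    have : (realCoord (n := n) h).symm.toHomeomorph.toMeasurableEquiv (realCoord h x) = x :=
      (realCoord h).symm_apply_apply x
    simp only [mem_preimage, this, Set.mem_pi, mem_univ, true_imp_iff, mem_prod,
      Complex.measurableEquivRealProd_apply, realCoord_apply]
    constructor
    · intro hx j; exact ⟨hx _, hx _⟩
    · intro hx b
      obtain ⟨c, rfl⟩ := (idxEnum h).symm.surjective b
      obtain ⟨⟨j, t⟩, rfl⟩ := toLex.surjective c
      cases t
      · exact (hx j).1
      · exact (hx j).2
  have h2 : ∀ j : Fin n, (volume : Measure ℂ) (Complex.measurableEquivRealProd ⁻¹'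
        (s ((idxEnum h).symm (toLex (j, false))) ×ˢ s ((idxEnum h).symm (toLex (j, true))))) =
      volume (s ((idxEnum h).symm (toLex (j, false)))) *
        volume (s ((idxEnum h).symm (toLex (j, true)))) := by
    intro j
    rw [Complex.volume_preserving_equiv_real_prod.measure_preimage
      ((hs _).prod (hs _)).nullMeasurableSet, Measure.volume_eq_prod, Measure.prod_prod]
  have h3 : ∏ i, volume (s i) = ∏ c, volume (s ((idxEnum h).symm c)) :=
    (Fintype.prod_equiv (idxEnum h).symm.toEquiv _ _ fun _ => rfl).symm
  have h1' : (⇑(realCoord (n := n) h).symm) ⁻¹' (Set.pi univ s) = _ := h1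
  refine Eq.trans (congrArg volume h1') ?_
  rw [volume_pi, Measure.pi_pi]
  simp only [h2]
  rw [h3, prod_idx]

theorem det_coframe_block :
    Matrix.det (Matrix.of fun s t : Bool => if s then (if t then -Complex.I else 1)
      else (if t then Complex.I else 1)) = -2 * Complex.I := by
  rw [← Matrix.det_submatrix_equiv_self finTwoEquiv, Matrix.det_fin_two]
  simp [finTwoEquiv]
  ring

theorem evalForm_realCoord {k : ℕ} (h : k = 2 * n) :
    evalForm (Pi.single Finset.univ 1)
      (fun b : Fin k => realCoord (n := n) h (Pi.single b 1)) = (-2 * Complex.I) ^ n := by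
  let e : Fin k ≃ Bool × Fin n :=
    (idxEnum h).toEquiv.trans (toLex.symm.trans (Equiv.prodComm (Fin n) Bool))
  have hM : (Matrix.of fun i b : Fin k => coframe (idxEnum h i)
      (realCoord (n := n) h (Pi.single b 1))) =
      (Matrix.blockDiagonal fun _ : Fin n => (Matrix.of fun s t : Bool =>
        if s then (if t then -Complex.I else 1) else (if t then Complex.I else 1))).submatrix
        e e := by
    ext i b
    obtain ⟨c, rfl⟩ := (idxEnum h).symm.surjective i
    obtain ⟨d, rfl⟩ := (idxEnum h).symm.surjective b
    obtain ⟨⟨j, s⟩, rfl⟩ := toLex.surjective c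
    obtain ⟨⟨l, t⟩, rfl⟩ := toLex.surjective d
    have he : ∀ j s, e ((idxEnum h).symm (toLex (j, s))) = (s, j) := by
      intro j s; simp [e]
    rw [Matrix.submatrix_apply, he, he, Matrix.blockDiagonal_apply, Matrix.of_apply,
      OrderIso.apply_symm_apply, coframe_apply, realCoord_apply]
    have hs : ∀ (j l : Fin n) (s t : Bool), (Pi.single ((idxEnum h).symm (toLex (l, t))) 1 :
        Fin k → ℝ) ((idxEnum h).symm (toLex (j, s))) = if j = l ∧ s = t then 1 else 0 := by
      intro j l s t
      rw [Pi.single_apply]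
      simp
    simp only [hs]
    by_cases hjl : j = l
    · subst hjl
      cases s <;> cases t <;> simp [Complex.ext_iff]
    · cases s <;> cases t <;> simp [hjl, Complex.ext_iff]
  rw [evalForm_single_univ h, hM, Matrix.det_submatrix_equiv_self,
    Matrix.det_blockDiagonal, det_coframe_block, Finset.prod_const, Finset.card_univ,
    Fintype.card_fin]

theorem orientedVolume_realCoord {k : ℕ} (h : k = 2 * n) :
    orientedVolume (fun b : Fin k => realCoord (n := n) h (Pi.single b 1)) = 1 := by
  rw [orientedVolume, evalForm_realCoord, div_self, Complex.one_re]
  exact pow_ne_zero _ (by simp)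

theorem det_eq_orientedVolume {k : ℕ} (h : k = 2 * n) (L : (Fin k → ℝ) →L[ℝ] Cn n) :
    (((realCoord (n := n) h).symm : Cn n →L[ℝ] (Fin k → ℝ)) ∘L L).det =
      orientedVolume fun b => L (Pi.single b 1) := by
  set f := (volAlt (n := n) k).compLinearMap (realCoord (n := n) h).toLinearMap with hf
  have h1 := f.eq_smul_basis_det (Pi.basisFun ℝ (Fin k))
  have h2 : f (Pi.basisFun ℝ (Fin k)) = 1 := by
    rw [← orientedVolume_realCoord (n := n) h, ← volAlt_apply, hf]
    change volAlt k _ = volAlt k _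
    congr 1
    funext b
    simp
  rw [h2, one_smul] at h1
  set L' := ((realCoord (n := n) h).symm : Cn n →L[ℝ] (Fin k → ℝ)) ∘L L
  have h3 := (Pi.basisFun ℝ (Fin k)).det_comp L'.toLinearMap (Pi.basisFun ℝ (Fin k))
  rw [Module.Basis.det_self, mul_one, ← h1] at h3
  rw [ContinuousLinearMap.det, ← h3, ← volAlt_apply, hf]
  change volAlt k _ = volAlt k _
  congr 1
  funext b
  simp [L']

/-- Change of variables on `ℂ^n`: integrability. -/
theorem integrableOn_image_iff_orientedVolume {k : ℕ} (h : k = 2 * n) {s : Set (Fin k → ℝ)}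
    (hs : MeasurableSet s) {Φ : (Fin k → ℝ) → Cn n} {Φ' : (Fin k → ℝ) → (Fin k → ℝ) →L[ℝ] Cn n}
    (hΦ : ∀ x ∈ s, HasFDerivWithinAt Φ (Φ' x) s x) (hinj : InjOn Φ s) (f : Cn n → ℝ) :
    IntegrableOn f (Φ '' s) ↔
      IntegrableOn (fun x => |orientedVolume fun b => Φ' x (Pi.single b 1)| * f (Φ x)) s := by
  set J := realCoord (n := n) h
  have hJ : MeasurableEmbedding J := J.toHomeomorph.measurableEmbedding
  have hΨ : ∀ x ∈ s, HasFDerivWithinAt (fun x => J.symm (Φ x))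
      ((J.symm : Cn n →L[ℝ] (Fin k → ℝ)) ∘L Φ' x) s x := fun x hx =>
    (J.symm : Cn n →L[ℝ] (Fin k → ℝ)).hasFDerivAt.comp_hasFDerivWithinAt x (hΦ x hx)
  have hinj' : InjOn (fun x => J.symm (Φ x)) s := fun x hx y hy hxy =>
    hinj hx hy (J.symm.injective hxy)
  have h1 := integrableOn_image_iff_integrableOn_abs_det_fderiv_smul volume hs hΨ hinj'
    (fun y => f (J y))
  have h2 : (fun x => J.symm (Φ x)) '' s = J ⁻¹' (Φ '' s) := by
    rw [← image_image]
    exact J.symm.image_eq_preimage_symm _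
  have h3 := (measurePreserving_realCoord (n := n) h).integrableOn_comp_preimage hJ
    (f := f) (s := Φ '' s)
  rw [← h3, ← h2]
  simp only [smul_eq_mul, ContinuousLinearEquiv.apply_symm_apply, J, det_eq_orientedVolume] at h1
  exact h1

/-- Change of variables on `ℂ^n`. -/
theorem setIntegral_image_eq_orientedVolume {k : ℕ} (h : k = 2 * n) {s : Set (Fin k → ℝ)}
    (hs : MeasurableSet s) {Φ : (Fin k → ℝ) → Cn n} {Φ' : (Fin k → ℝ) → (Fin k → ℝ) →L[ℝ] Cn n}
    (hΦ : ∀ x ∈ s, HasFDerivWithinAt Φ (Φ' x) s x) (hinj : InjOn Φ s) (f : Cn n → ℝ) :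
    ∫ y in Φ '' s, f y =
      ∫ x in s, |orientedVolume fun b => Φ' x (Pi.single b 1)| * f (Φ x) := by
  set J := realCoord (n := n) h
  have hJ : MeasurableEmbedding J := J.toHomeomorph.measurableEmbedding
  have hΨ : ∀ x ∈ s, HasFDerivWithinAt (fun x => J.symm (Φ x))
      ((J.symm : Cn n →L[ℝ] (Fin k → ℝ)) ∘L Φ' x) s x := fun x hx =>
    (J.symm : Cn n →L[ℝ] (Fin k → ℝ)).hasFDerivAt.comp_hasFDerivWithinAt x (hΦ x hx)
  have hinj' : InjOn (fun x => J.symm (Φ x)) s := fun x hx y hy hxy =>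
    hinj hx hy (J.symm.injective hxy)
  have h1 := integral_image_eq_integral_abs_det_fderiv_smul volume hs hΨ hinj'
    (fun y => f (J y))
  have h2 : (fun x => J.symm (Φ x)) '' s = J ⁻¹' (Φ '' s) := by
    rw [← image_image]
    exact J.symm.image_eq_preimage_symm _
  have h3 := (measurePreserving_realCoord (n := n) h).setIntegral_preimage_emb hJ f (Φ '' s)
  rw [← h3, ← h2]
  simp only [smul_eq_mul, ContinuousLinearEquiv.apply_symm_apply, J, det_eq_orientedVolume] at h1
  exact h1

section

variable {D : Set (Cn n)}

/-! ### Transverse directions at the boundary -/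

/-- On the ball `B(x₀, r)` all vectors `u` close to `v` point out of `D`: moving from a point of
`closure D` in the direction `-u` leads into `D`, and `u` points outwards at the boundary points. -/
structure IsTransverse (D : Set (Cn n)) (x₀ : Cn n) (r : ℝ) (v : Cn n) (δ : ℝ) : Prop where
  r_pos : 0 < r
  δ_pos : 0 < δ
  cone : ∀ y ∈ Metric.ball x₀ r, y ∈ closure D → ∀ u ∈ Metric.ball v δ, ∀ s : ℝ, 0 < s →
    y - s • u ∈ Metric.ball x₀ r → y - s • u ∈ D
  outward : ∀ y ∈ Metric.ball x₀ r, y ∈ frontier D → ∃ ρ, IsLocalDefiningFunction D y ρ ∧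
    ∀ u ∈ Metric.ball v δ, 0 < fderiv ℝ ρ y u

/-- At a boundary point there is a transverse direction: any vector along which a defining function
increases. -/
theorem exists_isTransverse {D : Set (Cn n)} (hDo : IsOpen D) (hD : HasC1Boundary D) {x₀ : Cn n}
    (hx₀ : x₀ ∈ frontier D) : ∃ r v δ, IsTransverse D x₀ r v δ := by
  obtain ⟨ρ, hρ, hρ0, hρd, hρD⟩ := hD x₀ hx₀
  obtain ⟨v, hv⟩ : ∃ v, 0 < fderiv ℝ ρ x₀ v := by
    by_contra! h
    apply hρd
    ext v
    refine le_antisymm (h v) ?_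
    have := h (-v)
    rw [map_neg] at this
    simpa using this
  have hcont : ContinuousAt (fun p : Cn n × Cn n => fderiv ℝ ρ p.1 p.2) (x₀, v) := by
    have h1 : ContinuousAt (fderiv ℝ ρ) x₀ :=
      (hρ.fderiv_right (m := 0) (by simp)).continuousAt
    exact (h1.comp_of_eq continuousAt_fst rfl).clm_apply continuousAt_snd
  have hpos : ∀ᶠ p in 𝓝 x₀ ×ˢ 𝓝 v, 0 < fderiv ℝ ρ p.1 p.2 := by
    rw [← nhds_prod_eq]; exact hcont.eventually (lt_mem_nhds hv)
  obtain ⟨A, hA, V, hV, hAV⟩ := Filter.mem_prod_iff.1 hpos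
  have hev : ∀ᶠ y in 𝓝 x₀, ContDiffAt ℝ 1 ρ y ∧ (∀ᶠ z in 𝓝 y, (z ∈ D ↔ ρ z < 0)) ∧ y ∈ A :=
    (hρ.eventually (by simp)).and (hρD.eventually_nhds.and hA)
  obtain ⟨r, hr, hball⟩ := Metric.eventually_nhds_iff_ball.1 hev
  obtain ⟨δ, hδ, hδV⟩ := Metric.mem_nhds_iff.1 hV
  have hdpos : ∀ y ∈ Metric.ball x₀ r, ∀ u ∈ Metric.ball v δ, 0 < fderiv ℝ ρ y u :=
    fun y hy u hu => hAV (mk_mem_prod (hball y hy).2.2 (hδV hu))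
  have hDρ : ∀ y ∈ Metric.ball x₀ r, (y ∈ D ↔ ρ y < 0) := fun y hy => (hball y hy).2.1.self_of_nhds
  have hcl : ∀ y ∈ Metric.ball x₀ r, y ∈ closure D → ρ y ≤ 0 := by
    intro y hy hyD
    have h1 : ∃ᶠ z in 𝓝 y, ρ z ≤ 0 := by
      refine ((mem_closure_iff_frequently.1 hyD).and_eventually (hball y hy).2.1).mono ?_
      rintro z ⟨hz, hz'⟩
      exact (hz'.1 hz).le
    by_contra! hlt
    exact h1 (((hball y hy).1.continuousAt.eventually (lt_mem_nhds hlt)).mono fun z hz => not_le.2 hz)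
  refine ⟨r, v, δ, hr, hδ, ?_, ?_⟩
  · intro y hy hyD u hu s hs hys
    rw [hDρ _ hys]
    refine lt_of_lt_of_le ?_ (hcl y hy hyD)
    have hseg : ∀ τ ∈ Icc 0 s, y - τ • u ∈ Metric.ball x₀ r := by
      intro τ hτ
      have : y - τ • u = (1 - τ / s) • y + (τ / s) • (y - s • u) := by
        rw [smul_sub, smul_smul, div_mul_cancel₀ _ hs.ne']
        module
      rw [this]
      refine (convex_ball x₀ r) hy hys ?_ ?_ (by ring)
      · rw [sub_nonneg, div_le_one hs]; exact hτ.2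
      · exact div_nonneg hτ.1 hs.le
    have hder : ∀ τ ∈ Icc 0 s, HasDerivAt (fun τ : ℝ => ρ (y - τ • u))
        (-(fderiv ℝ ρ (y - τ • u) u)) τ := by
      intro τ hτ
      have h1 : HasDerivAt (fun τ : ℝ => y - τ • u) (-u) τ := by
        simpa using ((hasDerivAt_id τ).smul_const u).const_sub y
      have h2 := ((hball _ (hseg τ hτ)).1.differentiableAt (by simp)).hasFDerivAt
      have h3 := h2.comp_hasDerivAt τ h1
      rwa [map_neg] at h3
    -- the defining function decreases along the segment from `y` to `y - s u`
    have hanti : StrictAntiOn (fun τ : ℝ => ρ (y - τ • u)) (Icc 0 s) := by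
      refine strictAntiOn_of_deriv_neg (convex_Icc 0 s)
        (fun τ hτ => (hder τ hτ).continuousAt.continuousWithinAt) fun τ hτ => ?_
      have hτ' := interior_subset hτ
      rw [(hder τ hτ').deriv, neg_lt_zero]
      exact hdpos _ (hseg τ hτ') u hu
    simpa using hanti (left_mem_Icc.2 hs.le) (right_mem_Icc.2 hs.le) hs
  · intro y hy hyD
    refine ⟨ρ, ⟨(hball y hy).1, ?_, ?_, (hball y hy).2.1⟩, hdpos y hy⟩
    · refine le_antisymm (hcl y hy hyD.1) ?_
      rw [hDo.frontier_eq] at hyD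
      by_contra! hlt
      exact hyD.2 ((hDρ y hy).2 hlt)
    · intro h0
      have := hdpos y hy v (Metric.mem_ball_self hδ)
      rw [h0] at this
      simp at this

theorem IsTransverse.ne_zero {D : Set (Cn n)} {x₀ v : Cn n} {r δ : ℝ}
    (h : IsTransverse D x₀ r v δ) (hx₀ : x₀ ∈ frontier D) {u : Cn n} (hu : u ∈ Metric.ball v δ) :
    u ≠ 0 := by
  rintro rfl
  obtain ⟨ρ, -, hρ⟩ := h.outward x₀ (Metric.mem_ball_self h.r_pos) hx₀
  simpa using hρ 0 hu

/-- Two boundary points in the ball do not lie on the same line in a transverse direction. -/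
theorem IsTransverse.eq_of_add_smul_eq {D : Set (Cn n)} (hDo : IsOpen D) {x₀ v : Cn n} {r δ : ℝ}
    (h : IsTransverse D x₀ r v δ) {u : Cn n} (hu : u ∈ Metric.ball v δ) {y y' : Cn n}
    (hy : y ∈ Metric.ball x₀ r) (hyD : y ∈ frontier D) (hy' : y' ∈ Metric.ball x₀ r)
    (hyD' : y' ∈ frontier D) {s s' : ℝ} (he : y + s • u = y' + s' • u) : y = y' ∧ s = s' := by
  have key : ∀ {y y' : Cn n} {s s' : ℝ}, y ∈ Metric.ball x₀ r → y ∈ frontier D →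
      y' ∈ Metric.ball x₀ r → y' ∈ frontier D → y + s • u = y' + s' • u → ¬ s < s' := by
    intro y y' s s' hy hyD hy' hyD' he hlt
    have h1 : y' = y - (s' - s) • u := by
      rw [sub_smul, ← sub_eq_zero]
      have := sub_eq_zero.2 he
      rw [← neg_eq_zero, ← this]; abel
    have h2 := h.cone y hy hyD.1 u hu (s' - s) (sub_pos.2 hlt) (h1 ▸ hy')
    rw [← h1] at h2
    rw [hDo.frontier_eq] at hyD'
    exact hyD'.2 h2
  have hs : s = s' :=
    le_antisymm (not_lt.1 (key hy' hyD' hy hyD he.symm)) (not_lt.1 (key hy hyD hy' hyD' he))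
  subst hs
  exact ⟨add_right_cancel he, rfl⟩

/-- Points of `D` near `x₀` can be projected to the boundary in all directions near `v`. -/
theorem IsTransverse.exists_proj {D : Set (Cn n)} (hDo : IsOpen D) {x₀ v : Cn n} {r δ : ℝ}
    (h : IsTransverse D x₀ r v δ) (hx₀ : x₀ ∈ frontier D) :
    ∃ r' > 0, r' ≤ r ∧ ∀ x ∈ Metric.ball x₀ r', x ∈ D → ∀ u ∈ Metric.ball v (δ / 2),
      ∃ y ∈ Metric.ball x₀ r, y ∈ frontier D ∧ ∃ s : ℝ, s < 0 ∧ x = y + s • u := by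
  have hr := h.r_pos
  have hδ := h.δ_pos
  set s₁ : ℝ := r / (2 * (‖v‖ + δ)) with hs₁
  have hvδ : 0 < ‖v‖ + δ := add_pos_of_nonneg_of_pos (norm_nonneg _) hδ
  have hs₁0 : 0 < s₁ := by positivity
  refine ⟨min (r / 2) (s₁ * (δ / 2)), by positivity, (min_le_left _ _).trans (by linarith), ?_⟩
  intro x hx hxD u hu
  have hxr : ‖x - x₀‖ < r / 2 := lt_of_lt_of_le (mem_ball_iff_norm.1 hx) (min_le_left _ _)
  have hxs : ‖x - x₀‖ < s₁ * (δ / 2) := lt_of_lt_of_le (mem_ball_iff_norm.1 hx) (min_le_right _ _)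
  have huv : ‖u - v‖ < δ / 2 := mem_ball_iff_norm.1 hu
  have hu' : ‖u‖ < ‖v‖ + δ := by
    have := norm_add_le (u - v) v
    rw [sub_add_cancel] at this
    linarith
  have hball : ∀ τ ∈ Icc 0 s₁, x + τ • u ∈ Metric.ball x₀ r := by
    intro τ hτ
    rw [mem_ball_iff_norm, add_sub_right_comm]
    refine (norm_add_le _ _).trans_lt ?_
    have h1 : ‖τ • u‖ ≤ s₁ * (‖v‖ + δ) := by
      rw [norm_smul, Real.norm_of_nonneg hτ.1]
      exact mul_le_mul hτ.2 hu'.le (norm_nonneg _) hs₁0.le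
    have h2 : s₁ * (‖v‖ + δ) = r / 2 := by rw [hs₁]; field_simp
    linarith
  -- otherwise `x₀ = x + s₁ u - s₁ u'` for a transverse vector `u'`, and `x₀` would be in `D`
  have hz : x + s₁ • u ∉ D := by
    intro hzD
    have hu'' : u + s₁⁻¹ • (x - x₀) ∈ Metric.ball v δ := by
      rw [mem_ball_iff_norm, add_sub_right_comm]
      refine (norm_add_le _ _).trans_lt ?_
      have : ‖s₁⁻¹ • (x - x₀)‖ < δ / 2 := by
        rw [norm_smul, norm_inv, Real.norm_of_nonneg hs₁0.le, inv_mul_lt_iff₀ hs₁0]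
        exact hxs
      linarith
    have he : x + s₁ • u - s₁ • (u + s₁⁻¹ • (x - x₀)) = x₀ := by
      rw [smul_add, smul_smul, mul_inv_cancel₀ hs₁0.ne', one_smul]; abel
    have h3 := h.cone _ (hball s₁ (right_mem_Icc.2 hs₁0.le)) (subset_closure hzD) _ hu'' s₁ hs₁0
      (by rw [he]; exact Metric.mem_ball_self hr)
    rw [he] at h3
    rw [hDo.frontier_eq] at hx₀
    exact hx₀.2 h3
  have hc : Continuous fun τ : ℝ => x + τ • u := by fun_prop
  have hA : IsCompact {τ ∈ Icc 0 s₁ | x + τ • u ∉ D} := by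
    refine isCompact_Icc.of_isClosed_subset ?_ fun τ hτ => hτ.1
    exact isClosed_Icc.inter (hDo.isClosed_compl.preimage hc)
  -- the first point outside `D` on the ray from `x` in the direction `u` is a boundary point
  obtain ⟨τ, ⟨hτ, hτD⟩, hmin⟩ := hA.exists_isLeast ⟨s₁, right_mem_Icc.2 hs₁0.le, hz⟩
  have hτ0 : 0 < τ := by
    refine lt_of_le_of_ne hτ.1 ?_
    rintro rfl
    simp [hxD] at hτD
  refine ⟨x + τ • u, hball τ hτ, ?_, -τ, by linarith, by module⟩
  rw [hDo.frontier_eq]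
  refine ⟨?_, hτD⟩
  have h4 : Tendsto (fun τ : ℝ => x + τ • u) (𝓝[<] τ) (𝓝 (x + τ • u)) :=
    hc.continuousAt.continuousWithinAt
  refine mem_closure_of_tendsto h4 ?_
  filter_upwards [Ioo_mem_nhdsLT hτ0] with σ hσ
  by_contra hσD
  exact (hmin ⟨⟨hσ.1.le, hσ.2.le.trans hτ.2⟩, hσD⟩).not_gt hσ.2

/-! ### The flux through the boundary -/

theorem continuous_of_zero_off {X E : Type*} [TopologicalSpace X] [TopologicalSpace E] [Zero E]
    {f : X → E} {U L : Set X} (hU : IsOpen U) (hL : IsClosed L) (hLU : L ⊆ U)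
    (hf : ContinuousOn f U) (h0 : ∀ x, x ∉ L → f x = 0) : Continuous f := by
  rw [continuous_iff_continuousAt]
  intro x
  by_cases hx : x ∈ U
  · exact hf.continuousAt (hU.mem_nhds hx)
  · have : f =ᶠ[𝓝 x] fun _ => 0 := by
      filter_upwards [hL.isOpen_compl.mem_nhds fun h => hx (hLU h)] with y hy using h0 y hy
    exact continuousAt_const.congr this.symm

/-- The density, in the `i`-th parametrization, of the flux of the constant vector field `e`
through `∂D`, weighted by the partition of unity. -/
def BoundaryAtlas.fluxDensity (𝔞 : BoundaryAtlas D) (i : Fin 𝔞.N) (e : Cn n)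
    (t : Fin (2 * n - 1) → ℝ) : ℝ :=
  (𝔞.dom i).indicator (fun t => 𝔞.weight i (𝔞.param i t) *
    orientedVolume (Fin.cons e (tangentFrame (𝔞.param i) t) : Fin (2 * n - 1 + 1) → Cn n)) t

/-- The flux of the vector field `f e` through `∂D`. -/
def BoundaryAtlas.flux {E : Type*} [NormedAddCommGroup E] [NormedSpace ℝ E] (𝔞 : BoundaryAtlas D)
    (f : Cn n → E) (e : Cn n) : E :=
  ∑ i, ∫ t, 𝔞.fluxDensity i e t • f (𝔞.param i t)

theorem BoundaryAtlas.exists_compact (𝔞 : BoundaryAtlas D) (i : Fin 𝔞.N) :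
    ∃ L, IsCompact L ∧ L ⊆ 𝔞.dom i ∧ ∀ t ∈ 𝔞.dom i, t ∉ L → 𝔞.weight i (𝔞.param i t) = 0 := by
  obtain ⟨L, hL, hLd, hw⟩ := 𝔞.subordinate i
  refine ⟨L, hL, hLd, fun t ht htL => ?_⟩
  by_contra h
  obtain ⟨t', ht', he⟩ := hw _ (𝔞.mapsTo_param i ht) h
  exact htL (𝔞.injOn_param i (hLd ht') ht he ▸ ht')

theorem BoundaryAtlas.fluxDensity_eq_zero (𝔞 : BoundaryAtlas D) (i : Fin 𝔞.N)
    {L : Set (Fin (2 * n - 1) → ℝ)}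
    (hL : ∀ t ∈ 𝔞.dom i, t ∉ L → 𝔞.weight i (𝔞.param i t) = 0) (e : Cn n) :
    ∀ t, t ∉ L → 𝔞.fluxDensity i e t = 0 := by
  intro t ht
  rw [BoundaryAtlas.fluxDensity]
  by_cases h : t ∈ 𝔞.dom i
  · rw [indicator_of_mem h, hL t h ht, zero_mul]
  · rw [indicator_of_notMem h]

theorem BoundaryAtlas.continuousOn_tangentFrame (𝔞 : BoundaryAtlas D) (i : Fin 𝔞.N) :
    ContinuousOn (tangentFrame (𝔞.param i)) (𝔞.dom i) := by
  refine continuousOn_pi.2 fun b => ?_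
  exact ((𝔞.contDiffOn_param i).continuousOn_fderiv_of_isOpen (𝔞.isOpen_dom i) le_rfl).clm_apply
    continuousOn_const

theorem BoundaryAtlas.continuousOn_weight (𝔞 : BoundaryAtlas D) (i : Fin 𝔞.N) :
    ContinuousOn (fun t => 𝔞.weight i (𝔞.param i t)) (𝔞.dom i) :=
  (𝔞.continuous_weight i).comp (𝔞.contDiffOn_param i).continuousOn (𝔞.mapsTo_param i)

theorem BoundaryAtlas.continuousOn_fluxDensity (𝔞 : BoundaryAtlas D) (i : Fin 𝔞.N) (e : Cn n) :
    ContinuousOn (𝔞.fluxDensity i e) (𝔞.dom i) := by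
  have h : ContinuousOn (fun t => 𝔞.weight i (𝔞.param i t) *
    orientedVolume (Fin.cons e (tangentFrame (𝔞.param i) t) : Fin (2 * n - 1 + 1) → Cn n))
      (𝔞.dom i) := by
    refine (𝔞.continuousOn_weight i).mul ?_
    have h1 : ContinuousOn (fun t => (Fin.cons e (tangentFrame (𝔞.param i) t) :
        Fin (2 * n - 1 + 1) → Cn n)) (𝔞.dom i) := by
      refine continuousOn_pi.2 fun b => ?_
      refine Fin.cases ?_ (fun b => ?_) b
      · simpa using continuousOn_const
      · simpa using continuousOn_pi.1 (𝔞.continuousOn_tangentFrame i) b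
    exact continuous_orientedVolume.comp_continuousOn h1
  exact h.congr fun t ht => indicator_of_mem ht _

/-- Functions on `X × ∂D`, weighted by the flux density, are continuous in the parameters. -/
theorem BoundaryAtlas.continuous_fluxDensity_smul {X E : Type*} [TopologicalSpace X]
    [NormedAddCommGroup E] [NormedSpace ℝ E] (𝔞 : BoundaryAtlas D) (i : Fin 𝔞.N) (e : Cn n)
    {f : X → Cn n → E} (hf : Continuous fun p : X × Cn n => f p.1 p.2) :
    Continuous fun p : X × (Fin (2 * n - 1) → ℝ) =>
      𝔞.fluxDensity i e p.2 • f p.1 (𝔞.param i p.2) := by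
  obtain ⟨L, hL, hLd, hw⟩ := 𝔞.exists_compact i
  refine continuous_of_zero_off (U := univ ×ˢ 𝔞.dom i) (L := univ ×ˢ L)
    (isOpen_univ.prod (𝔞.isOpen_dom i)) (isClosed_univ.prod hL.isClosed)
    (prod_mono le_rfl hLd) ?_ ?_
  · refine ((𝔞.continuousOn_fluxDensity i e).comp continuousOn_snd fun p hp => hp.2).smul ?_
    refine hf.comp_continuousOn (continuousOn_fst.prodMk ?_)
    exact (𝔞.contDiffOn_param i).continuousOn.comp continuousOn_snd fun p hp => hp.2
  · intro p hp
    rw [𝔞.fluxDensity_eq_zero i hw, zero_smul]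
    exact fun h => hp ⟨mem_univ _, h⟩

theorem BoundaryAtlas.integrable_fluxDensity_smul {E : Type*} [NormedAddCommGroup E]
    [NormedSpace ℝ E] (𝔞 : BoundaryAtlas D) (i : Fin 𝔞.N) (e : Cn n)
    {f : Cn n → E} (hf : Continuous f) :
    Integrable fun t => 𝔞.fluxDensity i e t • f (𝔞.param i t) := by
  obtain ⟨L, hL, hLd, hw⟩ := 𝔞.exists_compact i
  have hc : Continuous fun t => 𝔞.fluxDensity i e t • f (𝔞.param i t) := by
    have := 𝔞.continuous_fluxDensity_smul i e (X := Unit) (f := fun _ => f)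
      (hf.comp continuous_snd)
    exact this.comp (continuous_const.prodMk continuous_id : Continuous fun t => ((), t))
  refine hc.integrable_of_hasCompactSupport (HasCompactSupport.intro hL fun t ht => ?_)
  rw [𝔞.fluxDensity_eq_zero i hw e t ht, zero_smul]

theorem orientedVolume_cons_add {k : ℕ} (e e' : Cn n) (v : Fin k → Cn n) :
    orientedVolume (Fin.cons (e + e') v : Fin (k + 1) → Cn n) =
      orientedVolume (Fin.cons e v : Fin (k + 1) → Cn n) +
        orientedVolume (Fin.cons e' v : Fin (k + 1) → Cn n) := by
  simp only [← volAlt_apply]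
  exact (volAlt (k + 1)).toMultilinearMap.cons_add v e e'

theorem orientedVolume_cons_smul {k : ℕ} (c : ℝ) (e : Cn n) (v : Fin k → Cn n) :
    orientedVolume (Fin.cons (c • e) v : Fin (k + 1) → Cn n) =
      c * orientedVolume (Fin.cons e v : Fin (k + 1) → Cn n) := by
  simp only [← volAlt_apply]
  exact (volAlt (k + 1)).toMultilinearMap.cons_smul v c e

theorem BoundaryAtlas.fluxDensity_add (𝔞 : BoundaryAtlas D) (i : Fin 𝔞.N) (e e' : Cn n)
    (t : Fin (2 * n - 1) → ℝ) :
    𝔞.fluxDensity i (e + e') t = 𝔞.fluxDensity i e t + 𝔞.fluxDensity i e' t := by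
  simp only [BoundaryAtlas.fluxDensity]
  by_cases h : t ∈ 𝔞.dom i
  · simp only [indicator_of_mem h, orientedVolume_cons_add, mul_add]
  · simp only [indicator_of_notMem h, add_zero]

theorem BoundaryAtlas.fluxDensity_smul (𝔞 : BoundaryAtlas D) (i : Fin 𝔞.N) (c : ℝ) (e : Cn n)
    (t : Fin (2 * n - 1) → ℝ) :
    𝔞.fluxDensity i (c • e) t = c * 𝔞.fluxDensity i e t := by
  simp only [BoundaryAtlas.fluxDensity]
  by_cases h : t ∈ 𝔞.dom i
  · simp only [indicator_of_mem h, orientedVolume_cons_smul]; ring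
  · simp only [indicator_of_notMem h, mul_zero]

theorem BoundaryAtlas.flux_add_right {E : Type*} [NormedAddCommGroup E] [NormedSpace ℝ E]
    (𝔞 : BoundaryAtlas D) {f : Cn n → E} (hf : Continuous f) (e e' : Cn n) :
    𝔞.flux f (e + e') = 𝔞.flux f e + 𝔞.flux f e' := by
  simp only [BoundaryAtlas.flux, 𝔞.fluxDensity_add, add_smul]
  rw [← Finset.sum_add_distrib]
  exact Finset.sum_congr rfl fun i _ => integral_add (𝔞.integrable_fluxDensity_smul i e hf)
    (𝔞.integrable_fluxDensity_smul i e' hf)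

theorem BoundaryAtlas.flux_smul_right {E : Type*} [NormedAddCommGroup E] [NormedSpace ℝ E]
    (𝔞 : BoundaryAtlas D) (f : Cn n → E) (c : ℝ) (e : Cn n) :
    𝔞.flux f (c • e) = c • 𝔞.flux f e := by
  simp only [BoundaryAtlas.flux, 𝔞.fluxDensity_smul, mul_smul, integral_smul, Finset.smul_sum]

theorem BoundaryAtlas.flux_sum_left {E ι : Type*} [NormedAddCommGroup E] [NormedSpace ℝ E]
    (𝔞 : BoundaryAtlas D) (s : Finset ι) {f : ι → Cn n → E} (hf : ∀ l ∈ s, Continuous (f l))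
    (e : Cn n) : 𝔞.flux (fun x => ∑ l ∈ s, f l x) e = ∑ l ∈ s, 𝔞.flux (f l) e := by
  simp only [BoundaryAtlas.flux, Finset.smul_sum]
  rw [Finset.sum_comm]
  exact Finset.sum_congr rfl fun i _ => integral_finsetSum _ fun l hl =>
    𝔞.integrable_fluxDensity_smul i e (hf l hl)

/-- The flux depends only on the values on the boundary. -/
theorem BoundaryAtlas.flux_congr {E : Type*} [NormedAddCommGroup E] [NormedSpace ℝ E]
    (𝔞 : BoundaryAtlas D) {f g : Cn n → E} (h : ∀ x ∈ frontier D, f x = g x) (e : Cn n) :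
    𝔞.flux f e = 𝔞.flux g e := by
  refine Finset.sum_congr rfl fun i _ => integral_congr_ae (Eventually.of_forall fun t => ?_)
  by_cases ht : t ∈ 𝔞.dom i
  · simp only [h _ (𝔞.mapsTo_param i ht)]
  · simp only [BoundaryAtlas.fluxDensity, indicator_of_notMem ht, zero_smul]

theorem setIntegral_fin_succ {N : ℕ} {F : (Fin (N + 1) → ℝ) → ℝ} (hF : Integrable F) (A : Set ℝ)
    (O : Set (Fin N → ℝ)) :
    ∫ x in {x : Fin (N + 1) → ℝ | x 0 ∈ A ∧ Fin.tail x ∈ O}, F x =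
      ∫ t in O, ∫ s in A, F (Fin.cons s t) := by
  set e := MeasurableEquiv.piFinSuccAbove (fun _ : Fin (N + 1) => ℝ) 0
  have he : MeasurePreserving e := volume_preserving_piFinSuccAbove (fun _ : Fin (N + 1) => ℝ) 0
  have h1 := he.setIntegral_preimage_emb e.measurableEmbedding (fun p => F (e.symm p)) (A ×ˢ O)
  simp only [MeasurableEquiv.symm_apply_apply] at h1
  have h2 : e ⁻¹' (A ×ˢ O) = {x : Fin (N + 1) → ℝ | x 0 ∈ A ∧ Fin.tail x ∈ O} := rfl
  have h3 : ∀ s t, e.symm (s, t) = Fin.cons s t := fun s t => by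
    simp [e, MeasurableEquiv.piFinSuccAbove]
    rfl
  have hint : Integrable (fun p => F (e.symm p)) :=
    (he.symm e).integrable_comp_of_integrable hF
  rw [← h2, h1]
  change ∫ p, F (e.symm p) ∂((volume.prod volume : Measure (ℝ × (Fin N → ℝ))).restrict (A ×ˢ O)) = _
  rw [← Measure.prod_restrict, integral_prod_symm]
  · simp only [h3]
  · rw [Measure.prod_restrict]
    exact hint.restrict

/-! ### The divergence theorem -/

/-- The map `(s, t) ↦ γ(t) + s u` that sweeps out a neighbourhood of the boundary. -/
def sweep {k : ℕ} (γ : (Fin k → ℝ) → Cn n) (u : Cn n) (x : Fin (k + 1) → ℝ) : Cn n :=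
  γ (Fin.tail x) + x 0 • u

/-- The derivative of `sweep`. -/
def sweepDeriv {k : ℕ} (γ : (Fin k → ℝ) → Cn n) (u : Cn n) (x : Fin (k + 1) → ℝ) :
    (Fin (k + 1) → ℝ) →L[ℝ] Cn n :=
  fderiv ℝ γ (Fin.tail x) ∘L
      (ContinuousLinearMap.pi fun j : Fin k =>
        ContinuousLinearMap.proj (R := ℝ) (φ := fun _ : Fin (k + 1) => ℝ) j.succ) +
    (ContinuousLinearMap.proj (R := ℝ) (φ := fun _ : Fin (k + 1) => ℝ) 0).smulRight u

theorem hasFDerivAt_sweep {k : ℕ} {γ : (Fin k → ℝ) → Cn n} (u : Cn n) {x : Fin (k + 1) → ℝ}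
    (h : DifferentiableAt ℝ γ (Fin.tail x)) : HasFDerivAt (sweep γ u) (sweepDeriv γ u x) x := by
  have h1 : HasFDerivAt (fun y : Fin (k + 1) → ℝ => (Fin.tail y : Fin k → ℝ))
      (ContinuousLinearMap.pi fun j : Fin k =>
        ContinuousLinearMap.proj (R := ℝ) (φ := fun _ : Fin (k + 1) => ℝ) j.succ) x :=
    (ContinuousLinearMap.pi fun j : Fin k =>
        ContinuousLinearMap.proj (R := ℝ) (φ := fun _ : Fin (k + 1) => ℝ) j.succ).hasFDerivAt
  have h2 : HasFDerivAt (fun y : Fin (k + 1) → ℝ => y 0 • u)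
      ((ContinuousLinearMap.proj (R := ℝ) (φ := fun _ : Fin (k + 1) => ℝ) 0).smulRight u) x :=
    ContinuousLinearMap.hasFDerivAt
      ((ContinuousLinearMap.proj (R := ℝ) (φ := fun _ : Fin (k + 1) => ℝ) 0).smulRight u)
  exact (h.hasFDerivAt.comp x h1).add h2

theorem sweepDeriv_single {k : ℕ} (γ : (Fin k → ℝ) → Cn n) (u : Cn n) (x : Fin (k + 1) → ℝ) :
    (fun b => sweepDeriv γ u x (Pi.single b 1)) =
      (Fin.cons u (tangentFrame γ (Fin.tail x)) : Fin (k + 1) → Cn n) := by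
  funext b
  refine Fin.cases ?_ (fun b => ?_) b
  · have : (fun j : Fin k => (Pi.single 0 1 : Fin (k + 1) → ℝ) j.succ) = 0 := by
      funext j; simp
    simp only [sweepDeriv, add_apply, ContinuousLinearMap.comp_apply,
      ContinuousLinearMap.smulRight_apply, Fin.cons_zero]
    change fderiv ℝ γ (Fin.tail x) (fun j : Fin k => (Pi.single 0 1 : Fin (k + 1) → ℝ) j.succ) +
      (Pi.single 0 1 : Fin (k + 1) → ℝ) 0 • u = u
    rw [this]; simp
  · have : (fun j : Fin k => (Pi.single b.succ 1 : Fin (k + 1) → ℝ) j.succ) = Pi.single b 1 := by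
      funext j; simp [Pi.single_apply]
    simp only [sweepDeriv, add_apply, ContinuousLinearMap.comp_apply,
      ContinuousLinearMap.smulRight_apply, Fin.cons_succ]
    change fderiv ℝ γ (Fin.tail x) (fun j : Fin k => (Pi.single b.succ 1 : Fin (k + 1) → ℝ) j.succ) +
      (Pi.single b.succ 1 : Fin (k + 1) → ℝ) 0 • u = _
    rw [this]; simp [tangentFrame]

theorem integral_Iio_fderiv_line {g : Cn n → ℝ} (hg : ContDiff ℝ 1 g) (hgc : HasCompactSupport g)
    {u : Cn n} (hu : u ≠ 0) (y : Cn n) :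
    ∫ s in Iio (0 : ℝ), fderiv ℝ g (y + s • u) u = g y := by
  have hc : ContDiff ℝ 1 fun s : ℝ => g (y + s • u) :=
    hg.comp (contDiff_const.add (contDiff_id.smul contDiff_const))
  have hemb : IsClosedEmbedding fun s : ℝ => y + s • u :=
    (Homeomorph.addLeft y).isClosedEmbedding.comp
      (isClosedEmbedding_smul_left hu)
  have hcs : HasCompactSupport fun s : ℝ => g (y + s • u) := hgc.comp_isClosedEmbedding hemb
  have h := hcs.integral_Iic_deriv_eq hc 0
  rw [zero_smul, add_zero, integral_Iic_eq_integral_Iio] at h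
  rw [← h]
  congr 1
  funext s
  have h1 : HasDerivAt (fun s : ℝ => y + s • u) u s := by
    simpa using ((hasDerivAt_id s).smul_const u).const_add y
  exact (((hg.differentiable (by simp)) _).hasFDerivAt.comp_hasDerivAt s h1).deriv.symm

/-- The divergence theorem for a function supported near a boundary point, in a transverse
direction: the parametrizations of `∂D` are swept along the direction, which reduces the claim to
the fundamental theorem of calculus. -/
theorem stokes_of_isTransverse (hn : 0 < n) (hDo : IsOpen D) (𝔞 : BoundaryAtlas D)
    {x₀ v : Cn n} {r δ : ℝ} (h : IsTransverse D x₀ r v δ) (hx₀ : x₀ ∈ frontier D) {r' : ℝ}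
    (hr' : r' ≤ r) {u : Cn n} (hu : u ∈ Metric.ball v δ)
    (hproj : ∀ x ∈ Metric.ball x₀ r', x ∈ D →
      ∃ y ∈ Metric.ball x₀ r, y ∈ frontier D ∧ ∃ s : ℝ, s < 0 ∧ x = y + s • u)
    {g : Cn n → ℝ} (hg : ContDiff ℝ 1 g) (hgs : tsupport g ⊆ Metric.ball x₀ r') :
    ∫ x in D, fderiv ℝ g x u = 𝔞.flux g u := by
  classical
  have hu0 : u ≠ 0 := h.ne_zero hx₀ hu
  have hgc : HasCompactSupport g := HasCompactSupport.of_support_subset_isCompact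
    (isCompact_closedBall x₀ r')
    ((subset_tsupport g).trans (hgs.trans Metric.ball_subset_closedBall))
  set G : Cn n → ℝ := fun x => fderiv ℝ g x u with hG
  have hGc : Continuous G := (hg.continuous_fderiv (by simp)).clm_apply continuous_const
  have hGs : ∀ x, G x ≠ 0 → x ∈ Metric.ball x₀ r' := by
    intro x hx
    refine hgs (support_fderiv_subset ℝ fun h0 => hx ?_)
    simp only [hG, h0, zero_apply]
  -- the projection to the boundary along `u`
  set π : Cn n → Cn n := fun x =>
    if hx : ∃ y ∈ Metric.ball x₀ r, y ∈ frontier D ∧ ∃ s : ℝ, x = y + s • u then hx.choose else 0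
    with hπ
  have hπ_eq : ∀ y ∈ Metric.ball x₀ r, y ∈ frontier D → ∀ s : ℝ, π (y + s • u) = y := by
    intro y hy hyD s
    have hx : ∃ y' ∈ Metric.ball x₀ r, y' ∈ frontier D ∧ ∃ s' : ℝ, y + s • u = y' + s' • u :=
      ⟨y, hy, hyD, s, rfl⟩
    rw [hπ]
    simp only [dif_pos hx]
    obtain ⟨h1, h2, s', h3⟩ := hx.choose_spec
    exact (h.eq_of_add_smul_eq hDo hu hy hyD h1 h2 h3).1.symm
  -- the pieces swept out by the parametrizations
  set O : Fin 𝔞.N → Set (Fin (2 * n - 1) → ℝ) := fun i =>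
    𝔞.dom i ∩ 𝔞.param i ⁻¹' Metric.ball x₀ r with hO
  have hOo : ∀ i, IsOpen (O i) := fun i =>
    (𝔞.contDiffOn_param i).continuousOn.isOpen_inter_preimage (𝔞.isOpen_dom i) Metric.isOpen_ball
  set A : Fin 𝔞.N → Set (Fin (2 * n - 1 + 1) → ℝ) := fun i =>
    {x | x 0 ∈ Iio (0 : ℝ) ∧ Fin.tail x ∈ O i} with hA
  have htail : Continuous fun x : Fin (2 * n - 1 + 1) → ℝ => (Fin.tail x : Fin (2 * n - 1) → ℝ) :=
    continuous_pi fun j => continuous_apply j.succ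
  have hAm : ∀ i, MeasurableSet (A i) := fun i =>
    ((isOpen_Iio.preimage (continuous_apply 0)).inter ((hOo i).preimage htail)).measurableSet
  have hmem : ∀ i, ∀ t ∈ O i, 𝔞.param i t ∈ frontier D := fun i t ht => 𝔞.mapsTo_param i ht.1
  have hΦ : ∀ i, ∀ x ∈ A i, HasFDerivWithinAt (sweep (𝔞.param i) u)
      (sweepDeriv (𝔞.param i) u x) (A i) x := by
    intro i x hx
    refine (hasFDerivAt_sweep u ?_).hasFDerivWithinAt
    exact ((𝔞.contDiffOn_param i).contDiffAt ((𝔞.isOpen_dom i).mem_nhds hx.2.1)).differentiableAt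
      (by simp)
  have hinj : ∀ i, InjOn (sweep (𝔞.param i) u) (A i) := by
    intro i x hx y hy hxy
    obtain ⟨h1, h2⟩ := h.eq_of_add_smul_eq hDo hu hx.2.2 (hmem i _ hx.2) hy.2.2 (hmem i _ hy.2) hxy
    have h3 := 𝔞.injOn_param i hx.2.1 hy.2.1 h1
    rw [← Fin.cons_self_tail x, ← Fin.cons_self_tail y, h2, h3]
  set f : Fin 𝔞.N → Cn n → ℝ := fun i x => 𝔞.weight i (π x) * G x with hf
  set F : Fin 𝔞.N → (Fin (2 * n - 1 + 1) → ℝ) → ℝ := fun i x =>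
    𝔞.fluxDensity i u (Fin.tail x) * G (sweep (𝔞.param i) u x) with hF
  have hFint : ∀ i, Integrable (F i) := by
    intro i
    obtain ⟨L, hL, hLd, hw⟩ := 𝔞.exists_compact i
    have hc1 : Continuous fun p : ℝ × (Fin (2 * n - 1) → ℝ) =>
        𝔞.fluxDensity i u p.2 • G (𝔞.param i p.2 + p.1 • u) :=
      𝔞.continuous_fluxDensity_smul i u (f := fun (s : ℝ) y => G (y + s • u))
        (hGc.comp (by fun_prop))
    have hc : Continuous (F i) :=
      hc1.comp ((continuous_apply (0 : Fin (2 * n - 1 + 1))).prodMk htail)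
    -- the support is bounded as `g` and the density have compact support
    obtain ⟨C, hC⟩ := (hL.image_of_continuousOn
      ((𝔞.contDiffOn_param i).continuousOn.mono hLd)).isBounded.subset_closedBall x₀
    have hcs : HasCompactSupport (F i) := by
      set R := (C + r') / ‖u‖
      refine HasCompactSupport.intro (K := (fun p : ℝ × (Fin (2 * n - 1) → ℝ) =>
        (Fin.cons p.1 p.2 : Fin (2 * n - 1 + 1) → ℝ)) '' (Icc (-R) R ×ˢ L)) ?_ ?_
      · refine (isCompact_Icc.prod hL).image (continuous_pi fun j => ?_)
        refine Fin.cases ?_ (fun j => ?_) j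
        · simpa using continuous_fst
        · simp only [Fin.cons_succ]; fun_prop
      · intro x hx
        by_contra hne
        have h1 : Fin.tail x ∈ L := by
          by_contra h1
          exact hne (by simp only [hF, 𝔞.fluxDensity_eq_zero i hw u _ h1, zero_mul])
        have h2 : G (sweep (𝔞.param i) u x) ≠ 0 := fun h2 => hne (by simp only [hF, h2, mul_zero])
        have h3 := Metric.mem_closedBall.1 (hC (mem_image_of_mem _ h1))
        have h4 := Metric.mem_ball.1 (hGs _ h2)
        refine hx ⟨(x 0, Fin.tail x), ⟨?_, h1⟩, Fin.cons_self_tail x⟩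
        change -R ≤ x 0 ∧ x 0 ≤ R
        rw [← abs_le, le_div_iff₀ (norm_pos_iff.2 hu0), ← Real.norm_eq_abs, ← norm_smul]
        have h5 : x 0 • u = (sweep (𝔞.param i) u x - x₀) - (𝔞.param i (Fin.tail x) - x₀) := by
          simp only [sweep]; abel
        rw [h5]
        refine (norm_sub_le _ _).trans ?_
        rw [← dist_eq_norm, ← dist_eq_norm]
        linarith
    exact hc.integrable_of_hasCompactSupport hcs
  -- the orientation of the parametrizations makes the Jacobian of the sweep positive
  have hFf : ∀ i, ∀ x ∈ A i, |orientedVolume fun b => sweepDeriv (𝔞.param i) u x (Pi.single b 1)| *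
      f i (sweep (𝔞.param i) u x) = F i x := by
    intro i x hx
    obtain ⟨ρ, hρ, hρu⟩ := h.outward _ hx.2.2 (hmem i _ hx.2)
    have hpos := 𝔞.oriented i _ hx.2.1 ρ u hρ (hρu u hu)
    rw [sweepDeriv_single, abs_of_pos hpos]
    simp only [hf, hF, BoundaryAtlas.fluxDensity, indicator_of_mem hx.2.1]
    rw [sweep, hπ_eq _ hx.2.2 (hmem i _ hx.2)]
    ring
  have hk : 2 * n - 1 + 1 = 2 * n := by omega
  have hfint : ∀ i, IntegrableOn (f i) (sweep (𝔞.param i) u '' A i) := by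
    intro i
    rw [integrableOn_image_iff_orientedVolume hk (hAm i) (hΦ i) (hinj i)]
    exact ((hFint i).integrableOn).congr_fun (fun x hx => (hFf i x hx).symm) (hAm i)
  -- Mathlib's results on images of injective differentiable maps are about one space, so the
  -- sweep is composed with real coordinates
  have hXm : ∀ i, MeasurableSet (sweep (𝔞.param i) u '' A i) := by
    intro i
    have hΨm := measurable_image_of_fderivWithin (hAm i)
      (f := fun x => (realCoord (n := n) hk).symm (sweep (𝔞.param i) u x))
      (f' := fun x => (((realCoord (n := n) hk).symm :
        Cn n →L[ℝ] (Fin (2 * n - 1 + 1) → ℝ)) ∘L sweepDeriv (𝔞.param i) u x))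
      (fun x hx => ((realCoord (n := n) hk).symm :
        Cn n →L[ℝ] (Fin (2 * n - 1 + 1) → ℝ)).hasFDerivAt.comp_hasFDerivWithinAt x (hΦ i x hx))
      fun x hx y hy hxy => hinj i hx hy ((realCoord (n := n) hk).symm.injective hxy)
    have := (realCoord (n := n) hk).symm.continuous.measurable hΨm
    convert this using 1
    ext y
    constructor
    · rintro ⟨x, hx, rfl⟩; exact ⟨x, hx, rfl⟩
    · rintro ⟨x, hx, hxy⟩; exact ⟨x, hx, (realCoord (n := n) hk).symm.injective hxy⟩
  -- on `D` the function is the sum of its weighted pieces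
  have hsum : ∀ x, D.indicator G x = ∑ i, (sweep (𝔞.param i) u '' A i).indicator (f i) x := by
    intro x
    by_cases hGx : G x = 0
    · have : ∀ i, f i x = 0 := fun i => by simp only [hf, hGx, mul_zero]
      have h1 : ∀ i, (sweep (𝔞.param i) u '' A i).indicator (f i) x = 0 := by
        intro i; rw [indicator_apply, this]; simp
      rw [indicator_apply, hGx]; simp [h1]
    have hxb := hGs x hGx
    by_cases hxD : x ∈ D
    · obtain ⟨y, hy, hyD, s, hs, rfl⟩ := hproj x hxb hxD
      have h1 : ∀ i, (sweep (𝔞.param i) u '' A i).indicator (f i) (y + s • u) =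
          𝔞.weight i y * G (y + s • u) := by
        intro i
        by_cases hi : y + s • u ∈ sweep (𝔞.param i) u '' A i
        · rw [indicator_of_mem hi]
          simp only [hf, hπ_eq y hy hyD s]
        · rw [indicator_of_notMem hi]
          have : 𝔞.weight i y = 0 := by
            by_contra hw
            obtain ⟨L, -, hLd, hLw⟩ := 𝔞.subordinate i
            obtain ⟨t, ht, rfl⟩ := hLw y hyD hw
            exact hi ⟨Fin.cons s t, ⟨by simpa using hs, by simpa [hO] using ⟨hLd ht, hy⟩⟩,
              by simp [sweep]⟩
          rw [this, zero_mul]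
      simp only [h1]
      rw [indicator_of_mem hxD, ← Finset.sum_mul, 𝔞.sum_weight y hyD, one_mul]
    · rw [indicator_of_notMem hxD]
      refine (Finset.sum_eq_zero fun i _ => indicator_of_notMem ?_ _).symm
      rintro ⟨x', hx', rfl⟩
      apply hxD
      have h2 := h.cone _ hx'.2.2 (hmem i _ hx'.2).1 u hu (-(x' 0)) (neg_pos.2 hx'.1)
      have h3 : 𝔞.param i (Fin.tail x') - -(x' 0) • u = sweep (𝔞.param i) u x' := by
        simp only [sweep]; module
      rw [h3] at h2
      exact h2 (Metric.ball_subset_ball hr' hxb)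
  calc ∫ x in D, fderiv ℝ g x u = ∫ x, D.indicator G x := (integral_indicator hDo.measurableSet).symm
    _ = ∫ x, ∑ i, (sweep (𝔞.param i) u '' A i).indicator (f i) x := by simp only [hsum]
    _ = ∑ i, ∫ x, (sweep (𝔞.param i) u '' A i).indicator (f i) x :=
        integral_finsetSum _ fun i _ => (integrable_indicator_iff (hXm i)).2 (hfint i)
    _ = 𝔞.flux g u := by
        refine Finset.sum_congr rfl fun i _ => ?_
        rw [integral_indicator (hXm i), setIntegral_image_eq_orientedVolume hk (hAm i) (hΦ i)
          (hinj i), setIntegral_congr_fun (hAm i) (hFf i), setIntegral_fin_succ (hFint i)]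
        simp only [hF, sweep, Fin.tail_cons, Fin.cons_zero, integral_const_mul, hG,
          integral_Iio_fderiv_line hg hgc hu0]
        refine (setIntegral_eq_integral_of_forall_compl_eq_zero fun t ht => ?_)
        by_cases hti : t ∈ 𝔞.dom i
        · have : 𝔞.param i t ∉ tsupport g := fun hmem' =>
            ht ⟨hti, Metric.ball_subset_ball hr' (hgs hmem')⟩
          rw [image_eq_zero_of_notMem_tsupport this, mul_zero]
        · simp only [BoundaryAtlas.fluxDensity, indicator_of_notMem hti, zero_mul]

theorem integrable_fderiv_apply {g : Cn n → ℝ} (hg : ContDiff ℝ 1 g) (hgc : HasCompactSupport g)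
    (e : Cn n) : Integrable fun x => fderiv ℝ g x e :=
  ((hg.continuous_fderiv (by simp)).clm_apply continuous_const).integrable_of_hasCompactSupport
    (hgc.fderiv_apply ℝ e)

/-- The divergence theorem for functions supported near a boundary point. Every vector is a linear
combination of two transverse ones. -/
theorem exists_stokes_nhds_frontier (hn : 0 < n) (hDo : IsOpen D) (hD : HasC1Boundary D)
    (𝔞 : BoundaryAtlas D) {x₀ : Cn n} (hx₀ : x₀ ∈ frontier D) :
    ∃ r > 0, ∀ g : Cn n → ℝ, ContDiff ℝ 1 g → tsupport g ⊆ Metric.ball x₀ r →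
      ∀ e, ∫ x in D, fderiv ℝ g x e = 𝔞.flux g e := by
  obtain ⟨r, v, δ, h⟩ := exists_isTransverse hDo hD hx₀
  have hδ := h.δ_pos
  obtain ⟨r', hr'0, hr', hproj⟩ := h.exists_proj hDo hx₀
  refine ⟨r', hr'0, fun g hg hgs e => ?_⟩
  have hgc : HasCompactSupport g := HasCompactSupport.of_support_subset_isCompact
    (isCompact_closedBall x₀ r')
    ((subset_tsupport g).trans (hgs.trans Metric.ball_subset_closedBall))
  have key : ∀ u ∈ Metric.ball v (δ / 2), ∫ x in D, fderiv ℝ g x u = 𝔞.flux g u := fun u hu =>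
    stokes_of_isTransverse hn hDo 𝔞 h hx₀ hr' (Metric.ball_subset_ball (by linarith) hu)
      (fun x hx hxD => hproj x hx hxD u hu) hg hgs
  -- `v + c e` is still transverse, and `c e = (v + c e) - v`
  set c : ℝ := δ / (4 * (‖e‖ + 1)) with hc
  have he : 0 < ‖e‖ + 1 := by positivity
  have hc0 : 0 < c := by positivity
  have h1 := key v (Metric.mem_ball_self (by linarith))
  have h2 := key (v + c • e) (by
    rw [mem_ball_iff_norm, add_sub_cancel_left, norm_smul, Real.norm_of_nonneg hc0.le]
    have : c * (‖e‖ + 1) = δ / 4 := by rw [hc]; field_simp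
    nlinarith)
  rw [𝔞.flux_add_right hg.continuous, 𝔞.flux_smul_right, ← h1] at h2
  simp only [map_add, map_smul, smul_eq_mul] at h2
  rw [integral_add (integrable_fderiv_apply hg hgc v).integrableOn
    ((integrable_fderiv_apply hg hgc e).integrableOn.const_mul c), integral_const_mul] at h2
  exact mul_left_cancel₀ hc0.ne' (add_left_cancel h2)

/-- At an interior point both sides vanish. -/
theorem exists_stokes_nhds (hn : 0 < n) (hDo : IsOpen D) (hD : HasC1Boundary D)
    (𝔞 : BoundaryAtlas D) {x₀ : Cn n} (hx₀ : x₀ ∈ closure D) :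
    ∃ r > 0, ∀ g : Cn n → ℝ, ContDiff ℝ 1 g → tsupport g ⊆ Metric.ball x₀ r →
      ∀ e, ∫ x in D, fderiv ℝ g x e = 𝔞.flux g e := by
  by_cases hxD : x₀ ∈ D
  · obtain ⟨r, hr, hrD⟩ := Metric.isOpen_iff.1 hDo x₀ hxD
    refine ⟨r, hr, fun g hg hgs e => ?_⟩
    have hgc : HasCompactSupport g := HasCompactSupport.of_support_subset_isCompact
      (isCompact_closedBall x₀ r)
      ((subset_tsupport g).trans (hgs.trans Metric.ball_subset_closedBall))
    have h1 : ∫ x in D, fderiv ℝ g x e = ∫ x, fderiv ℝ g x e := by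
      refine setIntegral_eq_integral_of_forall_compl_eq_zero fun x hx => ?_
      have : fderiv ℝ g x = 0 := by
        by_contra h
        exact hx (hrD (hgs (support_fderiv_subset ℝ h)))
      rw [this, zero_apply]
    have h2 : ∫ x, fderiv ℝ g x e = 0 := by
      have := integral_mul_fderiv_eq_neg_fderiv_mul_of_integrable (μ := (volume : Measure (Cn n)))
        (f := fun _ : Cn n => (1 : ℝ)) (g := g) (v := e) (by simp)
        (by simpa using integrable_fderiv_apply hg hgc e)
        (by simpa using hg.continuous.integrable_of_hasCompactSupport hgc)
        (fun x _ => differentiableAt_const _) (fun x _ => hg.differentiable (by simp) x)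
      simpa using this
    have h3 : 𝔞.flux g e = 𝔞.flux (fun _ => (0 : ℝ)) e := by
      refine 𝔞.flux_congr (fun x hx => ?_) e
      refine image_eq_zero_of_notMem_tsupport fun h => ?_
      rw [hDo.frontier_eq] at hx
      exact hx.2 (hrD (hgs h))
    rw [h1, h2, h3]
    simp [BoundaryAtlas.flux]
  · exact exists_stokes_nhds_frontier hn hDo hD 𝔞 (by rw [hDo.frontier_eq]; exact ⟨hx₀, hxD⟩)

theorem exists_finite_partition {s : Set (Cn n)} (hs : IsCompact s) {U : Cn n → Set (Cn n)}
    (hU : ∀ x ∈ s, IsOpen (U x) ∧ x ∈ U x) :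
    ∃ (t : Finset (Cn n)) (η : t → Cn n → ℝ), (∀ l : t, (l : Cn n) ∈ s) ∧
      (∀ l, ContDiff ℝ ∞ (η l)) ∧ (∀ l x, 0 ≤ η l x) ∧ (∀ l, tsupport (η l) ⊆ U l) ∧
      (∀ x, ∑ l, η l x ≤ 1) ∧ ∀ x ∈ s, ∑ l, η l x = 1 := by
  obtain ⟨t, hts, hcov⟩ := hs.elim_nhds_subcover U fun x hx => (hU x hx).1.mem_nhds (hU x hx).2
  obtain ⟨f, hf⟩ := SmoothPartitionOfUnity.exists_isSubordinate (modelWithCornersSelf ℝ (Cn n))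
    hs.isClosed (fun l : t => U l) (fun l => (hU l (hts l l.2)).1) (by
      intro x hx
      obtain ⟨l, hl, hxl⟩ := mem_iUnion₂.1 (hcov hx)
      exact mem_iUnion.2 ⟨⟨l, hl⟩, hxl⟩)
  refine ⟨t, fun l => f l, fun l => hts l l.2, fun l => (f l).contMDiff.contDiff, fun l x =>
    f.nonneg l x, hf, fun x => ?_, fun x hx => ?_⟩
  · rw [← finsum_eq_sum_of_fintype]; exact f.sum_le_one x
  · rw [← finsum_eq_sum_of_fintype]; exact f.sum_eq_one hx

/-- **Divergence theorem** on a bounded domain with `C¹` boundary. -/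
theorem integral_fderiv_eq_flux (hn : 0 < n) (hDo : IsOpen D) (hDc : IsCompact (closure D))
    (hD : HasC1Boundary D) (𝔞 : BoundaryAtlas D) {g : Cn n → ℝ} (hg : ContDiff ℝ 1 g) (e : Cn n) :
    ∫ x in D, fderiv ℝ g x e = 𝔞.flux g e := by
  have h1 : ∀ x₀, ∃ r, x₀ ∈ closure D → 0 < r ∧ ∀ g : Cn n → ℝ, ContDiff ℝ 1 g →
      tsupport g ⊆ Metric.ball x₀ r → ∀ e, ∫ x in D, fderiv ℝ g x e = 𝔞.flux g e := by
    intro x₀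
    by_cases hx₀ : x₀ ∈ closure D
    · obtain ⟨r, hr, h⟩ := exists_stokes_nhds hn hDo hD 𝔞 hx₀
      exact ⟨r, fun _ => ⟨hr, h⟩⟩
    · exact ⟨0, fun h => absurd h hx₀⟩
  choose r hr using h1
  obtain ⟨t, η, hts, hη, -, hηs, -, hsum⟩ := exists_finite_partition hDc
    (U := fun x => Metric.ball x (r x))
    fun x hx => ⟨Metric.isOpen_ball, Metric.mem_ball_self (hr x hx).1⟩
  have hη1 : ∀ l, ContDiff ℝ 1 fun x => η l x * g x := fun l =>
    ((hη l).of_le (by norm_cast)).mul hg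
  have hηsup : ∀ l, tsupport (fun x => η l x * g x) ⊆ Metric.ball (l : Cn n) (r l) := fun l =>
    (tsupport_mul_subset_left).trans (hηs l)
  have hηc : ∀ l, HasCompactSupport fun x => η l x * g x := fun l =>
    HasCompactSupport.of_support_subset_isCompact (isCompact_closedBall (l : Cn n) (r l))
      ((subset_tsupport _).trans ((hηsup l).trans Metric.ball_subset_closedBall))
  have h2 : ∫ x in D, fderiv ℝ g x e = ∫ x in D, ∑ l, fderiv ℝ (fun x => η l x * g x) x e := by
    refine setIntegral_congr_fun hDo.measurableSet fun x hx => ?_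
    have h3 : g =ᶠ[𝓝 x] fun y => ∑ l, η l y * g y := by
      filter_upwards [hDo.mem_nhds hx] with y hy
      rw [← Finset.sum_mul, hsum y (subset_closure hy), one_mul]
    rw [h3.fderiv_eq, fderiv_fun_sum fun l _ => (hη1 l).differentiable (by simp) x, sum_apply]
  rw [h2, integral_finsetSum _ fun l _ => (integrable_fderiv_apply (hη1 l) (hηc l) e).integrableOn]
  have h4 : ∀ l, ∫ x in D, fderiv ℝ (fun x => η l x * g x) x e =
      𝔞.flux (fun x => η l x * g x) e := fun l => (hr l (hts l)).2 _ (hη1 l) (hηsup l) e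
  simp only [h4]
  rw [← 𝔞.flux_sum_left _ fun l _ => (hη1 l).continuous]
  refine 𝔞.flux_congr (fun x hx => ?_) e
  rw [← Finset.sum_mul, hsum x (frontier_subset_closure hx), one_mul]

/-! ### Cut-off functions adapted to the boundary -/

/-- An approximate identity `κ_j` such that, near points of `W`, smoothing the indicator function of
`D` with `κ_j` gives a function that vanishes outside a compact part of `D`. -/
structure IsInwardMollifier (D W : Set (Cn n)) (κ : ℕ → Cn n → ℝ) : Prop where
  contDiff : ∀ j, ContDiff ℝ ∞ (κ j)
  hasCompactSupport : ∀ j, HasCompactSupport (κ j)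
  nonneg : ∀ j x, 0 ≤ κ j x
  integral_eq_one : ∀ j, ∫ x, κ j x = 1
  tsupport_subset : ∀ ε > 0, ∀ᶠ j in atTop, tsupport (κ j) ⊆ Metric.ball 0 ε
  inward : ∀ A, IsCompact A → A ⊆ W → ∀ᶠ j in atTop, ∀ x ∈ A, ∀ y ∈ tsupport (κ j),
    x - y ∈ closure D → x ∈ D

/-- At interior points any approximate identity is inward, at boundary points one whose supports lie
in the cone of transverse directions. -/
theorem exists_isInwardMollifier (hDo : IsOpen D) (hD : HasC1Boundary D) {x₀ : Cn n}
    (hx₀ : x₀ ∈ closure D) : ∃ r > 0, ∃ κ, IsInwardMollifier D (Metric.ball x₀ r) κ := by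
  -- bump functions with centre `-s v` and radius `s δ`, for `s = 1 / (j + 1)`
  have bumps : ∀ (v : Cn n) (δ : ℝ), 0 < δ → ∃ κ : ℕ → Cn n → ℝ, (∀ j, ContDiff ℝ ∞ (κ j)) ∧
      (∀ j, HasCompactSupport (κ j)) ∧ (∀ j x, 0 ≤ κ j x) ∧ (∀ j, ∫ x, κ j x = 1) ∧
      (∀ j y, y ∈ tsupport (κ j) → ∃ u ∈ Metric.closedBall v δ, y = -((1 / ((j : ℝ) + 1)) • u)) ∧
      ∀ ε > 0, ∀ᶠ j in atTop, tsupport (κ j) ⊆ Metric.ball 0 ε := by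
    intro v δ hδ
    have hs : ∀ j : ℕ, 0 < 1 / ((j : ℝ) + 1) := fun j => by positivity
    let b : ∀ j : ℕ, ContDiffBump (-((1 / ((j : ℝ) + 1)) • v)) := fun j =>
      { rIn := 1 / ((j : ℝ) + 1) * δ / 2
        rOut := 1 / ((j : ℝ) + 1) * δ
        rIn_pos := by have := hs j; positivity
        rIn_lt_rOut := by have := mul_pos (hs j) hδ; linarith }
    have hts : ∀ j y, y ∈ tsupport ((b j).normed volume) →
        ∃ u ∈ Metric.closedBall v δ, y = -((1 / ((j : ℝ) + 1)) • u) := by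
      intro j y hy
      rw [(b j).tsupport_normed_eq] at hy
      refine ⟨-(((j : ℝ) + 1) • y), ?_, ?_⟩
      · have h1 : -(((j : ℝ) + 1) • y) - v =
            -(((j : ℝ) + 1) • (y - -((1 / ((j : ℝ) + 1)) • v))) := by
          rw [sub_neg_eq_add, smul_add, smul_smul, mul_one_div_cancel (by positivity), one_smul]
          abel
        rw [mem_closedBall_iff_norm, h1, norm_neg, norm_smul,
          Real.norm_of_nonneg (by positivity : (0 : ℝ) ≤ (j : ℝ) + 1)]
        rw [mem_closedBall_iff_norm] at hy
        calc ((j : ℝ) + 1) * ‖y - -((1 / ((j : ℝ) + 1)) • v)‖ ≤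
            ((j : ℝ) + 1) * (1 / ((j : ℝ) + 1) * δ) := by gcongr
          _ = δ := by field_simp
      · rw [smul_neg, smul_smul, one_div_mul_cancel (by positivity), one_smul, neg_neg]
    refine ⟨fun j => (b j).normed volume, fun j => (b j).contDiff_normed,
      fun j => (b j).hasCompactSupport_normed, fun j => (b j).nonneg_normed,
      fun j => (b j).integral_normed, hts, fun ε hε => ?_⟩
    have h2 : Tendsto (fun j : ℕ => 1 / ((j : ℝ) + 1) * (‖v‖ + δ)) atTop (𝓝 0) := by
      simpa using tendsto_one_div_add_atTop_nhds_zero_nat.mul_const (‖v‖ + δ)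
    filter_upwards [h2.eventually (gt_mem_nhds hε)] with j hj y hy
    obtain ⟨u, hu, rfl⟩ := hts j y hy
    rw [mem_ball_zero_iff, norm_neg, norm_smul, Real.norm_of_nonneg (hs j).le]
    refine lt_of_le_of_lt (mul_le_mul_of_nonneg_left ?_ (hs j).le) hj
    have := norm_add_le v (u - v)
    rw [add_sub_cancel] at this
    exact this.trans (add_le_add_right (mem_closedBall_iff_norm.1 hu) _)
  by_cases hxD : x₀ ∈ D
  · obtain ⟨r, hr, hrD⟩ := Metric.isOpen_iff.1 hDo x₀ hxD
    obtain ⟨κ, h1, h2, h3, h4, -, h6⟩ := bumps 0 1 one_pos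
    exact ⟨r, hr, κ, h1, h2, h3, h4, h6, fun A _ hA =>
      Eventually.of_forall fun j x hx _ _ _ => hrD (hA hx)⟩
  · obtain ⟨r, v, δ, h⟩ := exists_isTransverse hDo hD
      (by rw [hDo.frontier_eq]; exact ⟨hx₀, hxD⟩)
    have hδ := h.δ_pos
    obtain ⟨κ, h1, h2, h3, h4, h5, h6⟩ := bumps v (δ / 2) (by linarith)
    refine ⟨r, h.r_pos, κ, h1, h2, h3, h4, h6, fun A hA hAW => ?_⟩
    obtain ⟨ε, hε, hεA⟩ := hA.exists_thickening_subset_open Metric.isOpen_ball hAW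
    filter_upwards [h6 ε hε] with j hj x hx y hy hxy
    obtain ⟨u, hu, rfl⟩ := h5 j y hy
    have hxb : x - -((1 / ((j : ℝ) + 1)) • u) ∈ Metric.ball x₀ r := by
      refine hεA (Metric.mem_thickening_iff.2 ⟨x, hx, ?_⟩)
      rw [dist_eq_norm, sub_sub_cancel_left, norm_neg]
      exact mem_ball_zero_iff.1 (hj hy)
    have h7 := h.cone _ hxb hxy u (Metric.closedBall_subset_ball (by linarith) hu)
      (1 / ((j : ℝ) + 1)) (by positivity)
    rw [sub_neg_eq_add, add_sub_cancel_right] at h7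
    exact h7 (hAW hx)

/-- The indicator function of `D`, smoothed with `κ`. -/
def smoothIndicator (D : Set (Cn n)) (κ : Cn n → ℝ) (x : Cn n) : ℝ := ∫ t in D, κ (x - t)

theorem smoothIndicator_eq_convolution (hDo : IsOpen D) (κ : Cn n → ℝ) :
    smoothIndicator D κ = convolution (D.indicator fun _ => (1 : ℝ)) κ
      (ContinuousLinearMap.lsmul ℝ ℝ) volume := by
  funext x
  rw [smoothIndicator, convolution_def, ← integral_indicator hDo.measurableSet]
  congr 1
  funext t
  by_cases ht : t ∈ D <;> simp [ht]

theorem locallyIntegrable_indicator_one (hDo : IsOpen D) :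
    LocallyIntegrable (D.indicator fun _ => (1 : ℝ)) :=
  (locallyIntegrable_const 1).indicator hDo.measurableSet

theorem contDiff_smoothIndicator (hDo : IsOpen D) {κ : Cn n → ℝ} (hκ : ContDiff ℝ ∞ κ)
    (hκc : HasCompactSupport κ) : ContDiff ℝ ∞ (smoothIndicator D κ) := by
  rw [smoothIndicator_eq_convolution hDo]
  exact hκc.contDiff_convolution_right _ (locallyIntegrable_indicator_one hDo) hκ

/-- By the divergence theorem, the derivatives of a smoothed indicator function are boundary
integrals. -/
theorem fderiv_smoothIndicator (hn : 0 < n) (hDo : IsOpen D) (hDc : IsCompact (closure D))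
    (hD : HasC1Boundary D) (𝔞 : BoundaryAtlas D) {κ : Cn n → ℝ} (hκ : ContDiff ℝ ∞ κ)
    (hκc : HasCompactSupport κ) (x e : Cn n) :
    fderiv ℝ (smoothIndicator D κ) x e = -𝔞.flux (fun y => κ (x - y)) e := by
  have hκ1 : ContDiff ℝ 1 κ := hκ.of_le (by norm_cast)
  have hsub : ContDiff ℝ 1 fun y => κ (x - y) := hκ1.comp (contDiff_const.sub contDiff_id)
  rw [← integral_fderiv_eq_flux hn hDo hDc hD 𝔞 hsub e, smoothIndicator_eq_convolution hDo,
    (hκc.hasFDerivAt_convolution_right (ContinuousLinearMap.lsmul ℝ ℝ)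
      (locallyIntegrable_indicator_one hDo) hκ1 x).fderiv,
    convolution_precompR_apply _ (locallyIntegrable_indicator_one hDo) (hκc.fderiv ℝ)
      (hκ1.continuous_fderiv (by simp)), convolution_def, ← integral_neg,
    ← integral_indicator hDo.measurableSet]
  congr 1
  funext t
  have h1 : HasFDerivAt (fun y => κ (x - y)) (-(fderiv ℝ κ (x - t))) t := by
    have h2 : HasFDerivAt (fun y => x - y) (-ContinuousLinearMap.id ℝ (Cn n)) t :=
      (hasFDerivAt_id t).const_sub x
    have h3 := ((hκ1.differentiable (by simp)) (x - t)).hasFDerivAt.comp t h2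
    rw [ContinuousLinearMap.comp_neg, ContinuousLinearMap.comp_id] at h3
    exact h3
  by_cases ht : t ∈ D <;> simp [ht, h1.fderiv]

theorem smoothIndicator_mem_Icc {κ : Cn n → ℝ} (hκ : ContDiff ℝ ∞ κ)
    (hκc : HasCompactSupport κ) (h0 : ∀ x, 0 ≤ κ x) (h1 : ∫ x, κ x = 1) (x : Cn n) :
    smoothIndicator D κ x ∈ Icc (0 : ℝ) 1 := by
  have hint : Integrable fun t => κ (x - t) :=
    (hκ.continuous.integrable_of_hasCompactSupport hκc).comp_sub_left x
  refine ⟨integral_nonneg fun t => h0 _, ?_⟩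
  rw [smoothIndicator, ← h1, ← integral_sub_left_eq_self κ volume x]
  exact setIntegral_le_integral hint (Eventually.of_forall fun t => h0 _)

theorem smoothIndicator_eq_one {κ : Cn n → ℝ} (h1 : ∫ x, κ x = 1) {x : Cn n}
    (hx : ∀ y ∈ tsupport κ, x - y ∈ D) : smoothIndicator D κ x = 1 := by
  rw [smoothIndicator, ← h1, ← integral_sub_left_eq_self κ volume x]
  refine setIntegral_eq_integral_of_forall_compl_eq_zero fun t ht => ?_
  refine image_eq_zero_of_notMem_tsupport fun h => ht ?_
  simpa using hx _ h

theorem smoothIndicator_eq_zero {κ : Cn n → ℝ} {x : Cn n}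
    (hx : ∀ y ∈ tsupport κ, x - y ∉ closure D) : smoothIndicator D κ x = 0 := by
  rw [smoothIndicator]
  refine setIntegral_eq_zero_of_forall_eq_zero fun t ht => ?_
  refine image_eq_zero_of_notMem_tsupport fun h => hx _ h ?_
  simpa using subset_closure ht

theorem tendsto_flux {E : Type*} [NormedAddCommGroup E] [NormedSpace ℝ E] (𝔞 : BoundaryAtlas D)
    {f : ℕ → Cn n → E} {g : Cn n → E} (hf : ∀ j, Continuous (f j)) {C : ℝ}
    (hC : ∀ j x, ‖f j x‖ ≤ C) (hlim : ∀ x, Tendsto (fun j => f j x) atTop (𝓝 (g x))) (e : Cn n) :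
    Tendsto (fun j => 𝔞.flux (f j) e) atTop (𝓝 (𝔞.flux g e)) := by
  refine tendsto_finsetSum _ fun i _ => ?_
  refine tendsto_integral_of_dominated_convergence (fun t => |𝔞.fluxDensity i e t| * C)
    (fun j => (𝔞.integrable_fluxDensity_smul i e (hf j)).aestronglyMeasurable) ?_
    (fun j => Eventually.of_forall fun t => ?_)
    (Eventually.of_forall fun t => (hlim _).const_smul _)
  · have := 𝔞.integrable_fluxDensity_smul i e (f := fun _ => (1 : ℝ)) continuous_const
    simp only [smul_eq_mul, mul_one] at this
    exact this.abs.mul_const C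
  · rw [norm_smul, Real.norm_eq_abs]
    exact mul_le_mul_of_nonneg_left (hC _ _) (abs_nonneg _)

/-- Fubini for the flux of a convolution. -/
theorem integral_flux_smul {E : Type*} [NormedAddCommGroup E] [NormedSpace ℝ E] [CompleteSpace E]
    (𝔞 : BoundaryAtlas D) {κ : Cn n → ℝ} (hκ : Continuous κ) {h : Cn n → E}
    (hh : Continuous h) (hhc : HasCompactSupport h) (e : Cn n) :
    ∫ x, 𝔞.flux (fun y => κ (x - y)) e • h x = 𝔞.flux (fun y => ∫ x, κ (x - y) • h x) e := by
  have hint : ∀ i, Integrable (Function.uncurry fun (x : Cn n) (t : Fin (2 * n - 1) → ℝ) =>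
      𝔞.fluxDensity i e t • (κ (x - 𝔞.param i t) • h x)) (volume.prod volume) := by
    intro i
    obtain ⟨L, hL, hLd, hw⟩ := 𝔞.exists_compact i
    have hc : Continuous fun p : Cn n × (Fin (2 * n - 1) → ℝ) =>
        𝔞.fluxDensity i e p.2 • (κ (p.1 - 𝔞.param i p.2) • h p.1) :=
      𝔞.continuous_fluxDensity_smul i e (f := fun x y => κ (x - y) • h x) (by fun_prop)
    refine Continuous.integrable_of_hasCompactSupport hc
      (HasCompactSupport.intro ((show IsCompact (tsupport h) from hhc).prod hL) fun p hp => ?_)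
    by_cases h1 : p.2 ∈ L
    · have : h p.1 = 0 := image_eq_zero_of_notMem_tsupport fun h2 => hp ⟨h2, h1⟩
      change 𝔞.fluxDensity i e p.2 • (κ (p.1 - 𝔞.param i p.2) • h p.1) = 0
      rw [this, smul_zero, smul_zero]
    · change 𝔞.fluxDensity i e p.2 • (κ (p.1 - 𝔞.param i p.2) • h p.1) = 0
      rw [𝔞.fluxDensity_eq_zero i hw e _ h1, zero_smul]
  simp only [BoundaryAtlas.flux, Finset.sum_smul]
  rw [integral_finsetSum]
  · refine Finset.sum_congr rfl fun i _ => ?_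
    have h1 : ∀ x, (∫ t, 𝔞.fluxDensity i e t • κ (x - 𝔞.param i t)) • h x =
        ∫ t, 𝔞.fluxDensity i e t • (κ (x - 𝔞.param i t) • h x) := by
      intro x
      rw [← integral_smul_const]
      simp only [smul_eq_mul, mul_smul]
    simp only [h1]
    rw [integral_integral_swap (hint i)]
    simp only [integral_smul]
  · intro i _
    have := (hint i).integral_prod_left
    refine this.congr (Eventually.of_forall fun x => ?_)
    simp only [Function.uncurry_apply_pair]
    rw [← integral_smul_const]
    simp only [smul_eq_mul, mul_smul]

/-- Convolution with an approximate identity. -/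
theorem tendsto_integral_mollifier {W : Set (Cn n)} {κ : ℕ → Cn n → ℝ}
    (hκ : IsInwardMollifier D W κ) {h : Cn n → ℂ} (hh : Continuous h) (y : Cn n) :
    Tendsto (fun j => ∫ x, κ j (x - y) • h x) atTop (𝓝 (h y)) := by
  rw [Metric.tendsto_atTop']
  intro ε hε
  obtain ⟨δ, hδ, hball⟩ := Metric.continuousAt_iff.1 (hh.continuousAt (x := y)) (ε / 2)
    (half_pos hε)
  have hev := hκ.tsupport_subset δ hδ
  obtain ⟨N, hN⟩ := eventually_atTop.1 hev
  refine ⟨N, fun j hj => ?_⟩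
  have hsupp := hN j hj.le
  have hκc := (hκ.contDiff j).continuous
  have hint : Integrable fun x => κ j (x - y) :=
    (hκc.integrable_of_hasCompactSupport (hκ.hasCompactSupport j)).comp_sub_right y
  have h1 : ∫ x, κ j (x - y) = 1 := by
    rw [integral_sub_right_eq_self, hκ.integral_eq_one]
  have hint2 : Integrable fun x => κ j (x - y) • (h x - h y) := by
    have h2 : HasCompactSupport fun x => κ j (x - y) :=
      (hκ.hasCompactSupport j).comp_homeomorph (Homeomorph.subRight y)
    exact Continuous.integrable_of_hasCompactSupport (by fun_prop) h2.smul_right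
  have h3 : (∫ x, κ j (x - y) • h x) - h y = ∫ x, κ j (x - y) • (h x - h y) := by
    have : (fun x => κ j (x - y) • h x) =
        fun x => κ j (x - y) • (h x - h y) + κ j (x - y) • h y := by
      funext x; rw [← smul_add, sub_add_cancel]
    rw [this, integral_add hint2 (hint.smul_const _), integral_smul_const, h1, one_smul,
      add_sub_cancel_right]
  rw [dist_eq_norm, h3]
  refine lt_of_le_of_lt (norm_integral_le_of_norm_le (hint.const_mul (ε / 2))
    (Eventually.of_forall fun x => ?_)) ?_
  · rw [norm_smul, Real.norm_of_nonneg (hκ.nonneg j _), mul_comm]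
    by_cases hx : x - y ∈ tsupport (κ j)
    · refine mul_le_mul_of_nonneg_right ?_ (hκ.nonneg j _)
      have h4 := mem_ball_zero_iff.1 (hsupp hx)
      rw [← dist_eq_norm] at h4 ⊢
      exact (hball h4).le
    · rw [image_eq_zero_of_notMem_tsupport hx, mul_zero, mul_zero]
  · rw [integral_const_mul, h1, mul_one]
    exact half_lt_self hε

theorem norm_integral_mollifier_le {W : Set (Cn n)} {κ : ℕ → Cn n → ℝ}
    (hκ : IsInwardMollifier D W κ) {h : Cn n → ℂ} {C : ℝ} (hC : ∀ x, ‖h x‖ ≤ C)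
    (j : ℕ) (y : Cn n) : ‖∫ x, κ j (x - y) • h x‖ ≤ C := by
  have hint : Integrable fun x => κ j (x - y) :=
    ((hκ.contDiff j).continuous.integrable_of_hasCompactSupport
      (hκ.hasCompactSupport j)).comp_sub_right y
  refine (norm_integral_le_of_norm_le (hint.mul_const C) (Eventually.of_forall fun x => ?_)).trans ?_
  · rw [norm_smul, Real.norm_of_nonneg (hκ.nonneg j _)]
    exact mul_le_mul_of_nonneg_left (hC x) (hκ.nonneg j _)
  · rw [integral_mul_const, integral_sub_right_eq_self, hκ.integral_eq_one, one_mul]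

theorem continuous_integral_mollifier {κ : Cn n → ℝ} (hκ : Continuous κ)
    {h : Cn n → ℂ} (hh : Continuous h) (hhc : HasCompactSupport h) :
    Continuous fun y => ∫ x, κ (x - y) • h x := by
  have h1 : ∀ y, ∫ x, κ (x - y) • h x = ∫ x in tsupport h, κ (x - y) • h x := by
    intro y
    refine (setIntegral_eq_integral_of_forall_compl_eq_zero fun x hx => ?_).symm
    rw [image_eq_zero_of_notMem_tsupport hx, smul_zero]
  simp only [h1]
  exact continuous_parametric_integral_of_continuous
    (f := fun y x => κ (x - y) • h x) (by fun_prop) hhc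

/-- The contribution of one inward mollifier: the derivative of the smoothed indicator function
tends to the boundary measure. -/
theorem tendsto_integral_fderiv_smoothIndicator (hn : 0 < n) (hDo : IsOpen D)
    (hDc : IsCompact (closure D)) (hD : HasC1Boundary D) (𝔞 : BoundaryAtlas D) {W : Set (Cn n)}
    {κ : ℕ → Cn n → ℝ} (hκ : IsInwardMollifier D W κ) {h : Cn n → ℂ} (hh : Continuous h)
    (hhc : HasCompactSupport h) (e : Cn n) :
    Tendsto (fun j => ∫ x, fderiv ℝ (smoothIndicator D (κ j)) x e • h x) atTop
      (𝓝 (-𝔞.flux h e)) := by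
  have h1 : ∀ j, ∫ x, fderiv ℝ (smoothIndicator D (κ j)) x e • h x =
      -𝔞.flux (fun y => ∫ x, κ j (x - y) • h x) e := by
    intro j
    simp only [fderiv_smoothIndicator hn hDo hDc hD 𝔞 (hκ.contDiff j) (hκ.hasCompactSupport j),
      neg_smul]
    rw [integral_neg, integral_flux_smul 𝔞 (hκ.contDiff j).continuous hh hhc]
  simp only [h1]
  obtain ⟨C, hC⟩ := hh.bounded_above_of_compact_support hhc
  exact (tendsto_flux 𝔞 (fun j => continuous_integral_mollifier (hκ.contDiff j).continuous hh hhc)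
    (fun j y => norm_integral_mollifier_le hκ hC j y) (tendsto_integral_mollifier hκ hh) e).neg

theorem tendsto_integral_smoothIndicator_smul (hDo : IsOpen D)
    {W : Set (Cn n)} {κ : ℕ → Cn n → ℝ} (hκ : IsInwardMollifier D W κ) {h : Cn n → ℂ}
    (hh : Continuous h) (hhc : HasCompactSupport h) (hhW : tsupport h ⊆ W) :
    Tendsto (fun j => ∫ x, smoothIndicator D (κ j) x • h x) atTop (𝓝 (∫ x in D, h x)) := by
  rw [← integral_indicator hDo.measurableSet]
  refine tendsto_integral_of_dominated_convergence (fun x => ‖h x‖) (fun j => ?_)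
    (hh.integrable_of_hasCompactSupport hhc).norm (fun j => Eventually.of_forall fun x => ?_)
    (Eventually.of_forall fun x => ?_)
  · exact ((contDiff_smoothIndicator hDo (hκ.contDiff j)
      (hκ.hasCompactSupport j)).continuous.smul hh).aestronglyMeasurable
  · have := smoothIndicator_mem_Icc (D := D) (hκ.contDiff j) (hκ.hasCompactSupport j)
      (hκ.nonneg j) (hκ.integral_eq_one j) x
    rw [norm_smul, Real.norm_of_nonneg this.1]
    exact mul_le_of_le_one_left (norm_nonneg _) this.2
  · by_cases hx : x ∈ tsupport h
    · by_cases hxD : x ∈ D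
      · rw [indicator_of_mem hxD]
        refine tendsto_const_nhds.congr' ?_
        obtain ⟨ε, hε, hεD⟩ := Metric.isOpen_iff.1 hDo x hxD
        filter_upwards [hκ.tsupport_subset ε hε] with j hj
        rw [smoothIndicator_eq_one (hκ.integral_eq_one j), one_smul]
        intro y hy
        refine hεD ?_
        rw [mem_ball_iff_norm, sub_sub_cancel_left, norm_neg]
        exact mem_ball_zero_iff.1 (hj hy)
      · rw [indicator_of_notMem hxD]
        refine tendsto_const_nhds.congr' ?_
        filter_upwards [hκ.inward {x} isCompact_singleton (singleton_subset_iff.2 (hhW hx))]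
          with j hj
        rw [smoothIndicator_eq_zero, zero_smul]
        exact fun y hy hyD => hxD (hj x rfl y hy hyD)
    · have h0 : h x = 0 := image_eq_zero_of_notMem_tsupport hx
      have h1 : D.indicator h x = 0 := by
        by_cases hxD : x ∈ D
        · rw [indicator_of_mem hxD, h0]
        · rw [indicator_of_notMem hxD]
      rw [h1]
      simp only [h0, smul_zero]
      exact tendsto_const_nhds

open scoped Pointwise in
/-- There are cut-off functions on `D` whose derivatives tend to the boundary measure, as vector
measures. They are glued, with a partition of unity `η_l`, from indicator functions `u_l` of `D` that
are smoothed with inward mollifiers. -/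
theorem exists_isExhausting_tendsto_flux (hn : 0 < n) (D : Opens (Cn n))
    (hDc : IsCompact (closure (D : Set (Cn n)))) (hD : HasC1Boundary (D : Set (Cn n)))
    (𝔞 : BoundaryAtlas (D : Set (Cn n))) :
    ∃ χ : ℕ → 𝓓(D, ℝ), IsExhausting χ ∧ ∀ f : Cn n → ℂ, Continuous f → ∀ e,
      Tendsto (fun j => ∫ x, fderiv ℝ (χ j) x e • f x) atTop (𝓝 (-𝔞.flux f e)) := by
  have hDo := D.isOpen
  have h1 : ∀ x₀, ∃ r κ, x₀ ∈ closure (D : Set (Cn n)) →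
      0 < r ∧ IsInwardMollifier (D : Set (Cn n)) (Metric.ball x₀ r) κ := by
    intro x₀
    by_cases hx₀ : x₀ ∈ closure (D : Set (Cn n))
    · obtain ⟨r, hr, κ, h⟩ := exists_isInwardMollifier hDo hD hx₀
      exact ⟨r, κ, fun _ => ⟨hr, h⟩⟩
    · exact ⟨0, 0, fun h => absurd h hx₀⟩
  choose r κ hrκ using h1
  obtain ⟨t, η, hts, hη, hη0, hηs, hηle, hsum⟩ := exists_finite_partition hDc
    (U := fun x => Metric.ball x (r x))
    fun x hx => ⟨Metric.isOpen_ball, Metric.mem_ball_self (hrκ x hx).1⟩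
  have hκ : ∀ l : t, IsInwardMollifier (D : Set (Cn n)) (Metric.ball (l : Cn n) (r l)) (κ l) :=
    fun l => (hrκ l (hts l)).2
  have hηc : ∀ l, HasCompactSupport (η l) := fun l =>
    HasCompactSupport.of_support_subset_isCompact (isCompact_closedBall (l : Cn n) (r l))
      ((subset_tsupport _).trans ((hηs l).trans Metric.ball_subset_closedBall))
  set u : ℕ → t → Cn n → ℝ := fun j l => smoothIndicator (D : Set (Cn n)) (κ l j) with hu
  have huc : ∀ j l, ContDiff ℝ ∞ (u j l) := fun j l =>
    contDiff_smoothIndicator hDo ((hκ l).contDiff j) ((hκ l).hasCompactSupport j)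
  have huI : ∀ j l x, u j l x ∈ Icc (0 : ℝ) 1 := fun j l x =>
    smoothIndicator_mem_Icc ((hκ l).contDiff j) ((hκ l).hasCompactSupport j)
      ((hκ l).nonneg j) ((hκ l).integral_eq_one j) x
  set F : ℕ → Cn n → ℝ := fun j x => ∑ l, η l x * u j l x with hF
  have hFc : ∀ j, ContDiff ℝ ∞ (F j) := fun j =>
    ContDiff.sum fun l _ => (hη l).mul (huc j l)
  -- `A j l` contains the support of `η_l u_l`, and lies in `D` for large `j`
  set A : ℕ → t → Set (Cn n) := fun j l =>
    tsupport (η l) ∩ (closure (D : Set (Cn n)) + tsupport (κ l j)) with hA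
  have hAc : ∀ j l, IsCompact (A j l) := fun j l =>
    (show IsCompact (tsupport (η l)) from hηc l).inter_right
      (hDc.add (show IsCompact (tsupport (κ l j)) from (hκ l).hasCompactSupport j)).isClosed
  have hFA : ∀ j, Function.support (F j) ⊆ ⋃ l, A j l := by
    intro j x hx
    by_contra hxA
    refine hx (Finset.sum_eq_zero fun l _ => ?_)
    by_cases hxl : x ∈ tsupport (η l)
    · rw [show u j l x = 0 from smoothIndicator_eq_zero fun y hy hyD =>
        hxA (mem_iUnion.2 ⟨l, hxl, x - y, hyD, y, hy, sub_add_cancel x y⟩), mul_zero]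
    · rw [image_eq_zero_of_notMem_tsupport hxl, zero_mul]
  have hUc : ∀ j, IsCompact (⋃ l, A j l) := fun j => isCompact_iUnion (hAc j)
  have hevA : ∀ᶠ j in atTop, ∀ l, A j l ⊆ (D : Set (Cn n)) := by
    rw [eventually_all]
    intro l
    filter_upwards [(hκ l).inward _ (hηc l) (hηs l)] with j hj
    rintro _ ⟨hx, y, hy, z, hz, rfl⟩
    exact hj _ hx z hz (by simpa using hy)
  obtain ⟨N, hN⟩ := eventually_atTop.1 hevA
  let χ : ℕ → 𝓓(D, ℝ) := fun j =>
    { toFun := F (j + N)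
      contDiff' := hFc _
      hasCompactSupport' := HasCompactSupport.of_support_subset_isCompact (hUc _) (hFA _)
      tsupport_subset' := (closure_minimal (hFA _) (hUc _).isClosed).trans
        (iUnion_subset (hN _ (Nat.le_add_left N j))) }
  have hχ : ∀ j x, χ j x = F (j + N) x := fun j x => rfl
  refine ⟨χ, ⟨fun j x => ?_, fun L hL hLD => ?_⟩, fun f hf e => ?_⟩
  · rw [hχ]
    refine ⟨Finset.sum_nonneg fun l _ => mul_nonneg (hη0 l x) (huI _ l x).1, ?_⟩
    refine le_trans (Finset.sum_le_sum fun l _ => ?_) (hηle x)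
    exact mul_le_of_le_one_right (hη0 l x) (huI _ l x).2
  · obtain ⟨ε, hε, hεL⟩ := hL.exists_thickening_subset_open hDo hLD
    have hev : ∀ᶠ j in atTop, ∀ l : t, tsupport (κ l j) ⊆ Metric.ball 0 ε :=
      eventually_all.2 fun l => (hκ l).tsupport_subset ε hε
    filter_upwards [(tendsto_add_atTop_nat N).eventually hev] with j hj x hx
    rw [hχ]
    have : ∀ l, u (j + N) l x = 1 := by
      intro l
      refine smoothIndicator_eq_one ((hκ l).integral_eq_one _) fun y hy => hεL ?_
      refine Metric.mem_thickening_iff.2 ⟨x, hx, ?_⟩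
      rw [dist_eq_norm, sub_sub_cancel_left, norm_neg]
      exact mem_ball_zero_iff.1 (hj l hy)
    simp only [hF, this, mul_one]
    exact hsum x (subset_closure (hLD hx))
  · suffices h : Tendsto (fun j => ∫ x, fderiv ℝ (F j) x e • f x) atTop (𝓝 (-𝔞.flux f e)) from
      h.comp (tendsto_add_atTop_nat N)
    have hη' : ∀ l, Continuous fun x => fderiv ℝ (η l) x e := fun l =>
      ((hη l).continuous_fderiv (by simp)).clm_apply continuous_const
    have hu' : ∀ j l, Continuous fun x => fderiv ℝ (u j l) x e := fun j l =>
      ((huc j l).continuous_fderiv (by simp)).clm_apply continuous_const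
    have hη'c : ∀ l, HasCompactSupport fun x => fderiv ℝ (η l) x e := fun l =>
      (hηc l).fderiv_apply ℝ e
    have hη's : ∀ l, tsupport (fun x => fderiv ℝ (η l) x e • f x) ⊆
        Metric.ball (l : Cn n) (r l) := by
      intro l
      refine (closure_minimal (fun x hx => ?_) (isClosed_tsupport (η l))).trans (hηs l)
      refine support_fderiv_subset ℝ fun h0 => hx ?_
      simp only [h0, zero_apply, zero_smul]
    have hder : ∀ j x, fderiv ℝ (F j) x e • f x =
        ∑ l, (u j l x • (fderiv ℝ (η l) x e • f x) + fderiv ℝ (u j l) x e • (η l x • f x)) := by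
      intro j x
      have hη1 : ∀ l, DifferentiableAt ℝ (η l) x := fun l => (hη l).differentiable (by simp) x
      have hu1 : ∀ l, DifferentiableAt ℝ (u j l) x := fun l => (huc j l).differentiable (by simp) x
      simp only [hF]
      rw [fderiv_fun_sum fun l _ => (hη1 l).fun_mul (hu1 l), sum_apply, Finset.sum_smul]
      refine Finset.sum_congr rfl fun l _ => ?_
      rw [fderiv_fun_mul (hη1 l) (hu1 l)]
      simp only [add_apply, smul_apply, smul_eq_mul, smul_smul, ← add_smul]
      congr 1
      ring
    have hint1 : ∀ j l, Integrable fun x => u j l x • (fderiv ℝ (η l) x e • f x) := fun j l =>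
      Continuous.integrable_of_hasCompactSupport
        ((huc j l).continuous.smul ((hη' l).smul hf))
        (HasCompactSupport.intro (hη'c l) fun x hx => by
          have h0 : fderiv ℝ (η l) x e = 0 :=
            image_eq_zero_of_notMem_tsupport (f := fun y => fderiv ℝ (η l) y e) hx
          rw [h0, zero_smul, smul_zero])
    have hint2 : ∀ j l, Integrable fun x => fderiv ℝ (u j l) x e • (η l x • f x) := fun j l =>
      Continuous.integrable_of_hasCompactSupport
        ((hu' j l).smul ((hη l).continuous.smul hf))
        (HasCompactSupport.intro (hηc l) fun x hx => by
          rw [image_eq_zero_of_notMem_tsupport hx, zero_smul, smul_zero])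
    have hI : ∀ j, ∫ x, fderiv ℝ (F j) x e • f x =
        ∑ l, ((∫ x, u j l x • (fderiv ℝ (η l) x e • f x)) +
          ∫ x, fderiv ℝ (u j l) x e • (η l x • f x)) := by
      intro j
      simp only [hder]
      rw [integral_finsetSum _ (f := fun l x => u j l x • (fderiv ℝ (η l) x e • f x) +
        fderiv ℝ (u j l) x e • (η l x • f x)) fun l _ => (hint1 j l).add (hint2 j l)]
      exact Finset.sum_congr rfl fun l _ => integral_add (hint1 j l) (hint2 j l)
    simp only [hI]
    have hlim : Tendsto (fun j => ∑ l, ((∫ x, u j l x • (fderiv ℝ (η l) x e • f x)) +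
          ∫ x, fderiv ℝ (u j l) x e • (η l x • f x))) atTop
        (𝓝 (∑ l, ((∫ x in D, fderiv ℝ (η l) x e • f x) +
          -𝔞.flux (fun x => η l x • f x) e))) := by
      refine tendsto_finsetSum _ fun l _ => Tendsto.add ?_ ?_
      · exact tendsto_integral_smoothIndicator_smul hDo (hκ l) ((hη' l).smul hf)
          (hη'c l).smul_right (hη's l)
      · exact tendsto_integral_fderiv_smoothIndicator hn hDo hDc hD 𝔞 (hκ l)
          ((hη l).continuous.smul hf) (hηc l).smul_right e
    convert hlim using 2
    rw [Finset.sum_add_distrib, Finset.sum_neg_distrib, ← 𝔞.flux_sum_left _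
      (f := fun l x => η l x • f x) fun l _ => (hη l).continuous.smul hf]
    -- the derivatives of the `η_l` cancel, as these functions add up to `1` on `D`
    have hz : ∑ l, ∫ x in D, fderiv ℝ (η l) x e • f x = 0 := by
      rw [← integral_finsetSum _ (f := fun l x => fderiv ℝ (η l) x e • f x) fun l _ => (((hη' l).smul hf).integrable_of_hasCompactSupport
        (hη'c l).smul_right).integrableOn]
      refine setIntegral_eq_zero_of_forall_eq_zero fun x hx => ?_
      have h3 : (fun y => ∑ l, η l y) =ᶠ[𝓝 x] fun _ => (1 : ℝ) := by
        filter_upwards [hDo.mem_nhds hx] with y hy using hsum y (subset_closure hy)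
      have h4 := h3.fderiv_eq (𝕜 := ℝ)
      rw [fderiv_fun_sum fun l _ => (hη l).differentiable (by simp) x, fderiv_fun_const] at h4
      have h5 := congrArg (fun L : Cn n →L[ℝ] ℝ => L e) h4
      simp only [sum_apply, Pi.zero_apply, zero_apply] at h5
      rw [← Finset.sum_smul, h5, zero_smul]
    rw [hz, zero_add]
    congr 1
    refine 𝔞.flux_congr (fun x hx => ?_) e
    rw [← Finset.sum_smul, hsum x (frontier_subset_closure hx), one_smul]

/-! ### Boundary integrals of forms of bidegree `(n, n - 1)` -/

theorem evalForm_single_univ_eq {k : ℕ} (h : k = 2 * n) (v : Fin k → Cn n) :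
    evalForm (Pi.single Finset.univ 1) v = (-2 * Complex.I) ^ n * (orientedVolume v : ℂ) := by
  set c : ℂ := (-2 * Complex.I) ^ n with hc
  have hc0 : c ≠ 0 := pow_ne_zero _ (by simp)
  let A : Cn n [⋀^Fin k]→ₗ[ℝ] ℂ := evalAlt k (Pi.single Finset.univ 1)
  let B : Cn n [⋀^Fin k]→ₗ[ℝ] ℂ :=
    ((LinearMap.mulLeft ℂ c).restrictScalars ℝ ∘ₗ Complex.ofRealCLM.toLinearMap).compAlternatingMap
      (volAlt k)
  have hAB : A.compLinearMap (realCoord (n := n) h).toLinearMap =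
      B.compLinearMap (realCoord (n := n) h).toLinearMap := by
    refine Module.Basis.ext_alternating (Pi.basisFun ℝ (Fin k)) fun w hw => ?_
    obtain ⟨σ, rfl⟩ : ∃ σ : Equiv.Perm (Fin k), ⇑σ = w :=
      ⟨Equiv.ofBijective w (Finite.injective_iff_bijective.1 hw), rfl⟩
    have h0 : ∀ f : Cn n [⋀^Fin k]→ₗ[ℝ] ℂ,
        f.compLinearMap (realCoord (n := n) h).toLinearMap
          (fun i => Pi.basisFun ℝ (Fin k) (σ i)) =
        Equiv.Perm.sign σ • f fun b => realCoord (n := n) h (Pi.single b 1) := by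
      intro f
      rw [← AlternatingMap.map_perm]
      change f _ = f _
      congr 1
      funext b
      simp
    rw [h0, h0]
    congr 1
    change evalAlt k _ _ = c * ((volAlt k _ : ℝ) : ℂ)
    rw [evalAlt_apply, volAlt_apply, orientedVolume_realCoord, evalForm_realCoord, hc]
    simp
  have h1 := congrArg (fun f => f fun b => (realCoord (n := n) h).symm (v b)) hAB
  have h2 : ∀ f : Cn n [⋀^Fin k]→ₗ[ℝ] ℂ, f.compLinearMap (realCoord (n := n) h).toLinearMap
      (fun b => (realCoord (n := n) h).symm (v b)) = f v := by
    intro f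
    change f _ = f _
    congr 1
    funext b
    simp
  simp only [h2] at h1
  rw [← evalAlt_apply, ← volAlt_apply]
  exact h1

/-- Expansion of the determinant along its first column. -/
theorem evalForm_cons {k : ℕ} (h : k + 1 = 2 * n) (w : Cn n) (v : Fin k → Cn n) :
    evalForm (Pi.single Finset.univ 1) (Fin.cons w v : Fin (k + 1) → Cn n) =
      ∑ c : Idx n, coframe c w * (wedgeSign {c} (Finset.univ \ {c}) *
        evalForm (Pi.single (Finset.univ \ {c}) 1) v) := by
  rw [evalForm_single_univ h, Matrix.det_succ_column_zero,
    ← Equiv.sum_comp (idxEnum h).toEquiv]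
  refine Finset.sum_congr rfl fun i _ => ?_
  set c := idxEnum h i with hc
  have hcard : (Finset.univ \ {c} : Finset (Idx n)).card = k := by
    rw [Finset.card_sdiff_of_subset (Finset.subset_univ _), Finset.card_univ, card_idx, ← h,
      Finset.card_singleton, Nat.add_sub_cancel]
  have h1 : evalForm (Pi.single (Finset.univ \ {c}) 1) v = Matrix.det
      (Matrix.of fun l b : Fin k => coframe (idxEnum h (i.succAbove l)) (v b)) := by
    rw [evalForm_eq_sum, Fintype.sum_eq_single ⟨Finset.univ \ {c}, hcard⟩]
    · rw [Pi.single_eq_same, one_mul]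
      have : (fun l => idxEnum h (i.succAbove l)) = (Finset.univ \ {c}).orderEmbOfFin hcard :=
        Finset.orderEmbOfFin_unique hcard
          (fun l => by simp [hc, Fin.succAbove_ne])
          ((idxEnum h).strictMono.comp (Fin.strictMono_succAbove i))
      simp only [← this]
    · intro S hS
      have : S.1 ≠ Finset.univ \ {c} := fun h => hS (Subtype.ext h)
      rw [Pi.single_eq_of_ne this, zero_mul]
  have h2 : wedgeSign {c} (Finset.univ \ {c}) = (-1) ^ (i : ℕ) := by
    rw [wedgeSign]
    congr 1
    have : (({c} ×ˢ (Finset.univ \ {c}) : Finset (Idx n × Idx n)).filter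
        fun d => d.2 < d.1) = (Finset.Iio i).map
          ((idxEnum h).toEquiv.toEmbedding.trans ⟨fun d => (c, d), fun a b hab => by simpa using hab⟩) := by
      ext ⟨a, b⟩
      obtain ⟨l, rfl⟩ := (idxEnum h).surjective b
      simp only [Finset.mem_filter, Finset.mem_product, Finset.mem_singleton, Finset.mem_sdiff,
        Finset.mem_univ, true_and, Finset.mem_map, Finset.mem_Iio, Function.Embedding.trans_apply,
        Function.Embedding.coeFn_mk]
      constructor
      · rintro ⟨⟨rfl, -⟩, h3⟩
        exact ⟨l, (idxEnum h).lt_iff_lt.1 h3, rfl⟩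
      · rintro ⟨l', h3, h6⟩
        obtain ⟨rfl, h4⟩ : c = a ∧ idxEnum h l' = idxEnum h l := Prod.mk.inj h6
        obtain rfl : l' = l := (idxEnum h).injective h4
        exact ⟨⟨rfl, fun h5 => h3.ne ((idxEnum h).injective h5)⟩, (idxEnum h).lt_iff_lt.2 h3⟩
    rw [this, Finset.card_map, Fin.card_Iio]
  change _ = coframe c w * (wedgeSign {c} (Finset.univ \ {c}) *
    evalForm (Pi.single (Finset.univ \ {c}) 1) v)
  rw [h1, h2]
  have h3 : ∀ x y z : ℂ, x * y * z = y * (x * z) := fun x y z => by ring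
  rw [h3]
  rfl

/-- Contracting the volume form with `∂/∂z̄_j` leaves the monomial without `dz̄_j`. -/
theorem evalForm_single_compl {k : ℕ} (h : k + 1 = 2 * n) (j : Fin n) (v : Fin k → Cn n) :
    wedgeSign {toLex (j, true)} (Finset.univ \ {toLex (j, true)}) *
        evalForm (Pi.single (Finset.univ \ {toLex (j, true)}) 1) v =
      (-2 * Complex.I) ^ n * (1 / 2 *
        ((orientedVolume (Fin.cons (Pi.single j 1) v : Fin (k + 1) → Cn n) : ℂ) + Complex.I *
        (orientedVolume (Fin.cons (Pi.single j Complex.I) v : Fin (k + 1) → Cn n) : ℂ))) := by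
  have h1 : ∀ c : Idx n, coframe c (Pi.single j 1) + Complex.I * coframe c (Pi.single j Complex.I) =
      if c = toLex (j, true) then 2 else 0 := by
    intro c
    obtain ⟨⟨l, t⟩, rfl⟩ := toLex.surjective c
    rw [coframe_apply, coframe_apply]
    by_cases hl : l = j
    · subst hl
      cases t <;> simp <;> norm_num
    · cases t <;> simp [hl]
  have h2 : (-2 * Complex.I) ^ n * (1 / 2 *
        ((orientedVolume (Fin.cons (Pi.single j 1) v : Fin (k + 1) → Cn n) : ℂ) + Complex.I *
        (orientedVolume (Fin.cons (Pi.single j Complex.I) v : Fin (k + 1) → Cn n) : ℂ))) =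
      1 / 2 * (evalForm (Pi.single Finset.univ 1) (Fin.cons (Pi.single j 1) v : Fin (k + 1) → Cn n) +
      Complex.I * evalForm (Pi.single Finset.univ 1)
        (Fin.cons (Pi.single j Complex.I) v : Fin (k + 1) → Cn n)) := by
    rw [evalForm_single_univ_eq h, evalForm_single_univ_eq h]
    ring
  rw [h2, evalForm_cons h, evalForm_cons h, Finset.mul_sum, ← Finset.sum_add_distrib]
  simp only [← mul_assoc, ← add_mul, h1]
  simp only [ite_mul, zero_mul, Finset.sum_ite_eq', Finset.mem_univ, if_true]
  ring

theorem eq_compl_of_bidegree {S : Finset (Idx n)} (hn : 0 < n) (h1 : holDeg S = n)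
    (h2 : antiDeg S = n - 1) : ∃ j, S = Finset.univ \ {toLex (j, true)} := by
  have h3 : (Finset.univ \ S).card = 1 := by
    rw [Finset.card_sdiff_of_subset (Finset.subset_univ _), Finset.card_univ, card_idx,
      ← holDeg_add_antiDeg S, h1, h2]
    omega
  obtain ⟨c, hc⟩ := Finset.card_eq_one.1 h3
  obtain ⟨⟨j, t⟩, rfl⟩ := toLex.surjective c
  have hS : S = Finset.univ \ {toLex (j, t)} := by
    rw [← hc, Finset.sdiff_sdiff_eq_self (Finset.subset_univ _)]
  cases t
  · exfalso
    have h4 : holDeg (Finset.univ \ S) = 1 := by rw [hc]; simp [holDeg, Finset.filter_singleton]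
    have h5 : holDeg (Finset.univ \ S) = 0 := by
      have h6 := holDeg_sdiff (Finset.subset_univ S)
      rw [holDeg_univ] at h6
      omega
    omega
  · exact ⟨j, hS⟩

theorem wedge_dzbar_univ (j : Fin n) (a : ExtAlg n) :
    wedge (dzbar j) a Finset.univ =
      wedgeSign {toLex (j, true)} (Finset.univ \ {toLex (j, true)}) *
        a (Finset.univ \ {toLex (j, true)}) := by
  rw [dzbar, wedge_single_left]
  simp

/-- A form of bidegree `(n, n - 1)` on a real hypersurface, in terms of the volume form. -/
theorem evalForm_of_isBidegree {k : ℕ} (hn : 0 < n) (h : k + 1 = 2 * n) {a : ExtAlg n}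
    (ha : IsBidegree n (n - 1) a) (v : Fin k → Cn n) :
    evalForm a v = (-2 * Complex.I) ^ n * ∑ j, 1 / 2 *
        ((orientedVolume (Fin.cons (Pi.single j 1) v : Fin (k + 1) → Cn n) : ℂ) + Complex.I *
        (orientedVolume (Fin.cons (Pi.single j Complex.I) v : Fin (k + 1) → Cn n) : ℂ)) *
          wedge (dzbar j) a Finset.univ := by
  have h1 : a = ∑ j : Fin n, a (Finset.univ \ {toLex (j, true)}) •
      (Pi.single (Finset.univ \ {toLex (j, true)}) 1 : ExtAlg n) := by
    have hinj : ∀ j l : Fin n, (Finset.univ \ {toLex (j, true)} : Finset (Idx n)) =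
        Finset.univ \ {toLex (l, true)} → j = l := by
      intro j l hjl
      by_contra hne
      have : toLex (j, true) ∈ (Finset.univ \ {toLex (l, true)} : Finset (Idx n)) := by
        simp [hne]
      rw [← hjl] at this
      simp at this
    funext S
    rw [Finset.sum_apply]
    by_cases hS : ∃ j, S = Finset.univ \ {toLex (j, true)}
    · obtain ⟨j, rfl⟩ := hS
      rw [Finset.sum_eq_single j]
      · simp
      · intro l _ hlj
        rw [Pi.smul_apply, Pi.single_eq_of_ne fun h => hlj (hinj _ _ h).symm, smul_zero]
      · simp
    · have h0 : a S = 0 := by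
        by_contra hne
        exact hS (eq_compl_of_bidegree hn (ha S hne).1 (ha S hne).2)
      rw [h0, Finset.sum_eq_zero]
      intro l _
      rw [Pi.smul_apply, Pi.single_eq_of_ne fun h => hS ⟨l, h⟩, smul_zero]
  have hadd : ∀ (s : Finset (Fin n)) (f : Fin n → ExtAlg n),
      evalForm (∑ j ∈ s, f j) v = ∑ j ∈ s, evalForm (f j) v := by
    intro s f
    simp only [evalForm_eq_sum, Finset.sum_apply, Finset.sum_mul]
    rw [Finset.sum_comm]
  have hsmul : ∀ (r : ℂ) (b : ExtAlg n), evalForm (r • b) v = r * evalForm b v := by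
    intro r b
    simp only [evalForm_eq_sum, Pi.smul_apply, smul_eq_mul, mul_assoc, Finset.mul_sum]
  conv_lhs => rw [h1]
  rw [hadd, Finset.mul_sum]
  refine Finset.sum_congr rfl fun j _ => ?_
  rw [hsmul, wedge_dzbar_univ, ← mul_assoc, ← evalForm_single_compl h]
  have := wedgeSign_mul_self ({toLex (j, true)} : Finset (Idx n)) (Finset.univ \ {toLex (j, true)})
  linear_combination (-(a (Finset.univ \ {toLex (j, true)}) *
    evalForm (Pi.single (Finset.univ \ {toLex (j, true)}) 1) v)) * this

theorem continuous_wedge {X : Type*} [TopologicalSpace X] {a b : X → ExtAlg m}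
    (ha : Continuous a) (hb : Continuous b) : Continuous fun x => wedge (a x) (b x) :=
  ((wedgeBilin m).continuous.comp ha).clm_apply hb

/-- The boundary integral of a form of bidegree `(n, n - 1)` is a flux. -/
theorem BoundaryAtlas.integral_eq_flux (hn : 0 < n) (𝔞 : BoundaryAtlas D) {Θ : Cn n → ExtAlg n}
    (hΘ : Continuous Θ) (hdeg : ∀ x ∈ frontier D, IsBidegree n (n - 1) (Θ x)) :
    𝔞.integral Θ = (-2 * Complex.I) ^ n * ∑ j, 1 / 2 *
      (𝔞.flux (fun x => wedge (dzbar j) (Θ x) Finset.univ) (Pi.single j 1) +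
        Complex.I * 𝔞.flux (fun x => wedge (dzbar j) (Θ x) Finset.univ) (Pi.single j Complex.I)) := by
  have hb : ∀ j, Continuous fun x => wedge (dzbar j) (Θ x) Finset.univ := fun j =>
    (continuous_apply _).comp (continuous_wedge continuous_const hΘ)
  have hint := fun i e j => 𝔞.integrable_fluxDensity_smul i e (hb j)
  have h1 : ∀ i, ∫ t in 𝔞.dom i, (𝔞.weight i (𝔞.param i t) : ℂ) *
      evalForm (Θ (𝔞.param i t)) (tangentFrame (𝔞.param i) t) =
      (-2 * Complex.I) ^ n * ∑ j, 1 / 2 *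
      ((∫ t, 𝔞.fluxDensity i (Pi.single j 1) t •
          wedge (dzbar j) (Θ (𝔞.param i t)) Finset.univ) +
        Complex.I * ∫ t, 𝔞.fluxDensity i (Pi.single j Complex.I) t •
          wedge (dzbar j) (Θ (𝔞.param i t)) Finset.univ) := by
    intro i
    rw [← integral_indicator (𝔞.isOpen_dom i).measurableSet]
    simp only [← integral_const_mul]
    have h2 : ∀ j, Integrable fun t => 1 / 2 * (𝔞.fluxDensity i (Pi.single j 1) t •
          wedge (dzbar j) (Θ (𝔞.param i t)) Finset.univ + Complex.I *
          𝔞.fluxDensity i (Pi.single j Complex.I) t •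
          wedge (dzbar j) (Θ (𝔞.param i t)) Finset.univ) := fun j =>
      ((hint i _ j).add ((hint i _ j).const_mul _)).const_mul _
    have h3 : ∀ j, 1 / 2 * ((∫ t, 𝔞.fluxDensity i (Pi.single j 1) t •
          wedge (dzbar j) (Θ (𝔞.param i t)) Finset.univ) +
        ∫ t, Complex.I * 𝔞.fluxDensity i (Pi.single j Complex.I) t •
          wedge (dzbar j) (Θ (𝔞.param i t)) Finset.univ) =
        ∫ t, 1 / 2 * (𝔞.fluxDensity i (Pi.single j 1) t •
          wedge (dzbar j) (Θ (𝔞.param i t)) Finset.univ + Complex.I *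
          𝔞.fluxDensity i (Pi.single j Complex.I) t •
          wedge (dzbar j) (Θ (𝔞.param i t)) Finset.univ) := by
      intro j
      rw [← integral_add (hint i _ j) ((hint i _ j).const_mul _), ← integral_const_mul]
    simp only [h3]
    rw [← integral_finsetSum _ fun j _ => h2 j, ← integral_const_mul]
    congr 1
    funext t
    by_cases ht : t ∈ 𝔞.dom i
    · rw [indicator_of_mem ht, evalForm_of_isBidegree hn (by omega)
        (hdeg _ (𝔞.mapsTo_param i ht)), mul_left_comm, Finset.mul_sum]
      congr 1
      refine Finset.sum_congr rfl fun j _ => ?_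
      simp only [BoundaryAtlas.fluxDensity, indicator_of_mem ht, Complex.real_smul]
      push_cast
      ring
    · simp [BoundaryAtlas.fluxDensity, indicator_of_notMem ht]
  rw [BoundaryAtlas.integral]
  simp only [h1]
  rw [← Finset.mul_sum, Finset.sum_comm]
  congr 1
  refine Finset.sum_congr rfl fun j _ => ?_
  rw [← Finset.mul_sum, Finset.sum_add_distrib, ← Finset.mul_sum]
  rfl

/-- `∂̄χ` for a function `χ`. -/
def dbarFun (χ : Cn n → ℝ) (x : Cn n) : ExtAlg n :=
  ∑ j : Fin n, (1 / 2 * ((fderiv ℝ χ x (Pi.single j 1) : ℂ) +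
    Complex.I * (fderiv ℝ χ x (Pi.single j Complex.I) : ℂ))) • dzbar j

/-- The `∂̄`-derivatives of suitable cut-off functions tend to the boundary current. -/
theorem exists_isExhausting_tendsto_integral (hn : 0 < n) (D : Opens (Cn n))
    (hDc : IsCompact (closure (D : Set (Cn n)))) (hD : HasC1Boundary (D : Set (Cn n)))
    (𝔞 : BoundaryAtlas (D : Set (Cn n))) :
    ∃ χ : ℕ → 𝓓(D, ℝ), IsExhausting χ ∧ ∀ Θ : Cn n → ExtAlg n, Continuous Θ →
      (∀ x ∈ frontier (D : Set (Cn n)), IsBidegree n (n - 1) (Θ x)) →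
      Tendsto (fun j => integralForm univ fun x => wedge (dbarFun (χ j) x) (Θ x)) atTop
        (𝓝 (-𝔞.integral Θ)) := by
  obtain ⟨χ, hχ, hlim⟩ := exists_isExhausting_tendsto_flux hn D hDc hD 𝔞
  refine ⟨χ, hχ, fun Θ hΘ hdeg => ?_⟩
  have hb : ∀ j, Continuous fun x => wedge (dzbar j) (Θ x) Finset.univ := fun j =>
    (continuous_apply _).comp (continuous_wedge continuous_const hΘ)
  have hint : ∀ i l e, Integrable fun x => fderiv ℝ (χ i) x e •
      wedge (dzbar l) (Θ x) Finset.univ := by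
    intro i l e
    have h1 : Continuous fun x => fderiv ℝ (χ i) x e :=
      ((χ i).contDiff.continuous_fderiv (by simp)).clm_apply continuous_const
    refine Continuous.integrable_of_hasCompactSupport (h1.smul (hb l))
      (HasCompactSupport.intro (((χ i).hasCompactSupport.fderiv_apply ℝ e)) fun x hx => ?_)
    have h0 : fderiv ℝ (χ i) x e = 0 :=
      image_eq_zero_of_notMem_tsupport (f := fun y => fderiv ℝ (χ i) y e) hx
    rw [h0, zero_smul]
  rw [𝔞.integral_eq_flux hn hΘ hdeg, ← mul_neg, ← Finset.sum_neg_distrib]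
  have h2 : ∀ i, integralForm univ (fun x => wedge (dbarFun (χ i) x) (Θ x)) =
      (-2 * Complex.I) ^ n * ∑ l, 1 / 2 *
        ((∫ x, fderiv ℝ (χ i) x (Pi.single l 1) • wedge (dzbar l) (Θ x) Finset.univ) +
        Complex.I * ∫ x, fderiv ℝ (χ i) x (Pi.single l Complex.I) •
          wedge (dzbar l) (Θ x) Finset.univ) := by
    intro i
    have h3 : ∀ x, wedge (dbarFun (χ i) x) (Θ x) Finset.univ = ∑ l, 1 / 2 *
        (fderiv ℝ (χ i) x (Pi.single l 1) • wedge (dzbar l) (Θ x) Finset.univ + Complex.I *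
        fderiv ℝ (χ i) x (Pi.single l Complex.I) • wedge (dzbar l) (Θ x) Finset.univ) := by
      intro x
      have h4 : wedge (dbarFun (χ i) x) (Θ x) = wedgeBilin n (dbarFun (χ i) x) (Θ x) := rfl
      rw [h4, dbarFun, map_sum, sum_apply, Finset.sum_apply]
      refine Finset.sum_congr rfl fun l _ => ?_
      rw [map_smul, smul_apply, Pi.smul_apply, wedgeBilin_apply]
      simp only [smul_eq_mul, Complex.real_smul]
      ring
    rw [integralForm, Measure.restrict_univ]
    simp only [h3]
    rw [integral_finsetSum _ (f := fun l x => 1 / 2 *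
        (fderiv ℝ (χ i) x (Pi.single l 1) • wedge (dzbar l) (Θ x) Finset.univ + Complex.I *
        fderiv ℝ (χ i) x (Pi.single l Complex.I) • wedge (dzbar l) (Θ x) Finset.univ))
      fun l _ => ((hint i l _).add ((hint i l _).const_mul _)).const_mul _]
    congr 1
    refine Finset.sum_congr rfl fun l _ => ?_
    rw [integral_const_mul, integral_add (hint i l _) ((hint i l _).const_mul _),
      integral_const_mul]
  simp only [h2]
  refine Tendsto.const_mul _ (tendsto_finsetSum _ fun l _ => ?_)
  rw [← mul_neg, neg_add, ← mul_neg]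
  exact ((hlim _ (hb l) _).add ((hlim _ (hb l) _).const_mul _)).const_mul _

end

/-! ### Exterior products of forms in `ζ` and forms in `z` -/

/-- The projection `(ζ, z) ↦ ζ`. -/
def projZeta (n : ℕ) : Cn (n + n) →L[ℝ] Cn n :=
  ContinuousLinearMap.pi fun i => ContinuousLinearMap.proj (Fin.castAdd n i)

/-- The projection `(ζ, z) ↦ z`. -/
def projZ (n : ℕ) : Cn (n + n) →L[ℝ] Cn n :=
  ContinuousLinearMap.pi fun i => ContinuousLinearMap.proj (Fin.natAdd n i)

@[simp] theorem projZeta_append (ζ z : Cn n) : projZeta n (Fin.append ζ z) = ζ := by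
  funext i; exact Fin.append_left _ _ _

@[simp] theorem projZ_append (ζ z : Cn n) : projZ n (Fin.append ζ z) = z := by
  funext i; exact Fin.append_right _ _ _

theorem append_projZeta_projZ (w : Cn (n + n)) :
    (Fin.append (projZeta n w) (projZ n w) : Cn (n + n)) = w :=
  Fin.append_castAdd_natAdd

theorem continuous_append : Continuous fun x : Cn n × Cn n => (Fin.append x.1 x.2 : Cn (n + n)) := by
  refine continuous_pi fun i => ?_
  refine Fin.addCases (fun j => ?_) (fun j => ?_) i
  · simp only [Fin.append_left]; fun_prop
  · simp only [Fin.append_right]; fun_prop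

/-- `(a, b) ↦ a(ζ) ∧ b(z)` as a continuous bilinear map. -/
def extBilin (n : ℕ) : ExtAlg n →L[ℂ] ExtAlg n →L[ℂ] ExtAlg (n + n) :=
  (wedgeBilin (n + n)).bilinearComp (liftZetaCLM n) (liftZCLM n)

theorem extBilin_apply (a b : ExtAlg n) : extBilin n a b = wedge (liftZeta a) (liftZ b) := rfl

theorem extProd_apply {D₁ D₂ : Opens (Cn n)} (a : 𝓓(D₁, ExtAlg n)) (b : 𝓓(D₂, ExtAlg n))
    (w : Cn (n + n)) : extProd a b w = extBilin n (a (projZeta n w)) (b (projZ n w)) := rfl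

theorem tsupport_extProd_subset {D₁ D₂ : Opens (Cn n)} (a : 𝓓(D₁, ExtAlg n))
    (b : 𝓓(D₂, ExtAlg n)) : tsupport (extProd a b) ⊆
      (fun x : Cn n × Cn n => (Fin.append x.1 x.2 : Cn (n + n))) '' (tsupport a ×ˢ tsupport b) :=
  closure_minimal (support_extProd_subset a b)
    (isCompact_append a.hasCompactSupport b.hasCompactSupport).isClosed

theorem norm_iteratedFDeriv_comp_clm_le {E F G : Type*} [NormedAddCommGroup E] [NormedSpace ℝ E]
    [NormedAddCommGroup F] [NormedSpace ℝ F] [NormedAddCommGroup G] [NormedSpace ℝ G] {f : E → F}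
    (hf : ContDiff ℝ ∞ f) (g : G →L[ℝ] E) (i : ℕ) (x : G) :
    ‖iteratedFDeriv ℝ i (fun y => f (g y)) x‖ ≤ ‖iteratedFDeriv ℝ i f (g x)‖ * ‖g‖ ^ i := by
  have h := g.iteratedFDeriv_comp_right hf x (i := i) (by norm_cast; exact le_top)
  change iteratedFDeriv ℝ i (fun y => f (g y)) x = _ at h
  rw [h]
  refine (ContinuousMultilinearMap.norm_compContinuousLinearMap_le _ _).trans ?_
  simp

theorem exists_norm_iteratedFDeriv_bilin_le {E F G : Type*} (H : Type*) [NormedAddCommGroup E]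
    [NormedSpace ℝ E] [NormedAddCommGroup F] [NormedSpace ℝ F] [NormedAddCommGroup G]
    [NormedSpace ℝ G] [NormedAddCommGroup H] [NormedSpace ℝ H] (B : E →L[ℝ] F →L[ℝ] G) (i : ℕ) :
    ∃ M : ℝ, 0 ≤ M ∧ ∀ (f : H → E) (g : H → F), ContDiff ℝ ∞ f → ContDiff ℝ ∞ g → ∀ x,
      ‖iteratedFDeriv ℝ i (fun y => B (f y) (g y)) x‖ ≤ M * ∑ l ∈ Finset.range (i + 1),
        (i.choose l : ℝ) * ‖iteratedFDeriv ℝ l f x‖ * ‖iteratedFDeriv ℝ (i - l) g x‖ :=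
  ⟨‖B‖, B.opNorm_nonneg, fun _ _ hf hg x =>
    B.norm_iteratedFDeriv_le_of_bilinear hf hg x (by norm_cast; exact le_top)⟩

theorem contDiff_extBilin {D₁ : Opens (Cn n)} (a : 𝓓(D₁, ExtAlg n)) {L : Compacts (Cn n)}
    (b : 𝓓_{L}(Cn n, ExtAlg n)) :
    ContDiff ℝ ∞ fun w => extBilin n (a (projZeta n w)) (b (projZ n w)) :=
  (extProd a (TestFunction.ofSupportedIn (Ω := ⊤) (subset_univ _) b)).contDiff

theorem exists_norm_iteratedFDeriv_extBilin_le {D₁ : Opens (Cn n)} (a : 𝓓(D₁, ExtAlg n))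
    (L : Compacts (Cn n)) (i : ℕ) : ∃ C : ℝ, 0 ≤ C ∧ ∀ (b : 𝓓_{L}(Cn n, ExtAlg n)) (w : Cn (n + n)),
      ‖iteratedFDeriv ℝ i (fun w => extBilin n (a (projZeta n w)) (b (projZ n w))) w‖ ≤
        C * ((Finset.range (i + 1)).sup fun j =>
          ContDiffMapSupportedIn.seminorm ℂ (Cn n) (ExtAlg n) ⊤ L j) b := by
  have ha : ∀ l, ∃ C, 0 ≤ C ∧ ∀ x, ‖iteratedFDeriv ℝ l a x‖ ≤ C := by
    intro l
    obtain ⟨C, hC⟩ := (a.contDiff.continuous_iteratedFDeriv (m := l)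
      (by norm_cast; exact le_top)).bounded_above_of_compact_support
      (a.hasCompactSupport.iteratedFDeriv l)
    exact ⟨C, (norm_nonneg _).trans (hC 0), hC⟩
  choose C hC0 hC using ha
  obtain ⟨M, hM0, hM⟩ := exists_norm_iteratedFDeriv_bilin_le (Cn (n + n))
    ((extBilin n).bilinearRestrictScalars ℝ) i
  refine ⟨M *
    ∑ l ∈ Finset.range (i + 1), (i.choose l : ℝ) * (C l * ‖projZeta n‖ ^ l) *
      ‖projZ n‖ ^ (i - l), ?_, fun b w => ?_⟩
  · refine mul_nonneg hM0 (Finset.sum_nonneg fun l _ => ?_)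
    have := hC0 l
    positivity
  refine (hM _ _ (a.contDiff.comp (projZeta n).contDiff) (b.contDiff.comp (projZ n).contDiff)
    w).trans ?_
  rw [mul_assoc, Finset.sum_mul]
  refine mul_le_mul_of_nonneg_left (Finset.sum_le_sum fun l hl => ?_) hM0
  set N := ((Finset.range (i + 1)).sup fun j =>
    ContDiffMapSupportedIn.seminorm ℂ (Cn n) (ExtAlg n) ⊤ L j) b
  have hb : ‖iteratedFDeriv ℝ (i - l) b (projZ n w)‖ ≤ N :=
    (ContDiffMapSupportedIn.norm_iteratedFDeriv_apply_le_seminorm_top ℂ).trans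
      (Seminorm.le_finset_sup_apply
        (p := fun j => ContDiffMapSupportedIn.seminorm ℂ (Cn n) (ExtAlg n) ⊤ L j)
        (Finset.mem_range.2 (by omega)))
  have h1 := (norm_iteratedFDeriv_comp_clm_le a.contDiff (projZeta n) l w).trans
    (mul_le_mul_of_nonneg_right (hC l _) (by positivity))
  have h2 := (norm_iteratedFDeriv_comp_clm_le b.contDiff (projZ n) (i - l) w).trans
    (mul_le_mul_of_nonneg_right hb (by positivity))
  have := hC0 l
  calc _ ≤ (i.choose l : ℝ) * (C l * ‖projZeta n‖ ^ l) * (N * ‖projZ n‖ ^ (i - l)) :=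
        mul_le_mul (mul_le_mul_of_nonneg_left h1 (by positivity)) h2 (norm_nonneg _)
          (by positivity)
    _ = _ := by ring

/-- The set of all `(ζ, z)` with `ζ` in the support of `a` and `z` in `L`. -/
def extCompacts {D₁ : Opens (Cn n)} (a : 𝓓(D₁, ExtAlg n)) (L : Compacts (Cn n)) :
    Compacts (Cn (n + n)) :=
  ⟨_, isCompact_append a.hasCompactSupport L.isCompact⟩

/-- The exterior product with a fixed test form in `ζ`, on test forms in `z` supported in a fixed
compact set. -/
def extProdLM {D₁ : Opens (Cn n)} (a : 𝓓(D₁, ExtAlg n)) (L : Compacts (Cn n)) :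
    𝓓_{L}(Cn n, ExtAlg n) →ₗ[ℂ] 𝓓_{extCompacts a L}(Cn (n + n), ExtAlg (n + n)) where
  toFun b := ⟨fun w => extBilin n (a (projZeta n w)) (b (projZ n w)),
    contDiff_extBilin a b, fun w hw => by
      by_contra hne
      refine hw ⟨(projZeta n w, projZ n w), ⟨?_, ?_⟩, append_projZeta_projZ w⟩
      · refine subset_tsupport _ fun h => hne ?_
        simp [h]
      · by_contra h
        refine hne ?_
        have h0 : b (projZ n w) = 0 := b.zero_on_compl h
        simp [h0]⟩
  map_add' b c := by
    refine ContDiffMapSupportedIn.ext fun w => ?_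
    exact map_add (extBilin n (a (projZeta n w))) (b (projZ n w)) (c (projZ n w))
  map_smul' r b := by
    refine ContDiffMapSupportedIn.ext fun w => ?_
    exact map_smul (extBilin n (a (projZeta n w))) r (b (projZ n w))

theorem continuous_extProdLM {D₁ : Opens (Cn n)} (a : 𝓓(D₁, ExtAlg n)) (L : Compacts (Cn n)) :
    Continuous (extProdLM a L) := by
  refine WithSeminorms.continuous_of_isBounded (ContDiffMapSupportedIn.withSeminorms ..)
    (ContDiffMapSupportedIn.withSeminorms ..) _ (.of_real fun i => ?_)
  obtain ⟨C, hC, h⟩ := exists_norm_iteratedFDeriv_extBilin_le a L i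
  exact ⟨Finset.range (i + 1), C, fun f =>
    ((extProdLM a L f).seminorm_le_iff ℂ (mul_nonneg hC (apply_nonneg _ _)) i).2
      fun _ x _ => h f x⟩

/-- The exterior product with a fixed test form in `ζ` is continuous. -/
def extProdSupportedIn {D₁ D₂ : Opens (Cn n)} (a : 𝓓(D₁, ExtAlg n)) (L : Compacts (Cn n))
    (hL : (L : Set (Cn n)) ⊆ D₂) :
    𝓓_{L}(Cn n, ExtAlg n) →L[ℂ] 𝓓(prodOpens D₁ D₂, ExtAlg (n + n)) :=
  have hL' : (extCompacts a L : Set (Cn (n + n))) ⊆ prodOpens D₁ D₂ := by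
    rintro _ ⟨x, ⟨h₁, h₂⟩, rfl⟩
    refine ⟨?_, ?_⟩
    · simp only [Fin.append_left]
      exact a.tsupport_subset h₁
    · simp only [Fin.append_right]
      exact hL h₂
  TestFunction.ofSupportedInCLM ℂ hL' ∘L ⟨extProdLM a L, continuous_extProdLM a L⟩

/-! ### The current `∫_D K ∧ α` -/

theorem coe_monoCLM_extProd {Ω D : Opens (Cn n)} (hDΩ : (D : Set (Cn n)) ⊆ Ω)
    (a b : 𝓓(D, ExtAlg n)) :
    ((TestFunction.monoCLM ℂ (extProd a b) : 𝓓(prodOpens Ω Ω, ExtAlg (n + n))) :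
      Cn (n + n) → ExtAlg (n + n)) = extProd a b := by
  have h : prodOpens D D ≤ prodOpens Ω Ω := fun w hw => ⟨hDΩ hw.1, hDΩ hw.2⟩
  rw [TestFunction.monoCLM_apply, if_pos ⟨le_rfl, h⟩]

theorem extProd_sub_left {D₁ D₂ : Opens (Cn n)} (a a' : 𝓓(D₁, ExtAlg n)) (b : 𝓓(D₂, ExtAlg n)) :
    extProd (a - a') b = extProd a b - extProd a' b := by
  refine TestFunction.ext fun w => ?_
  rw [sub_apply]
  simp only [extProd_apply, sub_apply, map_sub]

theorem continuous_smul_of_tsupport_subset {X E : Type*} [TopologicalSpace X]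
    [NormedAddCommGroup E] [NormedSpace ℝ E] {U : Set X} (hU : IsOpen U) {ξ : X → ℝ}
    (hξ : Continuous ξ) (hξU : tsupport ξ ⊆ U) {k : X → E} (hk : ContinuousOn k U) :
    Continuous fun x => ξ x • k x := by
  refine continuous_iff_continuousAt.2 fun x => ?_
  by_cases hx : x ∈ tsupport ξ
  · exact hξ.continuousAt.smul (hk.continuousAt (hU.mem_nhds (hξU hx)))
  · have h0 : (fun y => ξ y • k y) =ᶠ[𝓝 x] fun _ => 0 := by
      filter_upwards [notMem_tsupport_iff_eventuallyEq.1 hx] with y hy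
      simp [hy]
    exact continuousAt_const.congr h0.symm

/-- Let `F` be a closed set such that `K` is given by the form `k` near `(∂D ∩ F) × D`. As long as
`z` stays in a compact part `L` of `D`, the current `K` is given, for `ζ ∈ F` outside a compact part
`M` of `D`, by a continuous form `ξ k` with compact support. -/
theorem exists_localKernel {Ω D : Opens (Cn n)} (hDΩ : (D : Set (Cn n)) ⊆ Ω)
    (hDc : IsCompact (closure (D : Set (Cn n)))) (K : Current (prodOpens Ω Ω))
    {U : Set (Cn (n + n))} (hU : IsOpen U) {k : Cn (n + n) → ExtAlg (n + n)}
    (hk : ContinuousOn k U)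
    (hKk : ∀ Ψ : 𝓓(prodOpens Ω Ω, ExtAlg (n + n)), tsupport Ψ ⊆ U →
      K Ψ = integralForm U fun w => wedge (k w) (Ψ w))
    {F : Set (Cn n)} (hF : IsClosed F)
    (hUD : ∀ ζ ∈ frontier (D : Set (Cn n)) ∩ F, ∀ z ∈ D, (Fin.append ζ z : Cn (n + n)) ∈ U)
    {L : Set (Cn n)} (hL : IsCompact L) (hLD : L ⊆ D) :
    ∃ ξ : Cn (n + n) → ℝ, HasCompactSupport ξ ∧ tsupport ξ ⊆ U ∧
      Continuous (fun w => ξ w • k w) ∧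
      (∀ ζ ∈ frontier (D : Set (Cn n)) ∩ F, ∀ z ∈ L, ξ (Fin.append ζ z) = 1) ∧
      ∃ M : Set (Cn n), IsCompact M ∧ M ⊆ D ∧ ∀ b ψ : 𝓓(D, ExtAlg n),
        (∀ x, b x ≠ 0 → x ∈ F) → (∀ x ∈ M, b x = 0) → tsupport ψ ⊆ L →
        K (TestFunction.monoCLM ℂ (extProd b ψ)) =
          integralForm univ fun w => wedge (ξ w • k w) (extProd b ψ w) := by
  set G := frontier (D : Set (Cn n)) ∩ F
  have hG : IsCompact G :=
    (hDc.of_isClosed_subset isClosed_frontier frontier_subset_closure).inter_right hF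
  have hGL : G ×ˢ L ⊆ (fun x : Cn n × Cn n => (Fin.append x.1 x.2 : Cn (n + n))) ⁻¹' U :=
    fun x hx => hUD _ hx.1 _ (hLD hx.2)
  obtain ⟨V, W, hV, hW, hGV, hLW, hVW⟩ :=
    generalized_tube_lemma hG hL (hU.preimage continuous_append) hGL
  obtain ⟨V₁, hV₁, hGV₁, hV₁V, hV₁c⟩ := exists_open_between_and_isCompact_closure hG hV hGV
  set A := (fun x : Cn n × Cn n => (Fin.append x.1 x.2 : Cn (n + n))) '' (closure V₁ ×ˢ L)
  have hA : IsCompact A := isCompact_append hV₁c hL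
  have hAU : A ⊆ U := by
    rintro _ ⟨x, hx, rfl⟩
    exact hVW ⟨hV₁V hx.1, hLW hx.2⟩
  obtain ⟨U₁, hU₁, hAU₁, hU₁U, hU₁c⟩ := exists_open_between_and_isCompact_closure hA hU hAU
  obtain ⟨ξ, hξ1, hξA, hξI⟩ := exists_tsupport_one_of_isOpen_isClosed hU₁ hU₁c hA.isClosed hAU₁
  have hξU : tsupport ξ ⊆ U := hξ1.trans (subset_closure.trans hU₁U)
  have hξc : HasCompactSupport ξ :=
    hU₁c.of_isClosed_subset (isClosed_tsupport _) (hξ1.trans subset_closure)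
  refine ⟨ξ, hξc, hξU, continuous_smul_of_tsupport_subset hU ξ.continuous hξU hk,
    fun ζ hζ z hz => hξA ⟨(ζ, z), ⟨subset_closure (hGV₁ hζ), hz⟩, rfl⟩,
    (closure (D : Set (Cn n)) ∩ F) \ V₁, (hDc.inter_right hF).diff hV₁, ?_, ?_⟩
  · rintro x ⟨⟨hx, hxF⟩, hxV⟩
    by_contra hxD
    refine hxV (hGV₁ ⟨?_, hxF⟩)
    rw [D.isOpen.frontier_eq]
    exact ⟨hx, hxD⟩
  · intro b ψ hbF hbM hψ
    have hbV : tsupport b ⊆ closure V₁ := by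
      refine closure_mono fun x hx => ?_
      by_contra hxV
      exact hx (hbM x ⟨⟨subset_closure (b.tsupport_subset (subset_tsupport _ hx)), hbF x hx⟩, hxV⟩)
    have hs : tsupport (extProd b ψ) ⊆ A :=
      (tsupport_extProd_subset b ψ).trans (image_mono (prod_mono hbV hψ))
    rw [hKk]
    · rw [coe_monoCLM_extProd hDΩ, integralForm, integralForm, Measure.restrict_univ]
      congr 1
      rw [← integral_indicator hU.measurableSet]
      congr 1
      funext w
      by_cases hw : w ∈ A
      · rw [indicator_of_mem (hAU hw), hξA hw]
        simp
      · have h0 : extProd b ψ w = 0 := image_eq_zero_of_notMem_tsupport fun h => hw (hs h)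
        by_cases hwU : w ∈ U
        · rw [indicator_of_mem hwU, h0, wedge_zero_right, wedge_zero_right]
        · rw [indicator_of_notMem hwU, h0, wedge_zero_right]
          rfl
    · rw [coe_monoCLM_extProd hDΩ]
      exact hs.trans hAU

theorem exists_norm_wedge_extBilin_le (n : ℕ) : ∃ M : ℝ, 0 ≤ M ∧ ∀ (c : ExtAlg (n + n))
    (a b : ExtAlg n), ‖wedge c (extBilin n a b) Finset.univ‖ ≤ M * ‖c‖ * ‖a‖ * ‖b‖ := by
  refine ⟨‖wedgeBilin (n + n)‖ * ‖extBilin n‖,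
    mul_nonneg (wedgeBilin (n + n)).opNorm_nonneg (extBilin n).opNorm_nonneg, fun c a b => ?_⟩
  refine (norm_le_pi_norm _ _).trans ?_
  refine ((wedgeBilin (n + n)).le_opNorm₂ c (extBilin n a b)).trans ?_
  calc _ ≤ ‖wedgeBilin (n + n)‖ * ‖c‖ * (‖extBilin n‖ * ‖a‖ * ‖b‖) :=
        mul_le_mul_of_nonneg_left ((extBilin n).le_opNorm₂ a b)
          (mul_nonneg (wedgeBilin (n + n)).opNorm_nonneg (norm_nonneg _))
    _ = _ := by ring

theorem measurable_indicator_of_continuousOn {X E : Type*} [TopologicalSpace X] [MeasurableSpace X]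
    [BorelSpace X] [TopologicalSpace E] [MeasurableSpace E] [BorelSpace E] [Zero E]
    {D : Set X} (hD : IsOpen D) {α : X → E} (hα : ContinuousOn α D) :
    Measurable (D.indicator α) := by
  classical
  rw [← piecewise_eq_indicator]
  exact hα.measurable_piecewise continuousOn_const hD.measurableSet

/-- The integrand `κ ∧ α(ζ) ∧ b(z)` for a continuous kernel with compact support. -/
theorem integrable_wedge_extBilin {κ : Cn (n + n) → ExtAlg (n + n)} (hκ : Continuous κ)
    (hκc : HasCompactSupport κ) {α b : Cn n → ExtAlg n} (hα : Measurable α) {C : ℝ}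
    (hC : ∀ x, ‖α x‖ ≤ C) (hb : Continuous b) {C' : ℝ} (hC' : ∀ x, ‖b x‖ ≤ C') :
    Integrable fun w => wedge (κ w) (extBilin n (α (projZeta n w)) (b (projZ n w))) Finset.univ := by
  obtain ⟨M, hM0, hM⟩ := exists_norm_wedge_extBilin_le n
  have hC0 : 0 ≤ C := (norm_nonneg _).trans (hC 0)
  refine Integrable.mono' (g := fun w => M * C * C' * ‖κ w‖)
    ((hκ.norm.integrable_of_hasCompactSupport hκc.norm).const_mul _) ?_
    (Eventually.of_forall fun w => ?_)
  · have h : Continuous fun x : ExtAlg (n + n) × ExtAlg n × ExtAlg n =>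
        wedge x.1 (extBilin n x.2.1 x.2.2) Finset.univ :=
      (continuous_apply _).comp (continuous_wedge continuous_fst
        (((extBilin n).continuous.comp (continuous_fst.comp continuous_snd)).clm_apply
          (continuous_snd.comp continuous_snd)))
    exact (h.measurable.comp (hκ.measurable.prodMk
      ((hα.comp (projZeta n).continuous.measurable).prodMk
        (hb.measurable.comp (projZ n).continuous.measurable)))).aestronglyMeasurable
  · refine (hM _ _ _).trans ?_
    have h1 := hC (projZeta n w)
    have h2 := hC' (projZ n w)
    calc M * ‖κ w‖ * ‖α (projZeta n w)‖ * ‖b (projZ n w)‖ ≤ M * ‖κ w‖ * C * C' := by gcongr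
      _ = _ := by ring

/-- The integral `∫ κ ∧ α(ζ) ∧ b(z)`, as a functional of `b`. -/
def kernelFunctional (κ : Cn (n + n) → ExtAlg (n + n)) (α b : Cn n → ExtAlg n) : ℂ :=
  integralForm univ fun w => wedge (κ w) (extBilin n (α (projZeta n w)) (b (projZ n w)))

theorem kernelFunctional_sub_left {κ : Cn (n + n) → ExtAlg (n + n)} (hκ : Continuous κ)
    (hκc : HasCompactSupport κ) {α α' b : Cn n → ExtAlg n} (hα : Measurable α)
    (hα' : Measurable α') {C C₁ C' : ℝ} (hC : ∀ x, ‖α x‖ ≤ C) (hC₁ : ∀ x, ‖α' x‖ ≤ C₁)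
    (hb : Continuous b) (hC' : ∀ x, ‖b x‖ ≤ C') :
    kernelFunctional κ (α - α') b = kernelFunctional κ α b - kernelFunctional κ α' b := by
  rw [kernelFunctional, kernelFunctional, kernelFunctional, integralForm, integralForm,
    integralForm, Measure.restrict_univ, ← mul_sub,
    ← integral_sub (integrable_wedge_extBilin hκ hκc hα hC hb hC')
      (integrable_wedge_extBilin hκ hκc hα' hC₁ hb hC')]
  congr 2
  funext w
  rw [Pi.sub_apply, map_sub, sub_apply]
  exact congrFun (map_sub (wedgeBilin (n + n) (κ w)) _ _) Finset.univ

/-- `b ↦ ∫ κ ∧ α(ζ) ∧ b(z)` is continuous. -/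
theorem exists_kernelFunctionalCLM {κ : Cn (n + n) → ExtAlg (n + n)} (hκ : Continuous κ)
    (hκc : HasCompactSupport κ) {α : Cn n → ExtAlg n} (hα : Measurable α) {C : ℝ}
    (hC : ∀ x, ‖α x‖ ≤ C) (L : Compacts (Cn n)) :
    ∃ R : 𝓓_{L}(Cn n, ExtAlg n) →L[ℂ] ℂ, ∀ b, R b = kernelFunctional κ α b := by
  have hbd : ∀ b : 𝓓_{L}(Cn n, ExtAlg n), ∀ x,
      ‖b x‖ ≤ ContDiffMapSupportedIn.seminorm ℂ (Cn n) (ExtAlg n) ⊤ L 0 b := fun b x =>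
    ContDiffMapSupportedIn.norm_apply_le_seminorm ℂ
  have hint := fun b : 𝓓_{L}(Cn n, ExtAlg n) =>
    integrable_wedge_extBilin hκ hκc hα hC b.continuous (hbd b)
  have hC0 : 0 ≤ C := (norm_nonneg _).trans (hC 0)
  obtain ⟨M, hM0, hM⟩ := exists_norm_wedge_extBilin_le n
  refine ⟨ContDiffMapSupportedIn.mkCLMtoNormedSpace ℂ (fun b => kernelFunctional κ α b) ?_ ?_
    ⟨{0}, ‖(-2 * Complex.I) ^ (n + n)‖ * (M * C * ∫ w, ‖κ w‖), ?_, fun b => ?_⟩, fun b => rfl⟩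
  · intro b c
    simp only [kernelFunctional, integralForm, Measure.restrict_univ]
    rw [← mul_add, ← integral_add (hint b) (hint c)]
    congr 2
    funext w
    rw [add_apply, map_add]
    exact congrFun (map_add (wedgeBilin (n + n) (κ w)) _ _) Finset.univ
  · intro r b
    simp only [kernelFunctional, integralForm, Measure.restrict_univ]
    rw [smul_eq_mul, mul_left_comm]
    congr 1
    rw [← integral_const_mul]
    congr 1
    funext w
    rw [smul_apply, map_smul]
    exact congrFun (map_smul (wedgeBilin (n + n) (κ w)) r _) Finset.univ
  · have : 0 ≤ ∫ w, ‖κ w‖ := integral_nonneg fun w => norm_nonneg _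
    positivity
  · rw [Finset.sup_singleton]
    simp only [kernelFunctional, integralForm, Measure.restrict_univ]
    rw [norm_mul, mul_assoc]
    refine mul_le_mul_of_nonneg_left ?_ (norm_nonneg _)
    refine (norm_integral_le_of_norm_le (((hκ.norm.integrable_of_hasCompactSupport
      hκc.norm).const_mul (M * C)).mul_const
        (ContDiffMapSupportedIn.seminorm ℂ (Cn n) (ExtAlg n) ⊤ L 0 b))
        (Eventually.of_forall fun w => ?_)).trans ?_
    · refine (hM _ _ _).trans ?_
      have h1 := hC (projZeta n w)
      have h2 := hbd b (projZ n w)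
      calc M * ‖κ w‖ * ‖α (projZeta n w)‖ * ‖b (projZ n w)‖
          ≤ M * ‖κ w‖ * C * ContDiffMapSupportedIn.seminorm ℂ (Cn n) (ExtAlg n) ⊤ L 0 b := by
            gcongr
        _ = _ := by ring
    · rw [integral_mul_const, integral_const_mul]

/-- Dominated convergence for `∫ κ ∧ α_j(ζ) ∧ b(z)`. -/
theorem tendsto_kernelFunctional {κ : Cn (n + n) → ExtAlg (n + n)} (hκ : Continuous κ)
    (hκc : HasCompactSupport κ) {α : ℕ → Cn n → ExtAlg n} {α' b : Cn n → ExtAlg n}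
    (hα : ∀ j, Measurable (α j)) {C : ℝ} (hC : ∀ j x, ‖α j x‖ ≤ C)
    (hlim : ∀ x, Tendsto (fun j => α j x) atTop (𝓝 (α' x))) (hb : Continuous b) {C' : ℝ}
    (hC' : ∀ x, ‖b x‖ ≤ C') :
    Tendsto (fun j => kernelFunctional κ (α j) b) atTop (𝓝 (kernelFunctional κ α' b)) := by
  obtain ⟨M, hM0, hM⟩ := exists_norm_wedge_extBilin_le n
  have hC0 : 0 ≤ C := (norm_nonneg _).trans (hC 0 0)
  simp only [kernelFunctional, integralForm, Measure.restrict_univ]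
  refine Tendsto.const_mul _ ?_
  refine tendsto_integral_of_dominated_convergence (fun w => M * C * C' * ‖κ w‖)
    (fun j => (integrable_wedge_extBilin hκ hκc (hα j) (hC j) hb hC').aestronglyMeasurable)
    ((hκ.norm.integrable_of_hasCompactSupport hκc.norm).const_mul _)
    (fun j => Eventually.of_forall fun w => ?_) (Eventually.of_forall fun w => ?_)
  · refine (hM _ _ _).trans ?_
    have h1 := hC j (projZeta n w)
    have h2 := hC' (projZ n w)
    calc M * ‖κ w‖ * ‖α j (projZeta n w)‖ * ‖b (projZ n w)‖ ≤ M * ‖κ w‖ * C * C' := by gcongr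
      _ = _ := by ring
  · have h : Continuous fun a : ExtAlg n =>
        wedge (κ w) (extBilin n a (b (projZ n w))) Finset.univ :=
      (continuous_apply _).comp (continuous_wedge continuous_const
        ((extBilin n).continuous.clm_apply continuous_const))
    exact (h.tendsto _).comp (hlim _)

theorem cutoff_apply {D : Opens (Cn n)} (χ : 𝓓(D, ℝ)) {α : Cn n → ExtAlg n}
    (hα : ContDiffOn ℝ ∞ α (D : Set (Cn n))) (x : Cn n) : cutoff χ α hα x = χ x • α x := rfl

theorem cutoff_eq_smul_indicator {D : Opens (Cn n)} (χ : 𝓓(D, ℝ)) {α : Cn n → ExtAlg n}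
    (hα : ContDiffOn ℝ ∞ α (D : Set (Cn n))) (x : Cn n) :
    cutoff χ α hα x = χ x • (D : Set (Cn n)).indicator α x := by
  rw [cutoff_apply]
  by_cases hx : x ∈ (D : Set (Cn n))
  · rw [indicator_of_mem hx]
  · rw [image_eq_zero_of_notMem_tsupport fun h => hx (χ.tsupport_subset h), zero_smul, zero_smul]

/-- An exhausting sequence converges to `1` on `D`. -/
theorem IsExhausting.tendsto_smul {D : Opens (Cn n)} {χ : ℕ → 𝓓(D, ℝ)} (hχ : IsExhausting χ)
    (α : Cn n → ExtAlg n) (x : Cn n) :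
    Tendsto (fun j => χ j x • (D : Set (Cn n)).indicator α x) atTop
      (𝓝 ((D : Set (Cn n)).indicator α x)) := by
  by_cases hx : x ∈ (D : Set (Cn n))
  · refine tendsto_const_nhds.congr' ?_
    filter_upwards [hχ.eventually_one {x} isCompact_singleton (singleton_subset_iff.2 hx)]
      with j hj
    rw [hj x rfl, one_smul]
  · simp [indicator_of_notMem hx]

/-- The limit that defines `∫_D K ∧ α` exists, and is continuous on the test forms with support in
a fixed compact set: up to a term that only involves `α` on a compact part of `D`, it is given by
integration against a continuous form. -/
theorem exists_fiberIntegral_supportedIn {Ω D : Opens (Cn n)} (hDΩ : (D : Set (Cn n)) ⊆ Ω)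
    (hDc : IsCompact (closure (D : Set (Cn n)))) (K : Current (prodOpens Ω Ω))
    {U : Set (Cn (n + n))} (hU : IsOpen U) {k : Cn (n + n) → ExtAlg (n + n)}
    (hk : ContinuousOn k U)
    (hKk : ∀ Ψ : 𝓓(prodOpens Ω Ω, ExtAlg (n + n)), tsupport Ψ ⊆ U →
      K Ψ = integralForm U fun w => wedge (k w) (Ψ w))
    {F : Set (Cn n)} (hF : IsClosed F)
    (hUD : ∀ ζ ∈ frontier (D : Set (Cn n)) ∩ F, ∀ z ∈ D, (Fin.append ζ z : Cn (n + n)) ∈ U)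
    {χ₀ : ℕ → 𝓓(D, ℝ)} (hχ₀ : IsExhausting χ₀) {α : Cn n → ExtAlg n}
    (hα : ContDiffOn ℝ ∞ α (D : Set (Cn n))) {C : ℝ} (hC : ∀ x ∈ D, ‖α x‖ ≤ C)
    (hαF : ∀ x ∈ D, α x ≠ 0 → x ∈ F) (L : Compacts (Cn n)) (hL : (L : Set (Cn n)) ⊆ D) :
    ∃ T : 𝓓_{L}(Cn n, ExtAlg n) →L[ℂ] ℂ, ∀ χ : ℕ → 𝓓(D, ℝ), IsExhausting χ → ∀ ψ,
      Tendsto (fun j => K (TestFunction.monoCLM ℂ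
        (extProd (cutoff (χ j) α hα) (TestFunction.ofSupportedIn hL ψ)))) atTop (𝓝 (T ψ)) := by
  obtain ⟨ξ, hξc, -, hκ, -, M, hMc, hMD, hM⟩ :=
    exists_localKernel hDΩ hDc K hU hk hKk hF hUD L.isCompact hL
  set κ : Cn (n + n) → ExtAlg (n + n) := fun w => ξ w • k w
  have hκc : HasCompactSupport κ := hξc.smul_right
  obtain ⟨j₀, hj₀⟩ := (hχ₀.eventually_one M hMc hMD).exists
  set β : Cn n → ExtAlg n := (D : Set (Cn n)).indicator α with hβ
  have hβm : Measurable β := measurable_indicator_of_continuousOn D.isOpen hα.continuousOn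
  have hβC : ∀ x, ‖β x‖ ≤ |C| := by
    intro x
    by_cases hx : x ∈ (D : Set (Cn n))
    · rw [hβ, indicator_of_mem hx]
      exact (hC x hx).trans (le_abs_self C)
    · rw [hβ, indicator_of_notMem hx, norm_zero]
      exact abs_nonneg C
  have hχm : ∀ χ : 𝓓(D, ℝ), Measurable fun x => χ x • β x := fun χ =>
    χ.continuous.measurable.smul hβm
  have hχC : ∀ χ : 𝓓(D, ℝ), (∀ x, χ x ∈ Icc (0 : ℝ) 1) → ∀ x, ‖χ x • β x‖ ≤ |C| := by
    intro χ hχ x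
    rw [norm_smul, Real.norm_of_nonneg (hχ x).1]
    exact (mul_le_of_le_one_left (norm_nonneg _) (hχ x).2).trans (hβC x)
  set β₀ : Cn n → ExtAlg n := fun x => χ₀ j₀ x • β x
  have hβ₀m := hχm (χ₀ j₀)
  have hβ₀C := hχC (χ₀ j₀) (hχ₀.mem_Icc j₀)
  have hdC : ∀ x, ‖(β - β₀) x‖ ≤ |C| + |C| := fun x =>
    (norm_sub_le _ _).trans (add_le_add (hβC x) (hβ₀C x))
  obtain ⟨R, hR⟩ := exists_kernelFunctionalCLM hκ hκc (hβm.sub hβ₀m) hdC L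
  refine ⟨K ∘L TestFunction.monoCLM ℂ ∘L extProdSupportedIn (cutoff (χ₀ j₀) α hα) L hL + R,
    fun χ hχ ψ => ?_⟩
  have hψC : ∀ x, ‖ψ x‖ ≤ ContDiffMapSupportedIn.seminorm ℂ (Cn n) (ExtAlg n) ⊤ L 0 ψ :=
    fun x => ContDiffMapSupportedIn.norm_apply_le_seminorm ℂ
  have h1 : ∀ᶠ j in atTop, K (TestFunction.monoCLM ℂ
      (extProd (cutoff (χ₀ j₀) α hα) (TestFunction.ofSupportedIn hL ψ))) +
      (kernelFunctional κ (fun x => χ j x • β x) ψ - kernelFunctional κ β₀ ψ) =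
      K (TestFunction.monoCLM ℂ
        (extProd (cutoff (χ j) α hα) (TestFunction.ofSupportedIn hL ψ))) := by
    filter_upwards [hχ.eventually_one M hMc hMD] with j hj
    have h2 := hM (cutoff (χ j) α hα - cutoff (χ₀ j₀) α hα) (TestFunction.ofSupportedIn hL ψ)
      (fun x hx => ?_) (fun x hx => ?_) ψ.tsupport_subset
    · rw [← kernelFunctional_sub_left hκ hκc (hχm (χ j)) hβ₀m (hχC (χ j) (hχ.mem_Icc j)) hβ₀C
        ψ.continuous hψC]
      rw [extProd_sub_left, map_sub, map_sub] at h2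
      rw [eq_comm, ← sub_eq_iff_eq_add', h2]
      simp only [kernelFunctional]
      congr 1
      funext w
      rw [← extProd_sub_left, extProd_apply]
      simp only [sub_apply, cutoff_eq_smul_indicator]
      rfl
    · rw [sub_apply, cutoff_eq_smul_indicator, cutoff_eq_smul_indicator, ← sub_smul] at hx
      have h3 := right_ne_zero_of_smul hx
      have hxD : x ∈ (D : Set (Cn n)) := by
        by_contra h
        exact h3 (indicator_of_notMem h _)
      rw [indicator_of_mem hxD] at h3
      exact hαF x hxD h3
    · rw [sub_apply, cutoff_apply, cutoff_apply, hj x hx, hj₀ x hx, sub_self]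
  refine Tendsto.congr' h1 ?_
  rw [add_apply]
  refine tendsto_const_nhds.add ?_
  rw [hR, kernelFunctional_sub_left hκ hκc hβm hβ₀m hβC hβ₀C ψ.continuous hψC]
  exact (tendsto_kernelFunctional hκ hκc (fun j => hχm (χ j))
    (fun j => hχC (χ j) (hχ.mem_Icc j)) (hχ.tendsto_smul α) ψ.continuous hψC).sub_const _

/-- The current `∫_D K ∧ α` exists. -/
theorem exists_isFiberIntegral {Ω D : Opens (Cn n)} (hDΩ : (D : Set (Cn n)) ⊆ Ω)
    (hDc : IsCompact (closure (D : Set (Cn n)))) (K : Current (prodOpens Ω Ω))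
    {U : Set (Cn (n + n))} (hU : IsOpen U) {k : Cn (n + n) → ExtAlg (n + n)}
    (hk : ContinuousOn k U)
    (hKk : ∀ Ψ : 𝓓(prodOpens Ω Ω, ExtAlg (n + n)), tsupport Ψ ⊆ U →
      K Ψ = integralForm U fun w => wedge (k w) (Ψ w))
    {F : Set (Cn n)} (hF : IsClosed F)
    (hUD : ∀ ζ ∈ frontier (D : Set (Cn n)) ∩ F, ∀ z ∈ D, (Fin.append ζ z : Cn (n + n)) ∈ U)
    {χ₀ : ℕ → 𝓓(D, ℝ)} (hχ₀ : IsExhausting χ₀) {α : Cn n → ExtAlg n}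
    (hα : ContDiffOn ℝ ∞ α (D : Set (Cn n))) {C : ℝ} (hC : ∀ x ∈ D, ‖α x‖ ≤ C)
    (hαF : ∀ x ∈ D, α x ≠ 0 → x ∈ F) : ∃ T : Current D, IsFiberIntegral K α hα T := by
  have h := exists_fiberIntegral_supportedIn hDΩ hDc K hU hk hKk hF hUD hχ₀ hα hC hαF
  choose T hT using h
  have hlim : ∀ L hL ψ, limUnder atTop (fun j => K (TestFunction.monoCLM ℂ
      (extProd (cutoff (χ₀ j) α hα) (TestFunction.ofSupportedIn hL ψ)))) = T L hL ψ :=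
    fun L hL ψ => (hT L hL χ₀ hχ₀ ψ).limUnder_eq
  refine ⟨TestFunction.limitCLM ℂ (fun ψ => limUnder atTop (fun j => K (TestFunction.monoCLM ℂ
      (extProd (cutoff (χ₀ j) α hα) ψ)))) T hlim, fun χ hχ ψ => ?_⟩
  let L : Compacts (Cn n) := ⟨tsupport ψ, ψ.hasCompactSupport⟩
  have hL : (L : Set (Cn n)) ⊆ D := ψ.tsupport_subset
  let ψ' : 𝓓_{L}(Cn n, ExtAlg n) := .of_support_subset ψ.contDiff subset_closure
  have hψ : TestFunction.ofSupportedIn hL ψ' = ψ := rfl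
  have h1 := hT L hL χ hχ ψ'
  rw [← hlim L hL ψ'] at h1
  rw [hψ] at h1
  exact h1

/-! ### Fubini's theorem for forms on the product -/

/-- The identification of pairs `(ζ, z)` with points of `ℂ^(n+n)`. -/
def appendHomeo (n : ℕ) : Cn n × Cn n ≃ₜ Cn (n + n) where
  toFun x := Fin.append x.1 x.2
  invFun w := (projZeta n w, projZ n w)
  left_inv _ := Prod.ext (projZeta_append _ _) (projZ_append _ _)
  right_inv w := append_projZeta_projZ w
  continuous_toFun := continuous_append
  continuous_invFun := (projZeta n).continuous.prodMk (projZ n).continuous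

theorem measurePreserving_append : MeasurePreserving (appendHomeo n) := by
  refine ⟨(appendHomeo n).continuous.measurable, ?_⟩
  refine (Measure.pi_eq fun s hs => ?_).symm
  rw [Measure.map_apply (appendHomeo n).continuous.measurable (MeasurableSet.univ_pi hs)]
  have h : appendHomeo n ⁻¹' Set.pi univ s =
      (Set.pi univ fun i => s (Fin.castAdd n i)) ×ˢ (Set.pi univ fun i => s (Fin.natAdd n i)) := by
    ext x
    simp only [mem_preimage, mem_univ_pi, mem_prod, appendHomeo, Homeomorph.homeomorph_mk_coe,
      Equiv.coe_fn_mk]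
    constructor
    · intro h
      refine ⟨fun i => ?_, fun i => ?_⟩
      · have := h (Fin.castAdd n i)
        rwa [Fin.append_left] at this
      · have := h (Fin.natAdd n i)
        rwa [Fin.append_right] at this
    · rintro ⟨h1, h2⟩ i
      refine Fin.addCases (fun j => ?_) (fun j => ?_) i
      · rw [Fin.append_left]
        exact h1 j
      · rw [Fin.append_right]
        exact h2 j
  rw [h, Measure.volume_eq_prod, Measure.prod_prod, volume_pi_pi, volume_pi_pi, Fin.prod_univ_add]

theorem integrable_append {E : Type*} [NormedAddCommGroup E] {f : Cn (n + n) → E}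
    (hf : Integrable f) :
    Integrable (Function.uncurry fun ζ z : Cn n => f (Fin.append ζ z)) (volume.prod volume) :=
  (measurePreserving_append.integrable_comp_emb
    (appendHomeo n).measurableEmbedding).2 hf

theorem integral_append {E : Type*} [NormedAddCommGroup E] [NormedSpace ℝ E]
    {f : Cn (n + n) → E} (hf : Integrable f) :
    ∫ w, f w = ∫ ζ : Cn n, ∫ z : Cn n, f (Fin.append ζ z) := by
  rw [← measurePreserving_append.integral_comp (appendHomeo n).measurableEmbedding,
    Measure.volume_eq_prod]
  exact integral_prod _ (integrable_append hf)

theorem integral_append' {E : Type*} [NormedAddCommGroup E] [NormedSpace ℝ E]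
    {f : Cn (n + n) → E} (hf : Integrable f) :
    ∫ w, f w = ∫ z : Cn n, ∫ ζ : Cn n, f (Fin.append ζ z) := by
  rw [integral_append hf]
  exact integral_integral_swap (integrable_append hf)

/-- The form `c` in `ζ` such that `c ∧ vol(z)` is the part of `Y ∧ b(z)` of top degree in `z`, where
`vol(z)` is the monomial of top degree. -/
def zContract (Y : ExtAlg (n + n)) (b : ExtAlg n) : ExtAlg n :=
  ∑ B, (wedgeSign B (Finset.univ \ B) * b (Finset.univ \ B)) • slice Y B

theorem wedge_liftZ_univ_eq_zContract (Y : ExtAlg (n + n)) (b : ExtAlg n) :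
    wedge Y (liftZ b) Finset.univ = zContract Y b Finset.univ := by
  rw [wedge_liftZ_univ, wedge, zContract, Finset.sum_apply, Finset.powerset_univ]
  refine Finset.sum_congr rfl fun B _ => ?_
  rw [Pi.smul_apply, smul_eq_mul]
  ring

theorem wedge_zContract (a b : ExtAlg n) (Y : ExtAlg (n + n)) :
    wedge a (zContract Y b) = zContract (wedge (liftZeta a) Y) b := by
  simp only [zContract, slice_wedge_liftZeta]
  rw [wedge_sum_right]
  simp only [wedge_smul_right]

theorem continuous_zContract {X : Type*} [TopologicalSpace X] {Y : X → ExtAlg (n + n)}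
    {b : X → ExtAlg n} (hY : Continuous Y) (hb : Continuous b) :
    Continuous fun x => zContract (Y x) (b x) := by
  refine continuous_finsetSum _ fun B _ => ?_
  refine (continuous_const.mul ((continuous_apply _).comp hb)).smul ?_
  exact continuous_pi fun A => (continuous_apply _).comp hY

theorem zContract_zero_right (Y : ExtAlg (n + n)) : zContract Y 0 = 0 := by
  simp [zContract]

theorem isBidegree_zContract {p q : ℕ} {c : ExtAlg (n + n)} {a b : ExtAlg n}
    (hc : IsBidegree n (n - 1) c) (ha : IsBidegree p q a) (hb : IsComplBidegree p q b) :
    IsBidegree n (n - 1) (zContract (wedge c (liftZeta a)) b) := by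
  intro A hA
  rw [zContract, Finset.sum_apply] at hA
  obtain ⟨B, -, hB⟩ := Finset.exists_ne_zero_of_sum_ne_zero hA
  rw [Pi.smul_apply, smul_eq_mul, slice] at hB
  have hb' := hb _ (right_ne_zero_of_mul (left_ne_zero_of_mul hB))
  have h1 := right_ne_zero_of_mul hB
  rw [wedge] at h1
  obtain ⟨S, hS, h2⟩ := Finset.exists_ne_zero_of_sum_ne_zero h1
  have hc' := hc _ (right_ne_zero_of_mul (left_ne_zero_of_mul h2))
  have h3 := right_ne_zero_of_mul h2
  obtain ⟨A', B', hAB⟩ := exists_idxPair (idxPair A B \ S)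
  rw [hAB, liftZeta_idxPair] at h3
  split_ifs at h3 with hB'
  · have ha' := ha _ h3
    have e1 := holDeg_sdiff (Finset.mem_powerset.1 hS)
    have e2 := antiDeg_sdiff (Finset.mem_powerset.1 hS)
    rw [hAB, holDeg_idxPair, holDeg_idxPair, hB', show holDeg (∅ : Finset (Idx n)) = 0 from rfl]
      at e1
    rw [hAB, antiDeg_idxPair, antiDeg_idxPair, hB', show antiDeg (∅ : Finset (Idx n)) = 0 from rfl]
      at e2
    have e3 := holDeg_sdiff (Finset.subset_univ B)
    have e4 := antiDeg_sdiff (Finset.subset_univ B)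
    rw [holDeg_univ] at e3
    rw [antiDeg_univ] at e4
    omega
  · exact absurd rfl h3

/-- Fubini's theorem, with the integration over `ζ` inside. -/
theorem kernelFunctional_eq_integral_fiber {κ : Cn (n + n) → ExtAlg (n + n)} (hκ : Continuous κ)
    (hκc : HasCompactSupport κ) {α b : Cn n → ExtAlg n} (hα : Measurable α) {C : ℝ}
    (hC : ∀ x, ‖α x‖ ≤ C) (hb : Continuous b) {C' : ℝ} (hC' : ∀ x, ‖b x‖ ≤ C') :
    kernelFunctional κ α b = integralForm univ fun z => wedge
      (fiberIntegralForm univ (fun w => wedge (κ w) (liftZeta (α (projZeta n w)))) z) (b z) := by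
  have hslice : ∀ z B, Integrable fun ζ => slice (wedge (κ (Fin.append ζ z))
      (liftZeta (α ζ))) B Finset.univ := by
    intro z B
    let β : ExtAlg (n + n) →L[ℂ] ExtAlg n →L[ℂ] ℂ :=
      (ContinuousLinearMap.compL ℂ (ExtAlg n) (ExtAlg (n + n)) ℂ
        (ContinuousLinearMap.proj (idxPair Finset.univ B))) ∘L
      ((ContinuousLinearMap.compL ℂ (ExtAlg n) (ExtAlg (n + n)) (ExtAlg (n + n))).flip
        (liftZetaCLM n) ∘L wedgeBilin (n + n))
    have h1 : Continuous fun ζ => κ (Fin.append ζ z) :=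
      hκ.comp (continuous_append.comp (continuous_id.prodMk continuous_const))
    have h2 : HasCompactSupport fun ζ => κ (Fin.append ζ z) := by
      refine HasCompactSupport.intro
        ((show IsCompact (tsupport κ) from hκc).image (projZeta n).continuous) fun ζ hζ => ?_
      by_contra h
      exact hζ ⟨_, subset_tsupport _ h, projZeta_append ζ z⟩
    exact β.integrable_of_bilin_of_bdd_right C (h1.integrable_of_hasCompactSupport h2)
      hα.aestronglyMeasurable (Eventually.of_forall hC)
  rw [kernelFunctional, integralForm, integralForm, Measure.restrict_univ, Measure.restrict_univ,
    integral_append' (integrable_wedge_extBilin hκ hκc hα hC hb hC'), pow_add, mul_assoc,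
    ← integral_const_mul]
  congr 2
  funext z
  have h3 : ∀ ζ, wedge (κ (Fin.append ζ z)) (extBilin n (α (projZeta n (Fin.append ζ z)))
      (b (projZ n (Fin.append ζ z)))) Finset.univ = ∑ B, wedgeSign B (Finset.univ \ B) *
        b z (Finset.univ \ B) * slice (wedge (κ (Fin.append ζ z)) (liftZeta (α ζ))) B
          Finset.univ := by
    intro ζ
    rw [projZeta_append, projZ_append, extBilin_apply, ← wedge_assoc,
      wedge_liftZ_univ_eq_zContract, zContract, Finset.sum_apply]
    rfl
  simp only [h3]
  rw [integral_finsetSum _ fun B _ => (hslice z B).const_mul _, wedge, Finset.powerset_univ,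
    Finset.mul_sum]
  refine Finset.sum_congr rfl fun B _ => ?_
  rw [integral_const_mul, fiberIntegralForm, integralForm, Measure.restrict_univ]
  simp only [projZeta_append]
  ring

/-- The fibre integral over `z` that corresponds to `κ ∧ α(ζ) ∧ b(z)`, as a form in `ζ`. -/
def zIntegral (κ : Cn (n + n) → ExtAlg (n + n)) (α b : Cn n → ExtAlg n) (ζ : Cn n) : ExtAlg n :=
  (-2 * Complex.I) ^ n • ∫ z, zContract (wedge (κ (Fin.append ζ z)) (liftZeta (α ζ))) (b z)

theorem continuous_zIntegrand {κ : Cn (n + n) → ExtAlg (n + n)} (hκ : Continuous κ)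
    {α b : Cn n → ExtAlg n} (hα : Continuous α) (hb : Continuous b) :
    Continuous fun x : Cn n × Cn n =>
      zContract (wedge (κ (Fin.append x.1 x.2)) (liftZeta (α x.1))) (b x.2) :=
  continuous_zContract (continuous_wedge (hκ.comp continuous_append)
    ((liftZetaCLM n).continuous.comp (hα.comp continuous_fst))) (hb.comp continuous_snd)

theorem continuous_zIntegral {κ : Cn (n + n) → ExtAlg (n + n)} (hκ : Continuous κ)
    {α b : Cn n → ExtAlg n} (hα : Continuous α) (hb : Continuous b) (hbc : HasCompactSupport b) :
    Continuous (zIntegral κ α b) := by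
  have h1 : ∀ ζ, ∫ z, zContract (wedge (κ (Fin.append ζ z)) (liftZeta (α ζ))) (b z) =
      ∫ z in tsupport b, zContract (wedge (κ (Fin.append ζ z)) (liftZeta (α ζ))) (b z) := by
    intro ζ
    refine (setIntegral_eq_integral_of_forall_compl_eq_zero fun z hz => ?_).symm
    rw [image_eq_zero_of_notMem_tsupport hz, zContract_zero_right]
  unfold zIntegral
  simp only [h1]
  have h2 : Continuous fun ζ => ∫ z in tsupport b,
      zContract (wedge (κ (Fin.append ζ z)) (liftZeta (α ζ))) (b z) :=
    continuous_parametric_integral_of_continuous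
      (f := fun ζ z => zContract (wedge (κ (Fin.append ζ z)) (liftZeta (α ζ))) (b z))
      (continuous_zIntegrand hκ hα hb) hbc
  exact h2.const_smul ((-2 * Complex.I) ^ n)

theorem gradeInvol_of_isBidegree {p q : ℕ} {a : ExtAlg m} (ha : IsBidegree p q a) :
    gradeInvol a = (-1 : ℂ) ^ (p + q) • a := by
  funext S
  rw [gradeInvol_apply, Pi.smul_apply, smul_eq_mul]
  by_cases h : a S = 0
  · rw [h, mul_zero, mul_zero]
  · rw [← holDeg_add_antiDeg, (ha S h).1, (ha S h).2]

/-- The form `∂̄χ(ζ)` has degree one, so moving it past `Y` costs the sign of the degree of `Y`. -/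
theorem wedge_liftZeta_dbarFun (χ : Cn n → ℝ) (x : Cn n) (Y : ExtAlg (n + n)) :
    wedge (liftZeta (dbarFun χ x)) Y = wedge (gradeInvol Y) (liftZeta (dbarFun χ x)) := by
  have h : liftZeta (dbarFun χ x) = ∑ j : Fin n, (1 / 2 * ((fderiv ℝ χ x (Pi.single j 1) : ℂ) +
      Complex.I * (fderiv ℝ χ x (Pi.single j Complex.I) : ℂ))) • dzbar (Fin.castAdd n j) := by
    rw [← liftZetaCLM_apply, dbarFun, map_sum]
    refine Finset.sum_congr rfl fun j _ => ?_
    rw [map_smul, liftZetaCLM_apply, dzbar_castAdd]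
  rw [h, wedge_sum_right]
  have h2 : wedge (∑ j : Fin n, (1 / 2 * ((fderiv ℝ χ x (Pi.single j 1) : ℂ) +
      Complex.I * (fderiv ℝ χ x (Pi.single j Complex.I) : ℂ))) • dzbar (Fin.castAdd n j)) Y =
      ∑ j : Fin n, wedge ((1 / 2 * ((fderiv ℝ χ x (Pi.single j 1) : ℂ) +
      Complex.I * (fderiv ℝ χ x (Pi.single j Complex.I) : ℂ))) • dzbar (Fin.castAdd n j)) Y := by
    rw [← wedgeBilin_apply, map_sum, sum_apply]
    rfl
  rw [h2]
  refine Finset.sum_congr rfl fun j _ => ?_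
  rw [wedge_smul_left, wedge_smul_right]
  congr 1
  exact wedge_single_comm _ _

theorem continuous_dbarFun {χ : Cn n → ℝ} (hχ : ContDiff ℝ ∞ χ) : Continuous (dbarFun χ) := by
  have h : ∀ v, Continuous fun x => (fderiv ℝ χ x v : ℂ) := fun v =>
    Complex.continuous_ofReal.comp ((hχ.continuous_fderiv (by simp)).clm_apply continuous_const)
  refine continuous_finsetSum _ fun j _ => ?_
  exact (continuous_const.mul ((h _).add (continuous_const.mul (h _)))).smul continuous_const

/-- Fubini's theorem, with the integration over `z` inside. The sign comes from moving `∂̄χ` past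
the kernel, which has odd degree. -/
theorem kernelFunctional_dbarFun {κ : Cn (n + n) → ExtAlg (n + n)} (hκ : Continuous κ)
    (hκc : HasCompactSupport κ) (hκd : ∀ w, gradeInvol (κ w) = -κ w) {χ : Cn n → ℝ}
    (hχ : ContDiff ℝ ∞ χ) (hχc : HasCompactSupport χ) {α b : Cn n → ExtAlg n} (hα : Continuous α)
    (hb : Continuous b) (hbc : HasCompactSupport b) :
    kernelFunctional κ (fun x => wedge (dbarFun χ x) (α x)) b =
      -integralForm univ fun ζ => wedge (dbarFun χ ζ) (zIntegral κ α b ζ) := by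
  have h1 : ∀ ζ z, wedge (κ (Fin.append ζ z)) (extBilin n (wedge (dbarFun χ ζ) (α ζ)) (b z))
      Finset.univ = -wedge (dbarFun χ ζ)
        (zContract (wedge (κ (Fin.append ζ z)) (liftZeta (α ζ))) (b z)) Finset.univ := by
    intro ζ z
    rw [wedge_zContract, ← wedge_liftZ_univ_eq_zContract, extBilin_apply, liftZeta_wedge,
      ← wedge_assoc, ← wedge_assoc, ← wedge_assoc, wedge_liftZeta_dbarFun, hκd]
    rw [← wedgeBilin_apply (-κ _), map_neg, neg_apply, wedgeBilin_apply,
      ← wedgeBilin_apply (-_), map_neg, neg_apply, wedgeBilin_apply,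
      ← wedgeBilin_apply (-_), map_neg, neg_apply, wedgeBilin_apply, Pi.neg_apply, neg_neg]
  have hdc : HasCompactSupport (dbarFun χ) := by
    refine HasCompactSupport.intro (hχc.fderiv (𝕜 := ℝ)) fun x hx => ?_
    have h0 : fderiv ℝ χ x = 0 := image_eq_zero_of_notMem_tsupport hx
    rw [dbarFun, h0]
    simp
  have hd : Continuous fun x => wedge (dbarFun χ x) (α x) :=
    continuous_wedge (continuous_dbarFun hχ) hα
  have hdc' : HasCompactSupport fun x => wedge (dbarFun χ x) (α x) :=
    HasCompactSupport.intro hdc fun x hx => by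
      rw [image_eq_zero_of_notMem_tsupport hx, wedge_zero_left]
  obtain ⟨C, hC⟩ := hd.bounded_above_of_compact_support hdc'
  obtain ⟨C', hC'⟩ := hb.bounded_above_of_compact_support hbc
  rw [kernelFunctional, integralForm, integralForm, Measure.restrict_univ, Measure.restrict_univ,
    integral_append (integrable_wedge_extBilin hκ hκc hd.measurable hC hb hC'), pow_add, mul_assoc,
    ← integral_const_mul, ← mul_neg, ← integral_neg]
  congr 2
  funext ζ
  simp only [projZeta_append, projZ_append, h1]
  rw [integral_neg, mul_neg, zIntegral, wedge_smul_right, Pi.smul_apply, smul_eq_mul]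
  congr 2
  let ℓ : ExtAlg n →L[ℂ] ℂ :=
    (ContinuousLinearMap.proj Finset.univ) ∘L (wedgeBilin n (dbarFun χ ζ))
  refine ℓ.integral_comp_comm (φ := fun z =>
    zContract (wedge (κ (Fin.append ζ z)) (liftZeta (α ζ))) (b z)) ?_
  refine Continuous.integrable_of_hasCompactSupport ((continuous_zIntegrand hκ hα hb).comp
    (continuous_const.prodMk continuous_id : Continuous fun z => (ζ, z)))
    (HasCompactSupport.intro hbc fun z hz => ?_)
  rw [image_eq_zero_of_notMem_tsupport hz, zContract_zero_right]

section

variable {D : Set (Cn n)}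

/-! ### Boundary integrals of families of forms -/

/-- Evaluation on a fixed family of tangent vectors. -/
def evalFormCLM {k : ℕ} (v : Fin k → Cn m) : ExtAlg m →L[ℂ] ℂ :=
  ∑ S : {S : Finset (Idx m) // S.card = k},
    Matrix.det (Matrix.of fun i b : Fin k => coframe (S.1.orderEmbOfFin S.2 i) (v b)) •
      ContinuousLinearMap.proj S.1

theorem evalFormCLM_apply {k : ℕ} (v : Fin k → Cn m) (a : ExtAlg m) :
    evalFormCLM v a = evalForm a v := by
  rw [evalForm_eq_sum, evalFormCLM, sum_apply]
  refine Finset.sum_congr rfl fun S _ => ?_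
  rw [smul_apply, smul_eq_mul, mul_comm]
  rfl

theorem continuousOn_evalForm {X : Type*} [TopologicalSpace X] {k : ℕ} {s : Set X}
    {a : X → ExtAlg m} {v : X → Fin k → Cn m} (ha : ContinuousOn a s) (hv : ContinuousOn v s) :
    ContinuousOn (fun x => evalForm (a x) (v x)) s := by
  rw [continuousOn_iff_continuous_domRestrict] at ha hv ⊢
  simp only [evalForm_eq_sum]
  refine continuous_finsetSum _ fun S _ => ?_
  refine ((continuous_apply S.1).comp ha).mul ?_
  refine Continuous.matrix_det (continuous_pi fun i => continuous_pi fun b => ?_)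
  exact (coframe _).continuous.comp ((continuous_apply b).comp hv)

/-- The integrand of `𝔞.integral θ` in the `i`-th parametrization. -/
def BoundaryAtlas.integrand (𝔞 : BoundaryAtlas D) (i : Fin 𝔞.N) (θ : Cn n → ExtAlg n)
    (t : Fin (2 * n - 1) → ℝ) : ℂ :=
  (𝔞.dom i).indicator (fun t => (𝔞.weight i (𝔞.param i t) : ℂ) *
    evalForm (θ (𝔞.param i t)) (tangentFrame (𝔞.param i) t)) t

theorem BoundaryAtlas.integral_eq_sum (𝔞 : BoundaryAtlas D) (θ : Cn n → ExtAlg n) :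
    𝔞.integral θ = ∑ i, ∫ t, 𝔞.integrand i θ t :=
  Finset.sum_congr rfl fun i _ => (integral_indicator (𝔞.isOpen_dom i).measurableSet).symm

theorem BoundaryAtlas.integrand_eq_zero (𝔞 : BoundaryAtlas D) (i : Fin 𝔞.N)
    {L : Set (Fin (2 * n - 1) → ℝ)}
    (hL : ∀ t ∈ 𝔞.dom i, t ∉ L → 𝔞.weight i (𝔞.param i t) = 0) (θ : Cn n → ExtAlg n) :
    ∀ t, t ∉ L → 𝔞.integrand i θ t = 0 := by
  intro t ht
  rw [BoundaryAtlas.integrand]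
  by_cases h : t ∈ 𝔞.dom i
  · rw [indicator_of_mem h, hL t h ht, Complex.ofReal_zero, zero_mul]
  · rw [indicator_of_notMem h]

theorem BoundaryAtlas.continuous_integrand {X : Type*} [TopologicalSpace X] (𝔞 : BoundaryAtlas D)
    (i : Fin 𝔞.N) {f : X → Cn n → ExtAlg n} (hf : Continuous fun p : X × Cn n => f p.1 p.2) :
    Continuous fun p : X × (Fin (2 * n - 1) → ℝ) => 𝔞.integrand i (f p.1) p.2 := by
  obtain ⟨L, hL, hLd, hw⟩ := 𝔞.exists_compact i
  refine continuous_of_zero_off (U := univ ×ˢ 𝔞.dom i) (L := univ ×ˢ L)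
    (isOpen_univ.prod (𝔞.isOpen_dom i)) (isClosed_univ.prod hL.isClosed)
    (prod_mono le_rfl hLd) ?_ ?_
  · have hs : MapsTo (fun p : X × (Fin (2 * n - 1) → ℝ) => p.2) (univ ×ˢ 𝔞.dom i) (𝔞.dom i) :=
      fun p hp => hp.2
    have h1 : ContinuousOn (fun p : X × (Fin (2 * n - 1) → ℝ) =>
        (𝔞.weight i (𝔞.param i p.2) : ℂ)) (univ ×ˢ 𝔞.dom i) :=
      Complex.continuous_ofReal.comp_continuousOn
        ((𝔞.continuousOn_weight i).comp continuousOn_snd hs)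
    have h2 : ContinuousOn (fun p : X × (Fin (2 * n - 1) → ℝ) => 𝔞.param i p.2)
        (univ ×ˢ 𝔞.dom i) := (𝔞.contDiffOn_param i).continuousOn.comp continuousOn_snd hs
    have h3 : ContinuousOn (fun p : X × (Fin (2 * n - 1) → ℝ) => tangentFrame (𝔞.param i) p.2)
        (univ ×ˢ 𝔞.dom i) := (𝔞.continuousOn_tangentFrame i).comp continuousOn_snd hs
    have h4 : ContinuousOn (fun p : X × (Fin (2 * n - 1) → ℝ) => f p.1 (𝔞.param i p.2))
        (univ ×ˢ 𝔞.dom i) := hf.comp_continuousOn (continuousOn_fst.prodMk h2)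
    have h5 : ContinuousOn (fun p : X × (Fin (2 * n - 1) → ℝ) =>
        evalForm (f p.1 (𝔞.param i p.2)) (tangentFrame (𝔞.param i) p.2)) (univ ×ˢ 𝔞.dom i) :=
      continuousOn_evalForm h4 h3
    exact (h1.mul h5).congr fun p hp => indicator_of_mem hp.2 _
  · intro p hp
    exact 𝔞.integrand_eq_zero i hw _ _ fun h => hp ⟨mem_univ _, h⟩

theorem BoundaryAtlas.integrable_integrand (𝔞 : BoundaryAtlas D) (i : Fin 𝔞.N)
    {θ : Cn n → ExtAlg n} (hθ : Continuous θ) : Integrable (𝔞.integrand i θ) := by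
  obtain ⟨L, hL, hLd, hw⟩ := 𝔞.exists_compact i
  have hc : Continuous (𝔞.integrand i θ) :=
    (𝔞.continuous_integrand i (X := Unit) (f := fun _ => θ) (hθ.comp continuous_snd)).comp
      (continuous_const.prodMk continuous_id : Continuous fun t => ((), t))
  exact hc.integrable_of_hasCompactSupport
    (HasCompactSupport.intro hL (𝔞.integrand_eq_zero i hw θ))

/-- The boundary integral depends only on the values on the boundary. -/
theorem BoundaryAtlas.integral_congr (𝔞 : BoundaryAtlas D) {θ θ' : Cn n → ExtAlg n}
    (h : ∀ x ∈ frontier D, θ x = θ' x) : 𝔞.integral θ = 𝔞.integral θ' :=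
  Finset.sum_congr rfl fun i _ => setIntegral_congr_fun (𝔞.isOpen_dom i).measurableSet
    fun t ht => by simp only [h _ (𝔞.mapsTo_param i ht)]

theorem BoundaryAtlas.integral_sum_smul {ι : Type*} (𝔞 : BoundaryAtlas D) (s : Finset ι)
    (c : ι → ℂ) {θ : ι → Cn n → ExtAlg n} (hθ : ∀ l ∈ s, Continuous (θ l)) :
    𝔞.integral (fun x => ∑ l ∈ s, c l • θ l x) = ∑ l ∈ s, c l * 𝔞.integral (θ l) := by
  simp only [𝔞.integral_eq_sum, Finset.mul_sum]
  rw [Finset.sum_comm]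
  refine Finset.sum_congr rfl fun i _ => ?_
  simp only [← integral_const_mul]
  rw [← integral_finsetSum _ fun l hl => (𝔞.integrable_integrand i (hθ l hl)).const_mul _]
  congr 1
  funext t
  by_cases ht : t ∈ 𝔞.dom i
  · simp only [BoundaryAtlas.integrand, indicator_of_mem ht, ← evalFormCLM_apply, map_sum,
      map_smul, smul_eq_mul, Finset.mul_sum]
    exact Finset.sum_congr rfl fun l _ => by ring
  · simp [BoundaryAtlas.integrand, indicator_of_notMem ht]

/-- Fubini's theorem for boundary integrals. -/
theorem BoundaryAtlas.integral_integral (𝔞 : BoundaryAtlas D) {f : Cn n → Cn n → ExtAlg n}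
    (hf : Continuous fun p : Cn n × Cn n => f p.1 p.2) {A : Set (Cn n)} (hA : IsCompact A)
    (h0 : ∀ z, z ∉ A → ∀ ζ, f z ζ = 0) :
    𝔞.integral (fun ζ => ∫ z, f z ζ) = ∫ z, 𝔞.integral (f z) := by
  have hint : ∀ i, Integrable (Function.uncurry fun (z : Cn n) (t : Fin (2 * n - 1) → ℝ) =>
      𝔞.integrand i (f z) t) (volume.prod volume) := by
    intro i
    obtain ⟨L, hL, hLd, hw⟩ := 𝔞.exists_compact i
    refine Continuous.integrable_of_hasCompactSupport (𝔞.continuous_integrand i hf)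
      (HasCompactSupport.intro (hA.prod hL) fun p hp => ?_)
    change 𝔞.integrand i (f p.1) p.2 = 0
    by_cases h1 : p.2 ∈ L
    · have h2 : f p.1 = 0 := funext fun ζ => h0 _ (fun h => hp ⟨h, h1⟩) ζ
      rw [h2, BoundaryAtlas.integrand]
      simp [← evalFormCLM_apply]
    · exact 𝔞.integrand_eq_zero i hw _ _ h1
  have hfi : ∀ ζ, Integrable fun z => f z ζ := fun ζ =>
    (hf.comp (continuous_id.prodMk continuous_const : Continuous fun z => (z, ζ))
      ).integrable_of_hasCompactSupport (HasCompactSupport.intro hA fun z hz => h0 z hz ζ)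
  simp only [𝔞.integral_eq_sum]
  rw [integral_finsetSum _ (f := fun i z => ∫ t, 𝔞.integrand i (f z) t)
    fun i _ => (hint i).integral_prod_left]
  refine Finset.sum_congr rfl fun i _ => ?_
  rw [integral_integral_swap (hint i)]
  congr 1
  funext t
  by_cases ht : t ∈ 𝔞.dom i
  · simp only [BoundaryAtlas.integrand, indicator_of_mem ht, ← evalFormCLM_apply]
    rw [integral_const_mul, ContinuousLinearMap.integral_comp_comm _ (hfi _)]
  · simp [BoundaryAtlas.integrand, indicator_of_notMem ht]

/-- The boundary term of Koppelman's formula: the integral of `κ ∧ α(ζ) ∧ b(z)` over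
`∂D × ℂ^n`. -/
theorem BoundaryAtlas.integral_zIntegral (𝔞 : BoundaryAtlas D) {κ : Cn (n + n) → ExtAlg (n + n)}
    (hκ : Continuous κ) {α b : Cn n → ExtAlg n} (hα : Continuous α) (hb : Continuous b)
    (hbc : HasCompactSupport b) :
    𝔞.integral (zIntegral κ α b) = integralForm univ fun z => wedge
      (𝔞.fiberIntegral (fun w => wedge (κ w) (liftZeta (α (projZeta n w)))) z) (b z) := by
  have h1 := 𝔞.integral_integral
    (f := fun z ζ => zContract (wedge (κ (Fin.append ζ z)) (liftZeta (α ζ))) (b z))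
    ((continuous_zIntegrand hκ hα hb).comp (continuous_snd.prodMk continuous_fst)) hbc
    fun z hz ζ => by rw [image_eq_zero_of_notMem_tsupport hz, zContract_zero_right]
  have h2 : 𝔞.integral (zIntegral κ α b) = (-2 * Complex.I) ^ n * 𝔞.integral (fun ζ => ∫ z,
      zContract (wedge (κ (Fin.append ζ z)) (liftZeta (α ζ))) (b z)) := by
    simp only [𝔞.integral_eq_sum, Finset.mul_sum, ← integral_const_mul]
    refine Finset.sum_congr rfl fun i _ => ?_
    congr 1
    funext t
    by_cases ht : t ∈ 𝔞.dom i
    · simp only [BoundaryAtlas.integrand, indicator_of_mem ht, ← evalFormCLM_apply, zIntegral,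
        map_smul, smul_eq_mul]
      ring
    · simp [BoundaryAtlas.integrand, indicator_of_notMem ht]
  rw [h2, h1, integralForm, Measure.restrict_univ]
  congr 2
  funext z
  simp only [zContract]
  rw [𝔞.integral_sum_smul, wedge, Finset.powerset_univ]
  · refine Finset.sum_congr rfl fun B _ => ?_
    rw [BoundaryAtlas.fiberIntegral]
    simp only [projZeta_append]
    ring
  · intro B _
    exact continuous_pi fun A => (continuous_apply _).comp (continuous_wedge
      (hκ.comp (continuous_append.comp (continuous_id.prodMk continuous_const)))
      ((liftZetaCLM n).continuous.comp hα))

end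

/-! ### The `∂̄`-operator: product rules and bounds -/

theorem dbarFun_eq_zero {χ : Cn n → ℝ} {x : Cn n} {c : ℝ} (h : χ =ᶠ[𝓝 x] fun _ => c) :
    dbarFun χ x = 0 := by
  have h0 : fderiv ℝ χ x = 0 := by
    rw [h.fderiv_eq]
    exact fderiv_const_apply c
  rw [dbarFun, h0]
  simp

theorem dbar_congr {θ θ' : Cn m → ExtAlg m} {x : Cn m} (h : θ =ᶠ[𝓝 x] θ') :
    dbar θ x = dbar θ' x := by
  simp only [dbar, h.fderiv_eq]

theorem dbar_zero (x : Cn m) : dbar (fun _ => (0 : ExtAlg m)) x = 0 := by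
  simp [dbar, wedge_zero_right]

theorem dbar_const_smul (c : ℂ) {θ : Cn m → ExtAlg m} {x : Cn m} (hθ : DifferentiableAt ℝ θ x) :
    dbar (fun y => c • θ y) x = c • dbar θ x := by
  have h : fderiv ℝ (fun y => c • θ y) x = c • fderiv ℝ θ x := (hθ.hasFDerivAt.const_smul c).fderiv
  simp only [dbar, h, smul_apply, Finset.smul_sum, ← wedge_smul_right]
  refine Finset.sum_congr rfl fun j _ => ?_
  congr 1
  module

/-- The product rule for a function and a form. -/
theorem dbar_smul {χ : Cn n → ℝ} {α : Cn n → ExtAlg n} {x : Cn n} (hχ : DifferentiableAt ℝ χ x)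
    (hα : DifferentiableAt ℝ α x) :
    dbar (fun y => χ y • α y) x = wedge (dbarFun χ x) (α x) + χ x • dbar α x := by
  have h : ∀ v, fderiv ℝ (fun y => χ y • α y) x v =
      (fderiv ℝ χ x v : ℂ) • α x + (χ x : ℂ) • fderiv ℝ α x v := by
    intro v
    rw [fderiv_fun_smul hχ hα]
    simp only [add_apply, smul_apply, ContinuousLinearMap.smulRight_apply, Complex.coe_smul]
    exact add_comm _ _
  have h2 : wedge (dbarFun χ x) (α x) = ∑ j : Fin n,
      (1 / 2 * ((fderiv ℝ χ x (Pi.single j 1) : ℂ) +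
        Complex.I * (fderiv ℝ χ x (Pi.single j Complex.I) : ℂ))) • wedge (dzbar j) (α x) := by
    rw [← wedgeBilin_apply, dbarFun, map_sum, sum_apply]
    refine Finset.sum_congr rfl fun j _ => ?_
    rw [map_smul, smul_apply, wedgeBilin_apply]
  rw [h2, ← Complex.coe_smul, dbar, dbar, Finset.smul_sum, ← Finset.sum_add_distrib]
  refine Finset.sum_congr rfl fun j _ => ?_
  rw [h, h, ← wedge_smul_right, ← wedge_smul_right, ← wedge_add_right]
  congr 1
  module

/-- The product rule for exterior products of forms in `ζ` and forms in `z`. -/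
theorem dbar_extBilin {a b : Cn n → ExtAlg n} {w : Cn (n + n)}
    (ha : DifferentiableAt ℝ a (projZeta n w)) (hb : DifferentiableAt ℝ b (projZ n w)) :
    dbar (fun w => extBilin n (a (projZeta n w)) (b (projZ n w))) w =
      extBilin n (dbar a (projZeta n w)) (b (projZ n w)) +
        extBilin n (gradeInvol (a (projZeta n w))) (dbar b (projZ n w)) := by
  have h : ∀ v, fderiv ℝ (fun w => extBilin n (a (projZeta n w)) (b (projZ n w))) w v =
      extBilin n (fderiv ℝ a (projZeta n w) (projZeta n v)) (b (projZ n w)) +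
        extBilin n (a (projZeta n w)) (fderiv ℝ b (projZ n w) (projZ n v)) := by
    intro v
    have h1 : HasFDerivAt (fun w => a (projZeta n w))
        ((fderiv ℝ a (projZeta n w)) ∘L projZeta n) w :=
      ha.hasFDerivAt.comp w (projZeta n).hasFDerivAt
    have h2 : HasFDerivAt (fun w => b (projZ n w)) ((fderiv ℝ b (projZ n w)) ∘L projZ n) w :=
      hb.hasFDerivAt.comp w (projZ n).hasFDerivAt
    have h3 : HasFDerivAt (fun w => (extBilin n).restrictScalars ℝ (a (projZeta n w)))
        (((extBilin n).restrictScalars ℝ) ∘L ((fderiv ℝ a (projZeta n w)) ∘L projZeta n)) w :=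
      ((extBilin n).restrictScalars ℝ).hasFDerivAt.comp w h1
    have h4 := ((ContinuousLinearMap.restrictScalarsL ℂ (ExtAlg n) (ExtAlg (n + n)) ℝ
      ℝ).hasFDerivAt.comp w h3).clm_apply h2
    have h5 := h4.fderiv
    change fderiv ℝ (fun w => extBilin n (a (projZeta n w)) (b (projZ n w))) w = _ at h5
    rw [DFunLike.congr_fun h5 v]
    exact add_comm (extBilin n (a (projZeta n w)) (fderiv ℝ b (projZ n w) (projZ n v)))
      (extBilin n (fderiv ℝ a (projZeta n w) (projZeta n v)) (b (projZ n w)))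
  have e1 : ∀ (j : Fin n) (c : ℂ), projZeta n (Pi.single (Fin.castAdd n j) c) = Pi.single j c := by
    intro j c
    funext i
    change (Pi.single (Fin.castAdd n j) c : Cn (n + n)) (Fin.castAdd n i) = _
    simp [Pi.single_apply]
  have e2 : ∀ (j : Fin n) (c : ℂ), projZ n (Pi.single (Fin.castAdd n j) c) = 0 := by
    intro j c
    funext i
    change (Pi.single (Fin.castAdd n j) c : Cn (n + n)) (Fin.natAdd n i) = _
    rw [Pi.single_eq_of_ne, Pi.zero_apply]
    intro h
    have := congrArg Fin.val h
    simp at this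
    omega
  have e3 : ∀ (j : Fin n) (c : ℂ), projZeta n (Pi.single (Fin.natAdd n j) c) = 0 := by
    intro j c
    funext i
    change (Pi.single (Fin.natAdd n j) c : Cn (n + n)) (Fin.castAdd n i) = _
    rw [Pi.single_eq_of_ne, Pi.zero_apply]
    intro h
    have := congrArg Fin.val h
    simp at this
    omega
  have e4 : ∀ (j : Fin n) (c : ℂ), projZ n (Pi.single (Fin.natAdd n j) c) = Pi.single j c := by
    intro j c
    funext i
    change (Pi.single (Fin.natAdd n j) c : Cn (n + n)) (Fin.natAdd n i) = _
    simp only [Pi.single_apply, Fin.natAdd_inj]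
  rw [dbar, Fin.sum_univ_add]
  simp only [h, e1, e2, e3, e4, map_zero, add_zero, zero_add, zero_apply]
  have s1 : ∀ x y : ExtAlg n, wedge (liftZeta x) (liftZ y) = extBilin n x y := fun _ _ => rfl
  have s2 : ∀ x y c : ExtAlg n, (1 / 2 : ℂ) • (extBilin n x c + Complex.I • extBilin n y c) =
      extBilin n ((1 / 2 : ℂ) • (x + Complex.I • y)) c := by
    intro x y c
    rw [map_smul, map_add, map_smul]
    rfl
  congr 1
  · rw [dbar, map_sum, sum_apply]
    refine Finset.sum_congr rfl fun j _ => ?_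
    rw [s2, dzbar_castAdd, extBilin_apply, ← wedge_assoc, ← liftZeta_wedge, s1]
  · rw [dbar, map_sum]
    refine Finset.sum_congr rfl fun j _ => ?_
    rw [← map_smul, ← map_add, ← map_smul, extBilin_apply, ← wedge_assoc]
    have h6 : wedge (dzbar (Fin.natAdd n j)) (liftZeta (a (projZeta n w))) =
        wedge (gradeInvol (liftZeta (a (projZeta n w)))) (dzbar (Fin.natAdd n j)) :=
      wedge_single_comm _ _
    rw [h6, wedge_assoc, dzbar_natAdd, ← liftZ_wedge, gradeInvol_liftZeta, s1]

theorem norm_wedge_dzbar_le (j : Fin m) : ∃ M : ℝ, 0 ≤ M ∧ ∀ a : ExtAlg m,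
    ‖wedge (dzbar j) a‖ ≤ M * ‖a‖ :=
  ⟨‖wedgeCLM (dzbar j)‖, (wedgeCLM (dzbar j)).opNorm_nonneg, (wedgeCLM (dzbar j)).le_opNorm⟩

theorem exists_norm_dbar_le (m : ℕ) : ∃ M : ℝ, 0 ≤ M ∧ ∀ (θ : Cn m → ExtAlg m) (x : Cn m),
    ‖dbar θ x‖ ≤ M * ‖fderiv ℝ θ x‖ := by
  choose M hM0 hM using norm_wedge_dzbar_le (m := m)
  refine ⟨∑ j, M j * (1 / 2 * (‖(Pi.single j 1 : Cn m)‖ + ‖(Pi.single j Complex.I : Cn m)‖)),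
    Finset.sum_nonneg fun j _ => mul_nonneg (hM0 j) (by positivity), fun θ x => ?_⟩
  rw [Finset.sum_mul]
  refine (norm_sum_le _ _).trans (Finset.sum_le_sum fun j _ => (hM j _).trans ?_)
  rw [mul_assoc]
  refine mul_le_mul_of_nonneg_left ?_ (hM0 j)
  rw [norm_smul, mul_assoc]
  have h1 := (fderiv ℝ θ x).le_opNorm (Pi.single j 1 : Cn m)
  have h2 := (fderiv ℝ θ x).le_opNorm (Pi.single j Complex.I : Cn m)
  have h3 : ‖Complex.I • fderiv ℝ θ x (Pi.single j Complex.I : Cn m)‖ =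
      ‖fderiv ℝ θ x (Pi.single j Complex.I : Cn m)‖ := by
    rw [norm_smul, Complex.norm_I, one_mul]
  have h4 : ‖(1 / 2 : ℂ)‖ = 1 / 2 := by norm_num
  rw [h4]
  refine mul_le_mul_of_nonneg_left ((norm_add_le _ _).trans ?_) (by norm_num)
  rw [h3]
  linarith

/-- A form that is smooth up to the boundary has bounded derivatives. -/
theorem exists_norm_fderiv_le {D : Set (Cn n)} (hDo : IsOpen D) (hDc : IsCompact (closure D))
    {φ : Cn n → ExtAlg n} (hφ : ContDiffOn ℝ ∞ φ (closure D)) :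
    ∃ C : ℝ, ∀ x ∈ D, ‖fderiv ℝ φ x‖ ≤ C := by
  have hloc : ∀ x ∈ closure D, ∃ t ∈ 𝓝 x, ∃ C : ℝ, ∀ y ∈ t ∩ D, ‖fderiv ℝ φ y‖ ≤ C := by
    intro x hx
    have h1 : ContDiffWithinAt ℝ (0 + 1) φ (closure D) x := (hφ x hx).of_le (by norm_cast)
    obtain ⟨u, hu, -, f', hf', hf'c⟩ := (contDiffWithinAt_succ_iff_hasFDerivWithinAt (by simp)).1 h1
    rw [insert_eq_of_mem hx] at hu
    have hxu : x ∈ u := mem_of_mem_nhdsWithin hx hu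
    obtain ⟨V, hV, hxV, hVu⟩ := mem_nhdsWithin.1 hu
    have h2 : ∀ᶠ y in 𝓝[u] x, ‖f' y‖ < ‖f' x‖ + 1 :=
      hf'c.continuousWithinAt.norm.eventually (gt_mem_nhds (lt_add_one _))
    obtain ⟨W, hW, hxW, hWu⟩ := mem_nhdsWithin.1 h2
    refine ⟨V ∩ W, (hV.inter hW).mem_nhds ⟨hxV, hxW⟩, ‖f' x‖ + 1, ?_⟩
    rintro y ⟨⟨hyV, hyW⟩, hyD⟩
    have hyu : u ∈ 𝓝 y := by
      filter_upwards [hV.mem_nhds hyV, hDo.mem_nhds hyD] with z hz1 hz2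
      exact hVu ⟨hz1, subset_closure hz2⟩
    have hyu' := mem_of_mem_nhds hyu
    rw [((hf' y hyu').hasFDerivAt hyu).fderiv]
    exact le_of_lt (hWu ⟨hyW, hyu'⟩)
  choose! t ht C hC using hloc
  obtain ⟨s, hs, hcover⟩ := hDc.elim_nhds_subcover t ht
  refine ⟨∑ x ∈ s, |C x|, fun y hy => ?_⟩
  obtain ⟨x, hxs, hxy⟩ := mem_iUnion₂.1 (hcover (subset_closure hy))
  refine (hC x (hs x hxs) y ⟨hxy, hy⟩).trans ((le_abs_self _).trans ?_)
  exact Finset.single_le_sum (f := fun x => |C x|) (fun i _ => abs_nonneg _) hxs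

theorem gradeInvol_of_isComplBidegree {p q : ℕ} {a : ExtAlg m} (ha : IsComplBidegree p q a) :
    gradeInvol a = (-1 : ℂ) ^ (p + q) • a := by
  funext S
  rw [gradeInvol_apply, Pi.smul_apply, smul_eq_mul]
  by_cases h : a S = 0
  · rw [h, mul_zero, mul_zero]
  · have h1 := ha S h
    congr 1
    have h2 : S.card + (p + q) = 2 * m := by
      have := holDeg_add_antiDeg S
      omega
    have h3 : (-1 : ℂ) ^ S.card * (-1) ^ (p + q) = 1 := by
      rw [← pow_add, h2, pow_mul]
      norm_num
    have h4 : (-1 : ℂ) ^ (p + q) * (-1) ^ (p + q) = 1 := by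
      rw [← mul_pow]
      norm_num
    linear_combination (-1 : ℂ) ^ (p + q) * h3 - (-1 : ℂ) ^ S.card * h4

/-- If the current `K` is given by a continuous form on an open set, then this form has the
bidegree of `K`. -/
theorem isBidegree_of_current {Ω : Opens (Cn m)} {K : Current Ω} {p q : ℕ}
    (hK : K.HasBidegree p q) {U : Set (Cn m)} (hU : IsOpen U) (hUΩ : U ⊆ Ω)
    {k : Cn m → ExtAlg m} (hk : ContinuousOn k U)
    (hKk : ∀ Ψ : 𝓓(Ω, ExtAlg m), tsupport Ψ ⊆ U → K Ψ = integralForm U fun w => wedge (k w) (Ψ w)) :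
    ∀ w ∈ U, IsBidegree p q (k w) := by
  intro w hw S hS
  by_contra hne
  refine hS ?_
  have hkS : ContinuousOn (fun w => k w S) U := (continuous_apply S).comp_continuousOn hk
  have h1 : ∀ᵐ x, x ∈ U → k x S = 0 := by
    refine hU.ae_eq_zero_of_integral_contDiff_smul_eq_zero
      (hkS.locallyIntegrableOn hU.measurableSet) fun g hg hgc hgU => ?_
    set E : ExtAlg m := Pi.single (Finset.univ \ S) 1 with hE
    have hts : tsupport (fun x => g x • E) ⊆ tsupport g := tsupport_smul_subset_left g _
    let Ψ : 𝓓(Ω, ExtAlg m) :=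
      { toFun := fun x => g x • E
        contDiff' := hg.smul contDiff_const
        hasCompactSupport' := hgc.smul_right
        tsupport_subset' := hts.trans (hgU.trans hUΩ) }
    have h2 : K Ψ = 0 := by
      refine hK Ψ fun x T hT1 hT2 => ?_
      change (g x • E) T = 0
      rw [Pi.smul_apply, hE, Pi.single_eq_of_ne, smul_zero]
      rintro rfl
      refine hne ?_
      have e1 := holDeg_sdiff (Finset.subset_univ S)
      have e2 := antiDeg_sdiff (Finset.subset_univ S)
      rw [holDeg_univ] at e1
      rw [antiDeg_univ] at e2
      omega
    rw [hKk Ψ (hts.trans hgU), integralForm, mul_eq_zero,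
      or_iff_right (pow_ne_zero _ (by simp))] at h2
    have h3 : ∀ x, wedge (k x) (Ψ x) Finset.univ =
        wedgeSign S (Finset.univ \ S) * (g x • k x S) := by
      intro x
      change wedge (k x) (g x • E) Finset.univ = _
      rw [wedge, Finset.powerset_univ, Finset.sum_eq_single S]
      · rw [Pi.smul_apply, hE, Pi.single_eq_same, Complex.real_smul, Complex.real_smul]
        ring
      · intro T _ hT
        rw [Pi.smul_apply, hE, Pi.single_eq_of_ne, smul_zero, mul_zero]
        intro h
        refine hT ?_
        have := congrArg (fun X => Finset.univ \ X) h
        simpa using this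
      · simp
    simp only [h3] at h2
    rw [integral_const_mul, mul_eq_zero] at h2
    have h4 : wedgeSign S (Finset.univ \ S) ≠ 0 := by
      intro h
      have := wedgeSign_mul_self S (Finset.univ \ S)
      rw [h, mul_zero] at this
      exact zero_ne_one this
    rw [← setIntegral_eq_integral_of_forall_compl_eq_zero (s := U)]
    · exact h2.resolve_left h4
    · intro x hx
      rw [image_eq_zero_of_notMem_tsupport fun h => hx (hgU h), zero_smul]
  have h2 : (fun w => k w S) =ᵐ[volume.restrict U] fun _ => 0 :=
    (ae_restrict_iff' hU.measurableSet).2 h1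
  exact Measure.eqOn_open_of_ae_eq h2 hU hkS continuousOn_const hw

/-! ### Koppelman's formula for cut-off forms -/

theorem integralForm_univ_eq {A : Set (Cn m)} {θ : Cn m → ExtAlg m} (h : ∀ x ∉ A, θ x = 0) :
    integralForm univ θ = integralForm A θ := by
  rw [integralForm, integralForm, Measure.restrict_univ,
    setIntegral_eq_integral_of_forall_compl_eq_zero]
  intro x hx
  rw [h x hx]
  rfl

theorem integralForm_congr {A : Set (Cn m)} (hA : MeasurableSet A) {θ θ' : Cn m → ExtAlg m}
    (h : ∀ x ∈ A, θ x = θ' x) : integralForm A θ = integralForm A θ' := by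
  rw [integralForm, integralForm]
  congr 1
  exact setIntegral_congr_fun hA fun x hx => by simp only [h x hx]

theorem gradeInvol_extBilin (a b : ExtAlg n) :
    gradeInvol (extBilin n a b) = extBilin n (gradeInvol a) (gradeInvol b) := by
  rw [extBilin_apply, extBilin_apply, gradeInvol_wedge, gradeInvol_liftZeta, gradeInvol_liftZ]

/-- As `a(ζ)` has bidegree `(p, q)` and `ψ(z)` the complementary one, their signs cancel in the term
with `∂̄a`. -/
theorem dbar_gradeInvol_extBilin {p q : ℕ} {a ψ : Cn n → ExtAlg n} (hda : Differentiable ℝ a)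
    (hdψ : Differentiable ℝ ψ) (ha : ∀ x, IsBidegree p q (a x))
    (hψ : ∀ z, IsComplBidegree p q (ψ z)) (w : Cn (n + n)) :
    dbar (fun w => gradeInvol (extBilin n (a (projZeta n w)) (ψ (projZ n w)))) w =
      extBilin n (dbar a (projZeta n w)) (ψ (projZ n w)) +
        extBilin n (a (projZeta n w)) (dbar (fun z => gradeInvol (ψ z)) (projZ n w)) := by
  have h3 : ∀ x, DifferentiableAt ℝ (fun x => gradeInvol (a x)) x := fun x =>
    (gradeInvol.restrictScalars ℝ).differentiableAt.comp x (hda x)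
  have h4 : ∀ x, DifferentiableAt ℝ (fun x => gradeInvol (ψ x)) x := fun x =>
    (gradeInvol.restrictScalars ℝ).differentiableAt.comp x (hdψ x)
  have h5 : ((-1 : ℂ) ^ (p + q)) * (-1) ^ (p + q) = 1 := by
    rw [← mul_pow]
    norm_num
  have h6 : (fun x => gradeInvol (a x)) = fun x => (-1 : ℂ) ^ (p + q) • a x :=
    funext fun x => gradeInvol_of_isBidegree (ha x)
  simp only [gradeInvol_extBilin]
  rw [dbar_extBilin (a := fun x => gradeInvol (a x)) (b := fun x => gradeInvol (ψ x))
    (h3 _) (h4 _), gradeInvol_gradeInvol, h6, dbar_const_smul _ (hda _), gradeInvol_of_isComplBidegree (hψ _), map_smul, map_smul,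
    smul_apply, smul_smul, h5, one_smul]

/-- `∂̄K` on exterior products of test forms. The sign in the definition of `∂̄K` cancels against the
degree of `a(ζ) ∧ ψ(z)`. -/
theorem dbar_monoCLM_extProd {Ω D : Opens (Cn n)} (hDΩ : (D : Set (Cn n)) ⊆ Ω) {p q : ℕ}
    (K : Current (prodOpens Ω Ω)) {a ψ : 𝓓(D, ExtAlg n)} (ha : ∀ x, IsBidegree p q (a x))
    (hψ : ∀ z, IsComplBidegree p q (ψ z)) :
    K.dbar (TestFunction.monoCLM ℂ (extProd a ψ)) =
      K (TestFunction.monoCLM ℂ (extProd (dbarTest a) ψ)) +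
        K (TestFunction.monoCLM ℂ
          (extProd a (dbarTest (TestFunction.postcompCLM gradeInvol ψ)))) := by
  have h1 : ⇑(TestFunction.postcompCLM gradeInvol
      (TestFunction.monoCLM ℂ (extProd a ψ) : 𝓓(prodOpens Ω Ω, ExtAlg (n + n))) :
        𝓓(prodOpens Ω Ω, ExtAlg (n + n))) =
      fun w => gradeInvol (extBilin n (a (projZeta n w)) (ψ (projZ n w))) := by
    funext w
    change gradeInvol ((TestFunction.monoCLM ℂ (extProd a ψ) :
      𝓓(prodOpens Ω Ω, ExtAlg (n + n))) w) = _
    rw [coe_monoCLM_extProd hDΩ, extProd_apply]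
  have h2 : dbarTest (TestFunction.postcompCLM gradeInvol (TestFunction.monoCLM ℂ (extProd a ψ))) =
      (TestFunction.monoCLM ℂ (extProd (dbarTest a) ψ) : 𝓓(prodOpens Ω Ω, ExtAlg (n + n))) +
        TestFunction.monoCLM ℂ
          (extProd a (dbarTest (TestFunction.postcompCLM gradeInvol ψ))) := by
    refine TestFunction.ext fun w => ?_
    rw [dbarTest_apply, h1, dbar_gradeInvol_extBilin (a.contDiff.differentiable (by simp))
      (ψ.contDiff.differentiable (by simp)) ha hψ]
    rw [add_apply, coe_monoCLM_extProd hDΩ, coe_monoCLM_extProd hDΩ, extProd_apply, extProd_apply,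
      dbarTest_apply, dbarTest_apply]
    rfl
  have h3 := congrArg K h2
  rw [map_add] at h3
  exact h3
/-- The two derivatives `∂̄(χα)` and `χ ∂̄α` differ by `∂̄χ ∧ α`. -/
theorem dbarTest_cutoff_sub {D : Opens (Cn n)} (χ : 𝓓(D, ℝ)) {α α' : Cn n → ExtAlg n}
    (hα : ContDiffOn ℝ ∞ α (D : Set (Cn n))) (hα' : ∀ x ∈ D, α' x = α x) (x : Cn n) :
    (dbarTest (cutoff χ α hα) - cutoff χ (dbar α) (contDiffOn_dbar D.isOpen hα)) x =
      wedge (dbarFun χ x) (α' x) := by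
  rw [sub_apply, dbarTest_apply, cutoff_apply]
  have h1 : ⇑(cutoff χ α hα) = fun y => χ y • α y := rfl
  rw [h1]
  by_cases hx : x ∈ D
  · rw [dbar_smul (χ.contDiff.differentiable (by simp) x)
      ((hα.contDiffAt (D.isOpen.mem_nhds hx)).differentiableAt (by simp)), hα' x hx]
    exact add_sub_cancel_right _ _
  · have h2 : χ =ᶠ[𝓝 x] fun _ => (0 : ℝ) :=
      notMem_tsupport_iff_eventuallyEq.1 fun h => hx (χ.tsupport_subset h)
    rw [dbarFun_eq_zero h2, wedge_zero_left, h2.self_of_nhds, zero_smul, sub_zero,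
      ← dbar_zero (m := n) x]
    refine dbar_congr ?_
    filter_upwards [h2] with y hy
    rw [hy, zero_smul]

/-- The current of integration over the diagonal, on `χ φ(ζ) ∧ ψ(z)`. -/
theorem diagCurrent_monoCLM_extProd {Ω D : Opens (Cn n)} (hDΩ : (D : Set (Cn n)) ⊆ Ω)
    (χ : 𝓓(D, ℝ)) {φ : Cn n → ExtAlg n} (hφ : ContDiffOn ℝ ∞ φ (D : Set (Cn n)))
    (ψ : 𝓓(D, ExtAlg n)) (hχ : ∀ x ∈ tsupport ψ, χ x = 1) :
    diagCurrent Ω (TestFunction.monoCLM ℂ (extProd (cutoff χ φ hφ) ψ)) =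
      integralForm (D : Set (Cn n)) fun z => wedge (φ z) (ψ z) := by
  have h1 : ∀ z, pullDiag ((TestFunction.monoCLM ℂ (extProd (cutoff χ φ hφ) ψ) :
      𝓓(prodOpens Ω Ω, ExtAlg (n + n))) (Fin.append z z)) = wedge (φ z) (ψ z) := by
    intro z
    rw [coe_monoCLM_extProd hDΩ, extProd_apply, projZeta_append, projZ_append, extBilin_apply,
      pullDiag_wedge, cutoff_apply]
    by_cases hz : z ∈ tsupport ψ
    · rw [hχ z hz, one_smul]
    · rw [image_eq_zero_of_notMem_tsupport hz, wedge_zero_right, wedge_zero_right]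
  have h0 : ∀ A : Set (Cn n), (D : Set (Cn n)) ⊆ A → ∀ z ∉ A, wedge (φ z) (ψ z) = 0 := by
    intro A hA z hz
    rw [image_eq_zero_of_notMem_tsupport fun h => hz (hA (ψ.tsupport_subset h)), wedge_zero_right]
  rw [diagCurrent]
  simp only [h1]
  rw [← integralForm_univ_eq (h0 _ hDΩ), ← integralForm_univ_eq (h0 _ subset_rfl)]

theorem exists_norm_le_of_continuousOn {D : Set (Cn n)} (hDc : IsCompact (closure D))
    {φ : Cn n → ExtAlg n} (hφ : ContinuousOn φ (closure D)) :
    ∃ C : ℝ, 0 ≤ C ∧ ∀ x ∈ D, ‖φ x‖ ≤ C := by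
  obtain ⟨C, hC⟩ := hDc.exists_bound_of_continuousOn hφ
  exact ⟨max C 0, le_max_right _ _, fun x hx =>
    (hC x (subset_closure hx)).trans (le_max_left _ _)⟩

theorem exists_norm_testFunction_le {D : Opens (Cn n)} (ψ : 𝓓(D, ExtAlg n)) :
    ∃ C : ℝ, ∀ x, ‖ψ x‖ ≤ C :=
  ψ.contDiff.continuous.bounded_above_of_compact_support ψ.hasCompactSupport

/-- The limit of the terms with the smooth kernel `P`. -/
theorem tendsto_integralForm_extProd {Ω D : Opens (Cn n)}
    (hDc : IsCompact (closure (D : Set (Cn n)))) (hDΩ : closure (D : Set (Cn n)) ⊆ Ω)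
    {P : Cn (n + n) → ExtAlg (n + n)} (hP : ContinuousOn P (prodOpens Ω Ω : Set (Cn (n + n))))
    {χ : ℕ → 𝓓(D, ℝ)} (hχ : IsExhausting χ) {φ : Cn n → ExtAlg n}
    (hφ : ContDiffOn ℝ ∞ φ (D : Set (Cn n))) {C : ℝ} (hC0 : 0 ≤ C) (hC : ∀ x ∈ D, ‖φ x‖ ≤ C)
    (ψ : 𝓓(D, ExtAlg n)) :
    Tendsto (fun j => integralForm (prodOpens Ω Ω : Set (Cn (n + n))) fun w => wedge (P w)
      ((TestFunction.monoCLM ℂ (extProd (cutoff (χ j) φ hφ) ψ) :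
        𝓓(prodOpens Ω Ω, ExtAlg (n + n))) w)) atTop
      (𝓝 (integralForm (D : Set (Cn n)) fun z => wedge
        (fiberIntegralForm (D : Set (Cn n)) (fun w => wedge (P w)
          (liftZeta (φ (projZeta n w)))) z) (ψ z))) := by
  have hDΩ' : (D : Set (Cn n)) ⊆ Ω := subset_closure.trans hDΩ
  -- a continuous cut-off `ρ` makes the kernel continuous on the whole space
  set A := (fun x : Cn n × Cn n => (Fin.append x.1 x.2 : Cn (n + n))) ''
    (closure (D : Set (Cn n)) ×ˢ tsupport ψ)
  have hA : IsCompact A := isCompact_append hDc ψ.hasCompactSupport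
  have hAΩ : A ⊆ (prodOpens Ω Ω : Set (Cn (n + n))) := by
    rintro _ ⟨x, hx, rfl⟩
    refine ⟨?_, ?_⟩
    · simp only [Fin.append_left]
      exact hDΩ hx.1
    · simp only [Fin.append_right]
      exact hDΩ' (ψ.tsupport_subset hx.2)
  obtain ⟨U₁, hU₁, hAU₁, hU₁U, hU₁c⟩ :=
    exists_open_between_and_isCompact_closure hA (prodOpens Ω Ω).isOpen hAΩ
  obtain ⟨ρ, hρ1, hρA, -⟩ := exists_tsupport_one_of_isOpen_isClosed hU₁ hU₁c hA.isClosed hAU₁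
  have hρc : HasCompactSupport ρ :=
    hU₁c.of_isClosed_subset (isClosed_tsupport _) (hρ1.trans subset_closure)
  set κ := fun w => ρ w • P w with hκdef
  have hκ : Continuous κ := continuous_smul_of_tsupport_subset (prodOpens Ω Ω).isOpen ρ.continuous
    (hρ1.trans (subset_closure.trans hU₁U)) hP
  have hκc : HasCompactSupport κ := hρc.smul_right
  have hκP : ∀ ζ ∈ D, ∀ z ∈ tsupport ψ, κ (Fin.append ζ z) = P (Fin.append ζ z) := by
    intro ζ hζ z hz
    have : ρ (Fin.append ζ z) = 1 := hρA ⟨(ζ, z), ⟨subset_closure hζ, hz⟩, rfl⟩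
    rw [hκdef]
    change ρ (Fin.append ζ z) • P (Fin.append ζ z) = _
    rw [this, one_smul]
  have hmeas : Measurable ((D : Set (Cn n)).indicator φ) :=
    measurable_indicator_of_continuousOn D.isOpen hφ.continuousOn
  have hbd : ∀ x, ‖(D : Set (Cn n)).indicator φ x‖ ≤ C := by
    intro x
    by_cases hx : x ∈ (D : Set (Cn n))
    · rw [indicator_of_mem hx]
      exact hC x hx
    · rw [indicator_of_notMem hx, norm_zero]
      exact hC0
  obtain ⟨C', hC'⟩ := exists_norm_testFunction_le ψ
  have hlim := tendsto_kernelFunctional hκ hκc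
    (α := fun j x => χ j x • (D : Set (Cn n)).indicator φ x)
    (fun j => ((χ j).contDiff.continuous.measurable).smul hmeas) (C := C) (fun j x => by
      rw [norm_smul, Real.norm_of_nonneg (hχ.mem_Icc j x).1]
      exact (mul_le_of_le_one_left (norm_nonneg _) (hχ.mem_Icc j x).2).trans (hbd x))
    (hχ.tendsto_smul φ) ψ.contDiff.continuous hC'
  have hleft : ∀ j, kernelFunctional κ (fun x => χ j x • (D : Set (Cn n)).indicator φ x) ψ =
      integralForm (prodOpens Ω Ω : Set (Cn (n + n))) fun w => wedge (P w)
        ((TestFunction.monoCLM ℂ (extProd (cutoff (χ j) φ hφ) ψ) :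
          𝓓(prodOpens Ω Ω, ExtAlg (n + n))) w) := by
    intro j
    rw [← integralForm_univ_eq, kernelFunctional]
    · congr 1
      funext w
      rw [coe_monoCLM_extProd hDΩ', extProd_apply, cutoff_eq_smul_indicator]
      by_cases hw : projZeta n w ∈ D ∧ projZ n w ∈ tsupport ψ
      · have := hκP _ hw.1 _ hw.2
        rw [append_projZeta_projZ] at this
        rw [this]
      · have h0 : extBilin n (χ j (projZeta n w) • (D : Set (Cn n)).indicator φ (projZeta n w))
            (ψ (projZ n w)) = 0 := by
          by_cases h : projZeta n w ∈ (D : Set (Cn n))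
          · rw [image_eq_zero_of_notMem_tsupport fun h' => hw ⟨h, h'⟩, map_zero]
          · rw [indicator_of_notMem h, smul_zero, map_zero, zero_apply]
        rw [h0, wedge_zero_right, wedge_zero_right]
    · intro w hw
      rw [image_eq_zero_of_notMem_tsupport fun h => hw (TestFunction.tsupport_subset _ h),
        wedge_zero_right]
  simp only [← hleft]
  convert hlim using 2
  rw [kernelFunctional_eq_integral_fiber hκ hκc hmeas hbd ψ.contDiff.continuous hC',
    integralForm_univ_eq (A := (D : Set (Cn n)))]
  · refine integralForm_congr D.isOpen.measurableSet fun z _ => ?_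
    by_cases hz : z ∈ tsupport ψ
    · congr 1
      funext B
      rw [fiberIntegralForm, fiberIntegralForm, integralForm_univ_eq (A := (D : Set (Cn n)))]
      · refine integralForm_congr D.isOpen.measurableSet fun ζ hζ => ?_
        rw [projZeta_append, hκP ζ hζ z hz, indicator_of_mem hζ]
      · intro ζ hζ
        rw [projZeta_append, indicator_of_notMem hζ, liftZeta_zero, wedge_zero_right]
        rfl
    · rw [image_eq_zero_of_notMem_tsupport hz, wedge_zero_right, wedge_zero_right]
  · intro z hz
    rw [image_eq_zero_of_notMem_tsupport fun h => hz (ψ.tsupport_subset h), wedge_zero_right]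

/-! ### The boundary integral -/

theorem isBidegree_integral {p q : ℕ} {f : Cn n → ExtAlg m} (h : ∀ z, IsBidegree p q (f z)) :
    IsBidegree p q (∫ z, f z) := by
  intro S hS
  by_cases hf : Integrable f
  · have h1 : (∫ z, f z) S = ∫ z, f z S :=
      ((ContinuousLinearMap.proj (R := ℝ) (φ := fun _ : Finset (Idx m) => ℂ) S).integral_comp_comm
        hf).symm
    rw [h1] at hS
    obtain ⟨z, hz⟩ : ∃ z, f z S ≠ 0 := by
      by_contra! h0
      simp [h0] at hS
    exact h z S hz
  · rw [integral_undef hf] at hS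
    exact absurd rfl hS

theorem IsBidegree.smul_real {p q : ℕ} {a : ExtAlg m} (r : ℝ) (h : r ≠ 0 → IsBidegree p q a) :
    IsBidegree p q (r • a) := by
  intro S hS
  rw [Pi.smul_apply] at hS
  exact h (left_ne_zero_of_smul hS) S (right_ne_zero_of_smul hS)

theorem dbarFun_eq_zero_of_notMem {D : Opens (Cn n)} (χ : 𝓓(D, ℝ)) {x : Cn n} (hx : x ∉ D) :
    dbarFun χ x = 0 :=
  dbarFun_eq_zero (notMem_tsupport_iff_eventuallyEq.1 fun h => hx (χ.tsupport_subset h))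

theorem exists_continuous_extension {A : Set (Cn n)} (hA : IsClosed A) {φ : Cn n → ExtAlg n}
    (hφ : ContinuousOn φ A) : ∃ φ' : Cn n → ExtAlg n, Continuous φ' ∧ ∀ x ∈ A, φ' x = φ x := by
  obtain ⟨g, hg⟩ := ContinuousMap.exists_restrict_eq hA
    ⟨A.domRestrict φ, continuousOn_iff_continuous_domRestrict.1 hφ⟩
  exact ⟨g, g.continuous, fun x hx => DFunLike.congr_fun hg ⟨x, hx⟩⟩

theorem isBidegree_zIntegral {p q : ℕ} {κ : Cn (n + n) → ExtAlg (n + n)} {α b : Cn n → ExtAlg n}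
    (hκ : ∀ w, IsBidegree n (n - 1) (κ w)) {ζ : Cn n} (hα : IsBidegree p q (α ζ))
    (hb : ∀ z, IsComplBidegree p q (b z)) : IsBidegree n (n - 1) (zIntegral κ α b ζ) := by
  intro S hS
  rw [zIntegral, Pi.smul_apply] at hS
  exact isBidegree_integral (fun z => isBidegree_zContract (hκ _) hα (hb z)) S
    (right_ne_zero_of_smul hS)

/-- Off the support of `φ` the coefficients of `φ` vanish, also at boundary points. -/
theorem eq_zero_of_notMem_closure {D : Set (Cn n)} {φ : Cn n → ExtAlg n}
    (hφ : ContinuousOn φ (closure D)) {ζ : Cn n} (hζ : ζ ∈ closure D)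
    (hζF : ζ ∉ closure {x ∈ D | φ x ≠ 0}) : φ ζ = 0 := by
  obtain ⟨φ', hφ'c, hφ'⟩ := exists_continuous_extension isClosed_closure hφ
  have h1 : ζ ∈ closure ((closure {x ∈ D | φ x ≠ 0})ᶜ ∩ D) :=
    isClosed_closure.isOpen_compl.inter_closure ⟨hζF, hζ⟩
  rw [← hφ' ζ hζ]
  have h2 : (closure {x ∈ D | φ x ≠ 0})ᶜ ∩ D ⊆ {x | φ' x = 0} := by
    rintro x ⟨hxF, hx⟩
    by_contra hne
    refine hxF (subset_closure ⟨hx, ?_⟩)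
    rw [← hφ' x (subset_closure hx)]
    exact hne
  exact closure_minimal h2 (isClosed_eq hφ'c continuous_const) h1

/-- As the cut-off functions increase to the indicator function of `D`, the terms with `∂̄χ_j ∧ φ`
tend to the boundary integral. -/
theorem tendsto_dbarFun_term (hn : 0 < n) {Ω D : Opens (Cn n)} {p q : ℕ}
    (hDc : IsCompact (closure (D : Set (Cn n)))) (hDΩ : (D : Set (Cn n)) ⊆ Ω)
    (𝔞 : BoundaryAtlas (D : Set (Cn n)))
    {φ : Cn n → ExtAlg n} (hφ : ContDiffOn ℝ ∞ φ (closure (D : Set (Cn n))))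
    (hφpq : ∀ x ∈ closure (D : Set (Cn n)), IsBidegree p q (φ x))
    {K : Current (prodOpens Ω Ω)} (hK : K.HasBidegree n (n - 1))
    {U : Set (Cn (n + n))} (hU : IsOpen U) (hUΩ : U ⊆ (prodOpens Ω Ω : Set (Cn (n + n))))
    (hUD : ∀ ζ ∈ frontier (D : Set (Cn n)) ∩ closure {x ∈ (D : Set (Cn n)) | φ x ≠ 0},
      ∀ z ∈ D, (Fin.append ζ z : Cn (n + n)) ∈ U)
    {k : Cn (n + n) → ExtAlg (n + n)} (hk : ContinuousOn k U)
    (hKk : ∀ Ψ : 𝓓(prodOpens Ω Ω, ExtAlg (n + n)), tsupport Ψ ⊆ U →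
      K Ψ = integralForm U fun w => wedge (k w) (Ψ w))
    {χ : ℕ → 𝓓(D, ℝ)} (hχ : IsExhausting χ)
    (hχlim : ∀ Θ : Cn n → ExtAlg n, Continuous Θ →
      (∀ x ∈ frontier (D : Set (Cn n)), IsBidegree n (n - 1) (Θ x)) →
      Tendsto (fun j => integralForm univ fun x => wedge (dbarFun (χ j) x) (Θ x)) atTop
        (𝓝 (-𝔞.integral Θ)))
    (ψ : 𝓓(D, ExtAlg n)) (hψ : ∀ z, IsComplBidegree p q (ψ z)) :
    Tendsto (fun j => K (TestFunction.monoCLM ℂ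
      (extProd (dbarTest (cutoff (χ j) φ (hφ.mono subset_closure)) -
        cutoff (χ j) (dbar φ) (contDiffOn_dbar D.isOpen (hφ.mono subset_closure))) ψ))) atTop
      (𝓝 (integralForm (D : Set (Cn n)) fun z => wedge
        (𝔞.fiberIntegral (fun w => wedge (k w) (liftZeta (φ (projZeta n w)))) z) (ψ z))) := by
  set F := closure {x ∈ (D : Set (Cn n)) | φ x ≠ 0}
  obtain ⟨ξ, hξc, hξU, hκ, hξ1, M, hMc, hMD, hM⟩ := exists_localKernel hDΩ hDc K hU hk hKk
    isClosed_closure hUD ψ.hasCompactSupport ψ.tsupport_subset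
  set κ : Cn (n + n) → ExtAlg (n + n) := fun w => ξ w • k w with hκdef
  have hκc : HasCompactSupport κ := hξc.smul_right
  have hκpq : ∀ w, IsBidegree n (n - 1) (κ w) := fun w =>
    IsBidegree.smul_real _ fun h =>
      isBidegree_of_current hK hU hUΩ hk hKk w (hξU (subset_tsupport _ h))
  have hκd : ∀ w, gradeInvol (κ w) = -κ w := by
    intro w
    -- here `n > 0` matters, as `n - 1` is truncated
    have hodd : Odd (n + (n - 1)) := ⟨n - 1, by omega⟩
    rw [gradeInvol_of_isBidegree (hκpq w), hodd.neg_one_pow, neg_one_smul]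
  -- the limit of the `∂̄χ_j` is only known for continuous forms on the whole space
  obtain ⟨φ', hφ'c, hφ'⟩ := exists_continuous_extension isClosed_closure hφ.continuousOn
  have hφD : ∀ x ∈ D, φ' x = φ x := fun x hx => hφ' x (subset_closure hx)
  have hφ'pq : ∀ x ∈ closure (D : Set (Cn n)), IsBidegree p q (φ' x) := fun x hx => by
    rw [hφ' x hx]
    exact hφpq x hx
  have hψc := ψ.contDiff.continuous
  have hlim := (hχlim (zIntegral κ φ' ψ) (continuous_zIntegral hκ hφ'c hψc ψ.hasCompactSupport)
    fun x hx => isBidegree_zIntegral hκpq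
      (hφ'pq x (frontier_subset_closure hx)) hψ).neg
  rw [neg_neg, 𝔞.integral_zIntegral hκ hφ'c hψc ψ.hasCompactSupport] at hlim
  have hval : (integralForm univ fun z => wedge
      (𝔞.fiberIntegral (fun w => wedge (κ w) (liftZeta (φ' (projZeta n w)))) z) (ψ z)) =
      integralForm (D : Set (Cn n)) fun z => wedge
        (𝔞.fiberIntegral (fun w => wedge (k w) (liftZeta (φ (projZeta n w)))) z) (ψ z) := by
    rw [integralForm_univ_eq (A := (D : Set (Cn n)))]
    · refine integralForm_congr D.isOpen.measurableSet fun z _ => ?_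
      by_cases hz : z ∈ tsupport ψ
      · congr 1
        funext B
        refine 𝔞.integral_congr fun ζ hζ => ?_
        simp only [projZeta_append, hφ' ζ (frontier_subset_closure hζ)]
        by_cases hζF : ζ ∈ F
        · rw [hκdef]
          simp only [hξ1 ζ ⟨hζ, hζF⟩ z hz, one_smul]
        · rw [eq_zero_of_notMem_closure hφ.continuousOn (frontier_subset_closure hζ) hζF,
            liftZeta_zero, wedge_zero_right, wedge_zero_right]
      · rw [image_eq_zero_of_notMem_tsupport hz, wedge_zero_right, wedge_zero_right]
    · intro z hz
      rw [image_eq_zero_of_notMem_tsupport fun h => hz (ψ.tsupport_subset h), wedge_zero_right]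
  rw [hval] at hlim
  refine hlim.congr' ?_
  -- once `χ_j = 1` near `M`, the form `∂̄χ_j ∧ φ` vanishes on `M`, and `K` is given by `κ`
  obtain ⟨M', hM'c, hMM', hM'D⟩ := exists_compact_between hMc D.isOpen hMD
  filter_upwards [hχ.eventually_one M' hM'c hM'D] with j hj
  rw [← kernelFunctional_dbarFun hκ hκc hκd (χ j).contDiff (χ j).hasCompactSupport hφ'c hψc
    ψ.hasCompactSupport]
  rw [hM _ ψ (fun x hx => ?_) (fun x hx => ?_) subset_rfl, kernelFunctional]
  · refine congrArg (integralForm univ) (funext fun w => ?_)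
    rw [extProd_apply, dbarTest_cutoff_sub _ _ hφD]
  · rw [dbarTest_cutoff_sub _ _ hφD] at hx
    have hxD : x ∈ D := by
      by_contra h
      rw [dbarFun_eq_zero_of_notMem _ h, wedge_zero_left] at hx
      exact hx rfl
    refine subset_closure ⟨hxD, fun h => hx ?_⟩
    rw [hφD x hxD, h, wedge_zero_right]
  · rw [dbarTest_cutoff_sub _ _ hφD, dbarFun_eq_zero (c := 1), wedge_zero_left]
    filter_upwards [mem_interior_iff_mem_nhds.1 (hMM' hx)] with y hy
    exact hj y hy

end Koppelman

end

theorem mainTheorem6 (n p q : ℕ) (hn : 0 < n) (Ω D : Opens (Cn n))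
    (hDc : IsCompact (closure (D : Set (Cn n))))
    (hDΩ : closure (D : Set (Cn n)) ⊆ (Ω : Set (Cn n)))
    (hD : HasC1Boundary (D : Set (Cn n))) (𝔞 : BoundaryAtlas (D : Set (Cn n)))
    (φ : Cn n → ExtAlg n) (hφ : ContDiffOn ℝ ∞ φ (closure (D : Set (Cn n))))
    (hφpq : ∀ x ∈ closure (D : Set (Cn n)), IsBidegree p q (φ x))
    (K : Current (prodOpens Ω Ω)) (hK : K.HasBidegree n (n - 1))
    (P : Cn (n + n) → ExtAlg (n + n))
    (hP : ContDiffOn ℝ ∞ P (prodOpens Ω Ω : Set (Cn (n + n))))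
    (hPnn : ∀ w ∈ prodOpens Ω Ω, IsBidegree n n (P w))
    (hKP : ∀ Ψ : 𝓓(prodOpens Ω Ω, ExtAlg (n + n)), K.dbar Ψ = diagCurrent Ω Ψ -
      integralForm (prodOpens Ω Ω : Set (Cn (n + n))) fun w => wedge (P w) (Ψ w))
    (U : Set (Cn (n + n))) (hU : IsOpen U)
    (hUΩ : U ⊆ (prodOpens Ω Ω : Set (Cn (n + n))))
    (hUD : ∀ ζ ∈ frontier (D : Set (Cn n)) ∩ closure {x ∈ (D : Set (Cn n)) | φ x ≠ 0},
      ∀ z ∈ D, (Fin.append ζ z : Cn (n + n)) ∈ U)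
    (k : Cn (n + n) → ExtAlg (n + n)) (hk : ContinuousOn k U)
    (hKk : ∀ Ψ : 𝓓(prodOpens Ω Ω, ExtAlg (n + n)), tsupport Ψ ⊆ U →
      K Ψ = integralForm U fun w => wedge (k w) (Ψ w)) :
    ∃ T S : Current D,
      IsFiberIntegral K φ (hφ.mono subset_closure) T ∧
      IsFiberIntegral K (dbar φ) (contDiffOn_dbar D.isOpen (hφ.mono subset_closure)) S ∧
      ∀ ψ : 𝓓(D, ExtAlg n), (∀ z, IsComplBidegree p q (ψ z)) →
        integralForm (D : Set (Cn n)) (fun z => wedge (φ z) (ψ z)) =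
          integralForm (D : Set (Cn n)) (fun z => wedge
            (𝔞.fiberIntegral (fun w => wedge (k w)
              (liftZeta (φ fun i => w (Fin.castAdd n i)))) z) (ψ z)) +
          S ψ + T.dbar ψ +
          integralForm (D : Set (Cn n)) (fun z => wedge
            (fiberIntegralForm (D : Set (Cn n)) (fun w => wedge (P w)
              (liftZeta (φ fun i => w (Fin.castAdd n i)))) z) (ψ z)) := by
  have hDΩ' : (D : Set (Cn n)) ⊆ Ω := subset_closure.trans hDΩ
  have hφD : ContDiffOn ℝ ∞ φ (D : Set (Cn n)) := hφ.mono subset_closure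
  obtain ⟨χ, hχ, hχlim⟩ := exists_isExhausting_tendsto_integral hn D hDc hD 𝔞
  obtain ⟨C, hC0, hC⟩ := exists_norm_le_of_continuousOn hDc hφ.continuousOn
  obtain ⟨C₁, hC₁⟩ := exists_norm_fderiv_le D.isOpen hDc hφ
  obtain ⟨M, hM0, hM⟩ := exists_norm_dbar_le n
  obtain ⟨T, hT⟩ := exists_isFiberIntegral hDΩ' hDc K hU hk hKk isClosed_closure hUD hχ hφD hC
    fun x hx h => subset_closure ⟨hx, h⟩
  obtain ⟨S, hS⟩ := exists_isFiberIntegral hDΩ' hDc K hU hk hKk isClosed_closure hUD hχ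
    (contDiffOn_dbar D.isOpen hφD) (C := M * C₁)
    (fun x hx => (hM φ x).trans (mul_le_mul_of_nonneg_left (hC₁ x hx) hM0)) fun x hx h => by
      by_contra hxF
      refine h ?_
      rw [← dbar_zero (m := n) x]
      refine dbar_congr ?_
      filter_upwards [D.isOpen.mem_nhds hx, isClosed_closure.isOpen_compl.mem_nhds hxF] with y hy hyF
      by_contra hne
      exact hyF (subset_closure ⟨hy, hne⟩)
  refine ⟨T, S, hT, hS, fun ψ hψ => ?_⟩
  have hPlim := tendsto_integralForm_extProd hDc hDΩ hP.continuousOn hχ hφD hC0 hC ψ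
  have hbd := tendsto_dbarFun_term hn hDc hDΩ' 𝔞 hφ hφpq hK hU hUΩ hUD hk hKk hχ hχlim ψ hψ
  have hTlim := hT χ hχ (dbarTest (TestFunction.postcompCLM gradeInvol ψ))
  -- the left hand side is the limit of a sequence that is eventually constant
  have hΔ : Tendsto (fun j => diagCurrent Ω (TestFunction.monoCLM ℂ
      (extProd (cutoff (χ j) φ hφD) ψ))) atTop
      (𝓝 (integralForm (D : Set (Cn n)) fun z => wedge (φ z) (ψ z))) := by
    refine tendsto_const_nhds.congr' ?_
    filter_upwards [hχ.eventually_one _ ψ.hasCompactSupport ψ.tsupport_subset] with j hj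
    exact (diagCurrent_monoCLM_extProd hDΩ' (χ j) hφD ψ hj).symm
  refine tendsto_nhds_unique hΔ ((((hbd.add (hS χ hχ ψ)).add hTlim).add hPlim).congr fun j => ?_)
  have h1 := hKP (TestFunction.monoCLM ℂ (extProd (cutoff (χ j) φ hφD) ψ))
  rw [dbar_monoCLM_extProd hDΩ' K (fun x => ?_) hψ] at h1
  · rw [extProd_sub_left, map_sub, map_sub, sub_add_cancel]
    rw [h1, sub_add_cancel]
  · refine IsBidegree.smul_real _ fun h => hφpq x (subset_closure ?_)
    exact (χ j).tsupport_subset (subset_tsupport _ h)
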